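/- **Conventions.** A decision problem $A$ consists of instances, each with a size $s\in\mathbb N$ and an encoding as a list of integers, and a set of yes-instances. Algorithms are RAM programs performing standard arithmetic on $O(\log s)$-bit integers in unit time on inputs of size $s$ (operations on longer integers are charged according to the number of machine words). A family $\mathcal Q=\{Q_n\}_{n\in\mathbb N}$ of polynomials over $\mathbb Z$, with $Q_n$ in $n$ variables, is *explicit* if for some constant $\Delta$ all $Q_n$ have degree at most $\Delta$, their coefficients have absolute value $O(n^\Delta)$, and all coefficients of $Q_n$ can be computed from $n$ in time $O(n^\Delta)$. $\mathrm{POTIME}[t,\mathcal Q]$ is the class of problems solvable in time $O(t(s))$ by a deterministic algorithm with oracle calls that, for integers $a_1,\dots,a_r$ with $|a_i|\le 2^{r^{o(1)}}$, return $Q_r(a_1,\dots,a_r)$ in time $r$. $k$-SAT ($k$-TAUT) asks whether a $k$-CNF formula on $n$ variables (without repeated clauses; size $n$) is satisfiable (unsatisfiable). *POSETH* is the statement: for every $\varepsilon>0$ and every explicit $\mathcal Q$ there is $k$ such that $k\text{-TAUT}\notin\mathrm{POTIME}[2^{(1-\varepsilon)n},\mathcal Q]$. For $\delta\colon\mathbb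 R_{>0}\to\mathbb R_{>0}$, write $(A,p)\le_\delta(B,q)$ if for every $\varepsilon>0$ there are an algorithm for $A$ with oracle access to $B$, a constant $d$ and a function $t$ such that on every instance of $A$ of size $n$ the algorithm runs in time at most $d\,p(n)^{1-\delta(\varepsilon)}$ and adaptively produces at most $t(n)$ instances of $B$, whose sizes $n_i$ satisfy $\sum_i q(n_i)^{1-\varepsilon}\le d\,p(n)^{1-\delta(\varepsilon)}$. A problem $B$ is *$t(n)$-SETH-hard* if there is $\delta\colon\mathbb R_{>0}\to\mathbb R_{>0}$ such that $(k\text{-SAT},2^n)\le_\delta(B,t(n))$ for every $k\in\mathbb N$. **Problems.** Let $W\colon\mathbb N\to\mathbb N$ with $W(n)=n^{O(1)}$ and $R=\{-W(n),\dots,W(n)\}$. Graphs are finite, simple and undirected, given by the number $n$ of vertices and the list of the $m$ edges. The size $s$ of an instance is $n$ in (1) and (2), and $n+m$ in (3)–(6). 1. $k$-SUM ($k$ fixed): given $k$ sets of $n$ integers from $R$ each, can one choose one integer from each set such that the sum is zero? 2. Collinearity: given $n$ distinct points in $R^2$, do three of them lie on a line? 3. $H$-induced subgraph ($H$ a fixed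 finite graph): does a given graph contain an induced subgraph isomorphic to $H$? 4. $\mathcal H$-induced subgraph ($\mathcal H$ a fixed finite set of finite graphs): does a given graph contain an induced subgraph isomorphic to some member of $\mathcal H$? 5. Minimum weight $k$-clique, decision version ($k$ fixed): given a graph with edge weights from $R$ and $w\in R$, is there a $k$-clique of total weight at most $w$? 6. MAX $H$-SUBGRAPH, decision version ($H$ a fixed finite graph), in two variants, with weights on edges and with weights on vertices: given a graph with weights from $R$ and $w\in R$, is there an induced subgraph isomorphic to $H$ of total weight at least $w$? **Statement.** Let $A$ be any of these problems and let $\varepsilon>0$. Then $A\in\mathrm{POTIME}[s^{1+\varepsilon},\mathcal Q]$ for some explicit family $\mathcal Q$, and, assuming POSETH, $A$ is not $s^{1+\varepsilon}$-SETH-hard. -/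

import Mathlib

open Filter Asymptotics

namespace FineGrained

/-! ### The machine model: RAM programs with an oracle -/

/-- Number of machine words occupied by the integer `z`, for words of `w` bits (at least one). -/
def words (w : ℕ) (z : ℤ) : ℕ := 1 + z.natAbs.size / w

/-- The word length, in bits, of the RAM on an input of size `n`. An integer of `O(log n)` bits
occupies `O(1)` words, so all arithmetic operations on such integers take time `O(1)`. -/
def wordSize (n : ℕ) : ℕ := Nat.log 2 n + 1

/-- The arithmetic operations of the RAM (division is Euclidean division with remainder). -/
inductive ArithOp
  | add | sub | mul | div | mod

def ArithOp.eval : ArithOp → ℤ → ℤ → ℤ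
  | .add, x, y => x + y
  | .sub, x, y => x - y
  | .mul, x, y => x * y
  | .div, x, y => x / y
  | .mod, x, y => x % y

/-- Time of an arithmetic operation: linear in the number of words for addition and subtraction,
product of the numbers of words (schoolbook method) for multiplication and division. -/
def ArithOp.cost (w : ℕ) : ArithOp → ℤ → ℤ → ℕ
  | .add, x, y => words w x + words w y
  | .sub, x, y => words w x + words w y
  | .mul, x, y => words w x * words w y
  | .div, x, y => words w x * words w y
  | .mod, x, y => words w x * words w y

/-- A memory configuration: registers and random access memory. The memory is divided into
banks; every program refers to a fixed finite number of registers and of banks. -/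
structure RAMState where
  reg : ℕ → ℤ
  mem : ℕ → ℤ → ℤ

def RAMState.setReg (σ : RAMState) (r : ℕ) (v : ℤ) : RAMState :=
  { σ with reg := Function.update σ.reg r v }

def RAMState.setMem (σ : RAMState) (b : ℕ) (a v : ℤ) : RAMState :=
  { σ with mem := Function.update σ.mem b (Function.update (σ.mem b) a v) }

/-- The contents of the first `len` cells `0, …, len - 1` of bank `b`. -/
def RAMState.segment (σ : RAMState) (b len : ℕ) : List ℤ :=
  (List.range len).map fun i => σ.mem b (i : ℤ)

/-- Integer expressions: constants, registers, random access to a bank, arithmetic. -/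
inductive Expr
  | const (c : ℤ)
  | reg (r : ℕ)
  | load (b : ℕ) (addr : Expr)
  | bin (o : ArithOp) (e₁ e₂ : Expr)

def Expr.eval (σ : RAMState) : Expr → ℤ
  | .const c => c
  | .reg r => σ.reg r
  | .load b e => σ.mem b (e.eval σ)
  | .bin o e₁ e₂ => o.eval (e₁.eval σ) (e₂.eval σ)

/-- The time needed to evaluate an expression. -/
def Expr.cost (w : ℕ) (σ : RAMState) : Expr → ℕ
  | .const c => words w c
  | .reg r => words w (σ.reg r)
  | .load b e => e.cost w σ + words w (σ.mem b (e.eval σ))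
  | .bin o e₁ e₂ => e₁.cost w σ + e₂.cost w σ + o.cost w (e₁.eval σ) (e₂.eval σ)

/-- RAM programs. `ite e₁ e₂ p q` is "if `e₁ < e₂` then `p` else `q`", `loop e₁ e₂ p` is
"while `e₁ < e₂` do `p`", and `query r b e` asks the oracle about the list stored in the cells
`0, …, e - 1` of bank `b` and puts the answer into register `r`. -/
inductive Program
  | skip
  | assign (r : ℕ) (e : Expr)
  | store (b : ℕ) (addr e : Expr)
  | query (r b : ℕ) (len : Expr)
  | seq (p q : Program)
  | ite (e₁ e₂ : Expr) (p q : Program)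
  | loop (e₁ e₂ : Expr) (p : Program)

/-- An oracle: `answer L v` says that `L` is an admissible question with answer `v`, and `cost L`
is the time charged for the call in addition to the ordinary cost of the instruction. -/
structure Oracle where
  answer : List ℤ → ℤ → Prop
  cost : List ℤ → ℕ

/-- The oracle that admits no question. -/
def Oracle.none : Oracle := ⟨fun _ _ => False, fun _ => 0⟩

/-- `Exec O w p σ σ' T qs`: with word length `w` and oracle `O`, the program `p` started in the
configuration `σ` halts in `σ'` after time `T`, and `qs` lists the questions to the oracle in
order. A program that asks a question which is not admissible does not halt. -/
inductive Exec (O : Oracle) (w : ℕ) :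
    Program → RAMState → RAMState → ℕ → List (List ℤ) → Prop
  | skip (σ : RAMState) : Exec O w .skip σ σ 1 []
  | assign (σ : RAMState) (r : ℕ) (e : Expr) :
      Exec O w (.assign r e) σ (σ.setReg r (e.eval σ)) (1 + e.cost w σ) []
  | store (σ : RAMState) (b : ℕ) (addr e : Expr) :
      Exec O w (.store b addr e) σ (σ.setMem b (addr.eval σ) (e.eval σ))
        (1 + addr.cost w σ + e.cost w σ) []
  | query (σ : RAMState) (r b : ℕ) (len : Expr) (L : List ℤ) (v : ℤ)
      (hL : L = σ.segment b (len.eval σ).toNat) (hv : O.answer L v) :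
      Exec O w (.query r b len) σ (σ.setReg r v) (1 + len.cost w σ + O.cost L) [L]
  | seq (σ σ₁ σ₂ : RAMState) (p q : Program) (T₁ T₂ : ℕ) (qs₁ qs₂ : List (List ℤ))
      (h₁ : Exec O w p σ σ₁ T₁ qs₁) (h₂ : Exec O w q σ₁ σ₂ T₂ qs₂) :
      Exec O w (.seq p q) σ σ₂ (T₁ + T₂) (qs₁ ++ qs₂)
  | ite_true (σ σ' : RAMState) (e₁ e₂ : Expr) (p q : Program) (T : ℕ) (qs : List (List ℤ))
      (hc : e₁.eval σ < e₂.eval σ) (h : Exec O w p σ σ' T qs) :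
      Exec O w (.ite e₁ e₂ p q) σ σ' (1 + e₁.cost w σ + e₂.cost w σ + T) qs
  | ite_false (σ σ' : RAMState) (e₁ e₂ : Expr) (p q : Program) (T : ℕ) (qs : List (List ℤ))
      (hc : ¬ e₁.eval σ < e₂.eval σ) (h : Exec O w q σ σ' T qs) :
      Exec O w (.ite e₁ e₂ p q) σ σ' (1 + e₁.cost w σ + e₂.cost w σ + T) qs
  | loop_true (σ σ₁ σ₂ : RAMState) (e₁ e₂ : Expr) (p : Program) (T₁ T₂ : ℕ)
      (qs₁ qs₂ : List (List ℤ)) (hc : e₁.eval σ < e₂.eval σ)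
      (h₁ : Exec O w p σ σ₁ T₁ qs₁) (h₂ : Exec O w (.loop e₁ e₂ p) σ₁ σ₂ T₂ qs₂) :
      Exec O w (.loop e₁ e₂ p) σ σ₂ (1 + e₁.cost w σ + e₂.cost w σ + T₁ + T₂) (qs₁ ++ qs₂)
  | loop_false (σ : RAMState) (e₁ e₂ : Expr) (p : Program) (hc : ¬ e₁.eval σ < e₂.eval σ) :
      Exec O w (.loop e₁ e₂ p) σ σ (1 + e₁.cost w σ + e₂.cost w σ) []

/-- Initial configuration: the input list is stored in bank `0` from address `0` on, its length in
register `0`; everything else is `0`. -/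
def initState (L : List ℤ) : RAMState where
  reg r := if r = 0 then (L.length : ℤ) else 0
  mem b a := if b = 0 ∧ 0 ≤ a then L.getD a.toNat 0 else 0

/-! ### Decision problems, explicit polynomial families, `POTIME` -/

/-- A decision problem with its complexity parameter `size`; instances are presented to a machine
as lists of integers. -/
structure Problem where
  Instance : Type
  size : Instance → ℕ
  encode : Instance → List ℤ
  encode_injective : Function.Injective encode
  Yes : Instance → Prop

open Classical in
/-- The integer `1` for true and `0` for false. -/
noncomputable def truthValue (p : Prop) : ℤ := if p then 1 else 0

/-- A family of integer polynomials, the `n`-th one in `n` variables. -/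
abbrev PolyFamily := (n : ℕ) → MvPolynomial (Fin n) ℤ

/-- The monomial `∏ⱼ x_{v j}` given by a tuple over `{0, …, n}`, where the entry `0` stands for
the factor `1` and the entry `i + 1` for the `i`-th variable. -/
noncomputable def tupleMonomial {n Δ : ℕ} (v : Fin Δ → Fin (n + 1)) : Fin n →₀ ℕ :=
  ∑ j, Fin.cases (motive := fun _ => Fin n →₀ ℕ) 0 (fun i => Finsupp.single i 1) (v j)

/-- Position of the tuple `v` in the table of coefficients: its value in base `n + 1`. -/
def tupleIndex {n Δ : ℕ} (v : Fin Δ → Fin (n + 1)) : ℕ := ∑ j, (v j : ℕ) * (n + 1) ^ (j : ℕ)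

/-- Explicit families of polynomials: constant degree, polynomially bounded coefficients, and a
program that, given `n`, writes the table of the coefficients of all monomials of degree at most
`Δ` into bank `1` in time `O(n ^ Δ)`. -/
def Explicit (Q : PolyFamily) : Prop :=
  ∃ Δ C : ℕ,
    (∀ n, (Q n).totalDegree ≤ Δ) ∧
    (∀ n μ, |(Q n).coeff μ| ≤ C * ((n : ℤ) + 1) ^ Δ) ∧
    ∃ p : Program, ∀ n : ℕ, ∃ σ T qs,
      Exec Oracle.none (wordSize n) p (initState [(n : ℤ)]) σ T qs ∧
      T ≤ C * (n + 1) ^ Δ ∧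
      ∀ v : Fin Δ → Fin (n + 1), σ.mem 1 (tupleIndex v : ℤ) = (Q n).coeff (tupleMonomial v)

/-- The oracle evaluating `Q`: for `a₁, …, a_s` with `|aᵢ| ≤ 2 ^ bits s` it returns
`Q_s(a₁, …, a_s)` in time `s`. -/
def polyOracle (Q : PolyFamily) (bits : ℕ → ℕ) : Oracle where
  answer L v := (∀ a ∈ L, |a| ≤ 2 ^ bits L.length) ∧
    v = MvPolynomial.eval (fun i => L.get i) (Q L.length)
  cost L := L.length

/-- `POTIME t Q`: problems decided in time `O(t(n))` by a program (output in register `0`) that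
evaluates `Q` by oracle calls, at integers of absolute value at most `2 ^ (s ^ o(1))` for calls
with `s` arguments. -/
def POTIME (t : ℕ → ℝ) (Q : PolyFamily) : Set Problem :=
  {A | ∃ (p : Program) (bits : ℕ → ℕ) (C : ℝ),
    (∀ γ : ℝ, 0 < γ → (fun s => (bits s : ℝ)) =O[atTop] fun s : ℕ => (s : ℝ) ^ γ) ∧
    ∀ x : A.Instance, ∃ σ T qs,
      Exec (polyOracle Q bits) (wordSize (A.size x)) p (initState (A.encode x)) σ T qs ∧
      σ.reg 0 = truthValue (A.Yes x) ∧
      (T : ℝ) ≤ C * (t (A.size x) + 1)}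

/-! ### `k`-SAT, `k`-TAUT and POSETH -/

/-- `k`-CNF formulas over `n` Boolean variables, without repeated clauses; the literal
`(i, true)` is the `i`-th variable and `(i, false)` its negation. -/
structure KCNF (k : ℕ) where
  n : ℕ
  clauses : List (List (Fin n × Bool))
  width : ∀ c ∈ clauses, c.length ≤ k
  nodup : clauses.Nodup

def KCNF.Satisfiable {k : ℕ} (φ : KCNF k) : Prop :=
  ∃ τ : Fin φ.n → Bool, ∀ c ∈ φ.clauses, ∃ l ∈ c, τ l.1 = l.2

/-- The literals are coded by `i + 1` and `-(i + 1)`. -/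
def encodeLiteral {n : ℕ} (l : Fin n × Bool) : ℤ :=
  if l.2 then (l.1 : ℤ) + 1 else -((l.1 : ℤ) + 1)

/-- A clause is coded by its literals, followed by `0`. -/
def encodeClause {n : ℕ} (c : List (Fin n × Bool)) : List ℤ := c.map encodeLiteral ++ [0]

def KCNF.encode {k : ℕ} (φ : KCNF k) : List ℤ := (φ.n : ℤ) :: φ.clauses.flatMap encodeClause

theorem encodeLiteral_ne_zero {n : ℕ} (l : Fin n × Bool) : encodeLiteral l ≠ 0 := by
  unfold encodeLiteral; split <;> omega

theorem encodeLiteral_injective {n : ℕ} :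
    Function.Injective (encodeLiteral : Fin n × Bool → ℤ) := by
  rintro ⟨i, a⟩ ⟨j, b⟩ h
  cases a <;> cases b <;> simp [encodeLiteral] at h ⊢ <;> omega

theorem encodeClause_append_inj {n : ℕ} (c d : List (Fin n × Bool)) (s t : List ℤ)
    (h : encodeClause c ++ s = encodeClause d ++ t) : c = d ∧ s = t := by
  induction c generalizing d with
  | nil =>
    cases d with
    | nil => simpa [encodeClause] using h
    | cons l d => simp [encodeClause] at h; exact absurd h.1.symm (encodeLiteral_ne_zero l)
  | cons l c ih =>
    cases d with
    | nil => simp [encodeClause] at h; exact absurd h.1 (encodeLiteral_ne_zero l)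
    | cons l' d =>
      have h' : encodeLiteral l = encodeLiteral l' ∧
          encodeClause c ++ s = encodeClause d ++ t := by simpa [encodeClause] using h
      obtain ⟨h₁, h₂⟩ := ih d h'.2
      exact ⟨by rw [encodeLiteral_injective h'.1, h₁], h₂⟩

theorem KCNF.encode_injective (k : ℕ) : Function.Injective (KCNF.encode (k := k)) := by
  have key : ∀ {n : ℕ} (l l' : List (List (Fin n × Bool))),
      l.flatMap encodeClause = l'.flatMap encodeClause → l = l' := by
    intro n l
    induction l with
    | nil => intro l' h; cases l' with
      | nil => rfl
      | cons c l' => simp [encodeClause] at h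
    | cons c l ih => intro l' h; cases l' with
      | nil => simp [encodeClause] at h
      | cons c' l' =>
        simp only [List.flatMap_cons] at h
        obtain ⟨h₁, h₂⟩ := encodeClause_append_inj _ _ _ _ h
        rw [h₁, ih l' h₂]
  rintro ⟨n, l, h1, h2⟩ ⟨n', l', h1', h2'⟩ h
  simp only [KCNF.encode, List.cons.injEq, Nat.cast_inj] at h
  obtain ⟨rfl, h⟩ := h
  obtain rfl := key _ _ h
  rfl

/-- `k`-SAT: is the given `k`-CNF formula satisfiable? -/
def kSAT (k : ℕ) : Problem where
  Instance := KCNF k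
  size φ := φ.n
  encode := KCNF.encode
  encode_injective := KCNF.encode_injective k
  Yes φ := φ.Satisfiable

/-- `k`-TAUT: is the given `k`-CNF formula unsatisfiable? -/
def kTAUT (k : ℕ) : Problem where
  Instance := KCNF k
  size φ := φ.n
  encode := KCNF.encode
  encode_injective := KCNF.encode_injective k
  Yes φ := ¬ φ.Satisfiable

/-- The polynomial oracle strong exponential time hypothesis. -/
def POSETH : Prop :=
  ∀ ε : ℝ, 0 < ε → ∀ Q : PolyFamily, Explicit Q →
    ∃ k : ℕ, kTAUT k ∉ POTIME (fun n => (2 : ℝ) ^ ((1 - ε) * (n : ℝ))) Q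

/-! ### Fine-grained reductions and SETH-hardness -/

/-- Oracle access to a decision problem: the admissible questions are the codes of instances. -/
def Problem.oracle (B : Problem) : Oracle where
  answer L v := ∃ y : B.Instance, L = B.encode y ∧ v = truthValue (B.Yes y)
  cost _ := 0

/-- `(A, p)` `δ`-fine-grained reduces to `(B, q)`. -/
def FineGrainedReduces (δ : ℝ → ℝ) (A : Problem) (p : ℕ → ℝ) (B : Problem) (q : ℕ → ℝ) : Prop :=
  ∀ ε : ℝ, 0 < ε → ∃ (prog : Program) (d : ℝ) (t : ℕ → ℕ), ∀ x : A.Instance,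
    ∃ (σ : RAMState) (T : ℕ) (ys : List B.Instance),
      Exec B.oracle (wordSize (A.size x)) prog (initState (A.encode x)) σ T (ys.map B.encode) ∧
      σ.reg 0 = truthValue (A.Yes x) ∧
      (T : ℝ) ≤ d * p (A.size x) ^ (1 - δ ε) ∧
      ys.length ≤ t (A.size x) ∧
      (ys.map fun y => q (B.size y) ^ (1 - ε)).sum ≤ d * p (A.size x) ^ (1 - δ ε)

/-- `B` is `t(n)`-SETH-hard. -/
def SETHHard (t : ℕ → ℝ) (B : Problem) : Prop :=
  ∃ δ : ℝ → ℝ, (∀ ε : ℝ, 0 < ε → 0 < δ ε) ∧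
    ∀ k : ℕ, FineGrainedReduces δ (kSAT k) (fun n => (2 : ℝ) ^ (n : ℝ)) B t

/-! ### The problems from P

In all of them the input integers lie in `{-W, …, W}`, where `W` is a function of `n`. -/

/-- `k` sets of `n` integers each. -/
structure SumInput (k : ℕ) (W : ℕ → ℕ) where
  n : ℕ
  elt : Fin k → Fin n → ℤ
  elt_injective : ∀ i, Function.Injective (elt i)
  elt_le : ∀ i j, |elt i j| ≤ W n

/-- `n`, followed by the elements of the first set, of the second set, and so on. -/
def SumInput.encode {k : ℕ} {W : ℕ → ℕ} (x : SumInput k W) : List ℤ :=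
  (x.n : ℤ) ::
    List.ofFn fun t : Fin (k * x.n) => x.elt (finProdFinEquiv.symm t).1 (finProdFinEquiv.symm t).2

theorem SumInput.encode_injective (k : ℕ) (W : ℕ → ℕ) :
    Function.Injective (SumInput.encode (k := k) (W := W)) := by
  rintro ⟨n, a, h1, h2⟩ ⟨n', a', h1', h2'⟩ h
  simp only [SumInput.encode, List.cons.injEq, Nat.cast_inj] at h
  obtain ⟨rfl, h⟩ := h
  have h := List.ofFn_injective h
  have : a = a' := by
    funext i j
    simpa only [Equiv.symm_apply_apply] using congrFun h (finProdFinEquiv (i, j))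
  subst this
  rfl

/-- `k`-SUM: can one choose one element of each set such that the sum is zero? -/
def kSum (k : ℕ) (W : ℕ → ℕ) : Problem where
  Instance := SumInput k W
  size x := x.n
  encode := SumInput.encode
  encode_injective := SumInput.encode_injective k W
  Yes x := ∃ c : Fin k → Fin x.n, ∑ i, x.elt i (c i) = 0

/-- `n` different points of the grid `{-W, …, W}²`. -/
structure PointsInput (W : ℕ → ℕ) where
  n : ℕ
  pt : Fin n → ℤ × ℤ
  pt_injective : Function.Injective pt
  pt_le : ∀ i, |(pt i).1| ≤ W n ∧ |(pt i).2| ≤ W n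

/-- `n`, the first coordinates, the second coordinates. -/
def PointsInput.encode {W : ℕ → ℕ} (x : PointsInput W) : List ℤ :=
  (x.n : ℤ) :: (List.ofFn (fun i => (x.pt i).1) ++ List.ofFn (fun i => (x.pt i).2))

theorem PointsInput.encode_injective (W : ℕ → ℕ) :
    Function.Injective (PointsInput.encode (W := W)) := by
  rintro ⟨n, a, h1, h2⟩ ⟨n', a', h1', h2'⟩ h
  simp only [PointsInput.encode, List.cons.injEq, Nat.cast_inj] at h
  obtain ⟨rfl, h⟩ := h
  obtain ⟨h3, h4⟩ := List.append_inj h (by simp)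
  have : a = a' := by
    funext i
    exact Prod.ext (congrFun (List.ofFn_injective h3) i) (congrFun (List.ofFn_injective h4) i)
  subst this
  rfl

/-- The point of the real plane with the given integer coordinates. -/
def toPlane (p : ℤ × ℤ) : ℝ × ℝ := ((p.1 : ℝ), (p.2 : ℝ))

/-- Collinearity: do three of the points lie on a line? -/
def collinearity (W : ℕ → ℕ) : Problem where
  Instance := PointsInput W
  size x := x.n
  encode := PointsInput.encode
  encode_injective := PointsInput.encode_injective W
  Yes x := ∃ i j l : Fin x.n, i ≠ j ∧ i ≠ l ∧ j ≠ l ∧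
    Collinear ℝ {toPlane (x.pt i), toPlane (x.pt j), toPlane (x.pt l)}

/-- A simple undirected graph with `n` vertices, given by the list of its `m` edges: every edge
is listed once, with its smaller end point first. -/
structure GraphInput where
  n : ℕ
  m : ℕ
  edge : Fin m → Fin n × Fin n
  edge_lt : ∀ e, (edge e).1 < (edge e).2
  edge_injective : Function.Injective edge

def GraphInput.graph (x : GraphInput) : SimpleGraph (Fin x.n) :=
  SimpleGraph.fromRel fun u v => ∃ e, x.edge e = (u, v)

/-- The first end points of the edges, followed by the second end points. -/
def GraphInput.encodeEdges (x : GraphInput) : List ℤ :=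
  List.ofFn (fun e => ((x.edge e).1 : ℤ)) ++ List.ofFn (fun e => ((x.edge e).2 : ℤ))

/-- `n` and `m`, followed by the edges. -/
def GraphInput.encode (x : GraphInput) : List ℤ :=
  (x.n : ℤ) :: (x.m : ℤ) :: x.encodeEdges

theorem GraphInput.ext_of_encodeEdges {x y : GraphInput} (hn : x.n = y.n) (hm : x.m = y.m)
    (h : x.encodeEdges = y.encodeEdges) : x = y := by
  obtain ⟨n, m, a, h1, h2⟩ := x
  obtain ⟨n', m', a', h1', h2'⟩ := y
  dsimp only at hn hm
  subst hn hm
  obtain ⟨h3, h4⟩ := List.append_inj h (by simp)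
  have : a = a' := by
    funext i
    have h5 := congrFun (List.ofFn_injective h3) i
    have h6 := congrFun (List.ofFn_injective h4) i
    simp only [Nat.cast_inj] at h5 h6
    exact Prod.ext (Fin.ext h5) (Fin.ext h6)
  subst this
  rfl

theorem GraphInput.encodeEdges_length (x : GraphInput) :
    x.encodeEdges.length = x.m + x.m := by
  simp [GraphInput.encodeEdges]

theorem GraphInput.encode_injective : Function.Injective GraphInput.encode := by
  intro x y h
  simp only [GraphInput.encode, List.cons.injEq, Nat.cast_inj] at h
  exact GraphInput.ext_of_encodeEdges h.1 h.2.1 h.2.2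

/-- `H`-induced subgraph: does the graph contain an induced subgraph isomorphic to `H`? -/
def inducedSubgraph {h : ℕ} (H : SimpleGraph (Fin h)) : Problem where
  Instance := GraphInput
  size x := x.n + x.m
  encode := GraphInput.encode
  encode_injective := GraphInput.encode_injective
  Yes x := H.IsIndContained x.graph

/-- `ℋ`-induced subgraph for a finite set `ℋ` of graphs: does the graph contain an induced
subgraph isomorphic to a member of `ℋ`? -/
def familyInducedSubgraph (ℋ : Finset (Σ h : ℕ, SimpleGraph (Fin h))) : Problem where
  Instance := GraphInput
  size x := x.n + x.m
  encode := GraphInput.encode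
  encode_injective := GraphInput.encode_injective
  Yes x := ∃ H ∈ ℋ, H.2.IsIndContained x.graph

/-- A graph with weights on its edges, and a threshold. -/
structure EdgeWeightedInput (W : ℕ → ℕ) extends GraphInput where
  weight : Fin m → ℤ
  threshold : ℤ
  weight_le : ∀ e, |weight e| ≤ W n
  threshold_le : |threshold| ≤ W n

/-- `n`, `m`, the threshold, the edges, the weights. -/
def EdgeWeightedInput.encode {W : ℕ → ℕ} (x : EdgeWeightedInput W) : List ℤ :=
  (x.n : ℤ) :: (x.m : ℤ) :: x.threshold :: (x.encodeEdges ++ List.ofFn x.weight)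

theorem EdgeWeightedInput.encode_injective (W : ℕ → ℕ) :
    Function.Injective (EdgeWeightedInput.encode (W := W)) := by
  rintro ⟨x, a, w, h1, h2⟩ ⟨x', a', w', h1', h2'⟩ h
  simp only [EdgeWeightedInput.encode, List.cons.injEq, Nat.cast_inj] at h
  obtain ⟨hn, hm, rfl, h⟩ := h
  obtain ⟨h3, h4⟩ := List.append_inj h (by simp [GraphInput.encodeEdges_length, hm])
  obtain rfl := GraphInput.ext_of_encodeEdges hn hm h3
  obtain rfl := List.ofFn_injective h4
  rfl

/-- Total weight of the edges of the subgraph induced by the vertex set `C`. -/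
def EdgeWeightedInput.totalWeight {W : ℕ → ℕ} (x : EdgeWeightedInput W)
    (C : Finset (Fin x.n)) : ℤ :=
  ∑ e with (x.edge e).1 ∈ C ∧ (x.edge e).2 ∈ C, x.weight e

/-- Minimum weight `k`-clique (decision version): is there a `k`-clique whose total (edge) weight
is at most the threshold? -/
def minWeightClique (k : ℕ) (W : ℕ → ℕ) : Problem where
  Instance := EdgeWeightedInput W
  size x := x.n + x.m
  encode := EdgeWeightedInput.encode
  encode_injective := EdgeWeightedInput.encode_injective W
  Yes x := ∃ C : Finset (Fin x.n), x.graph.IsNClique k C ∧ x.totalWeight C ≤ x.threshold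

/-- MAX `H`-SUBGRAPH with weights on edges (decision version): is there an induced subgraph
isomorphic to `H` whose total weight is at least the threshold? -/
def maxSubgraphEdges {h : ℕ} (H : SimpleGraph (Fin h)) (W : ℕ → ℕ) : Problem where
  Instance := EdgeWeightedInput W
  size x := x.n + x.m
  encode := EdgeWeightedInput.encode
  encode_injective := EdgeWeightedInput.encode_injective W
  Yes x := ∃ f : H ↪g x.graph, x.threshold ≤ x.totalWeight (Finset.univ.map f.toEmbedding)

/-- A graph with weights on its vertices, and a threshold. -/
structure VertexWeightedInput (W : ℕ → ℕ) extends GraphInput where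
  weight : Fin n → ℤ
  threshold : ℤ
  weight_le : ∀ v, |weight v| ≤ W n
  threshold_le : |threshold| ≤ W n

/-- `n`, `m`, the threshold, the edges, the weights. -/
def VertexWeightedInput.encode {W : ℕ → ℕ} (x : VertexWeightedInput W) : List ℤ :=
  (x.n : ℤ) :: (x.m : ℤ) :: x.threshold :: (x.encodeEdges ++ List.ofFn x.weight)

theorem VertexWeightedInput.encode_injective (W : ℕ → ℕ) :
    Function.Injective (VertexWeightedInput.encode (W := W)) := by
  rintro ⟨x, a, w, h1, h2⟩ ⟨x', a', w', h1', h2'⟩ h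
  simp only [VertexWeightedInput.encode, List.cons.injEq, Nat.cast_inj] at h
  obtain ⟨hn, hm, rfl, h⟩ := h
  obtain ⟨h3, h4⟩ := List.append_inj h (by simp [GraphInput.encodeEdges_length, hm])
  obtain rfl := GraphInput.ext_of_encodeEdges hn hm h3
  obtain rfl := List.ofFn_injective h4
  rfl

/-- MAX `H`-SUBGRAPH with weights on vertices (decision version): is there an induced subgraph
isomorphic to `H` whose total weight is at least the threshold? -/
def maxSubgraphVertices {h : ℕ} (H : SimpleGraph (Fin h)) (W : ℕ → ℕ) : Problem where
  Instance := VertexWeightedInput W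
  size x := x.n + x.m
  encode := VertexWeightedInput.encode
  encode_injective := VertexWeightedInput.encode_injective W
  Yes x := ∃ f : H ↪g x.graph, x.threshold ≤ ∑ i, x.weight (f i)

/-- The problems under consideration, with input integers in `{-W, …, W}`. -/
inductive Listed (W : ℕ → ℕ) : Problem → Prop
  | kSum (k : ℕ) : Listed W (kSum k W)
  | collinearity : Listed W (collinearity W)
  | inducedSubgraph {h : ℕ} (H : SimpleGraph (Fin h)) : Listed W (inducedSubgraph H)
  | familyInducedSubgraph (ℋ : Finset (Σ h : ℕ, SimpleGraph (Fin h))) :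
      Listed W (familyInducedSubgraph ℋ)
  | minWeightClique (k : ℕ) : Listed W (minWeightClique k W)
  | maxSubgraphEdges {h : ℕ} (H : SimpleGraph (Fin h)) : Listed W (maxSubgraphEdges H W)
  | maxSubgraphVertices {h : ℕ} (H : SimpleGraph (Fin h)) : Listed W (maxSubgraphVertices H W)

end FineGrained

open FineGrained

/-! Each listed problem asks whether a weighted number of tuples of input elements, of constant
length, is positive; the weight is a fixed arithmetic function of the numbers and the labels of the
elements (`Counting`). Such a count is a single value of an explicit polynomial at arguments 0 and
1.

Write every label in a base `β` close to `s ^ (1 / g)`. Labels are polynomially bounded, so a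
constant number of digits suffices. For each position, label and digit place reserve a block of `β ^
(g + 1)` variables; the variable `i * β + d` of the block is set to 1 exactly when that digit of the
`i`-th element is `d`. A monomial with one variable from each block guesses a tuple together with
all digits of all its labels. Its coefficient is the weight of the guessed tuple, or 0 if the
guesses for one position name different elements; it does not depend on the instance. The monomials
that survive evaluation are those with true guesses, so the value is the count
(`Counting.eval_family`). The degree is the number of blocks, and the coefficients are bounded and
computable by a RAM (`explicit_blockPoly`). The only query has `O(s ^ (1 + 1 / g))` arguments, so
for large `g` everything takes time `O(s ^ (1 + γ))` for any prescribed `γ > 0`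
(`Counting.exists_fast_solver`).

For induced subgraphs a tuple consists of vertices and, for each pair of them, of an edge or the
symbol "no edge". Non-edges cannot be listed in time close to `n + m`; they are counted as one minus
the number of joining edges, which is why weights may be negative. For a fixed choice of vertices
the sum over the edges is the indicator of a correct embedding (`GraphInput.sum_tupleWeight_edges`).

If the problem were `s ^ (1 + ε)`-SETH-hard, replacing the oracle calls of the reductions by this
solver, with `γ = ε / 2`, would decide every `k`-SAT, and by negating the output every `k`-TAUT, in
time `2 ^ ((1 - δ') n)` for one `δ' > 0` and one explicit family (`kTAUT_mem_POTIME`). This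
contradicts POSETH. -/

namespace FineGrained

/-! ### Arithmetically definable functions -/

/-- Functions of integer variables given by constants and the operations of the RAM. -/
inductive Arith {V : Type} : ((V → ℤ) → ℤ) → Prop
  | const (c : ℤ) : Arith fun _ => c
  | var (v : V) : Arith fun ρ => ρ v
  | bin (o : ArithOp) {f g : (V → ℤ) → ℤ} (hf : Arith f) (hg : Arith g) :
      Arith fun ρ => o.eval (f ρ) (g ρ)

namespace Arith

variable {V V' : Type} {f g : (V → ℤ) → ℤ}

theorem add (hf : Arith f) (hg : Arith g) : Arith fun ρ => f ρ + g ρ := bin .add hf hg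
theorem sub (hf : Arith f) (hg : Arith g) : Arith fun ρ => f ρ - g ρ := bin .sub hf hg
theorem mul (hf : Arith f) (hg : Arith g) : Arith fun ρ => f ρ * g ρ := bin .mul hf hg
theorem div (hf : Arith f) (hg : Arith g) : Arith fun ρ => f ρ / g ρ := bin .div hf hg
theorem mod (hf : Arith f) (hg : Arith g) : Arith fun ρ => f ρ % g ρ := bin .mod hf hg

theorem pow (hf : Arith f) (n : ℕ) : Arith fun ρ => f ρ ^ n := by
  induction n with
  | zero => simpa using const 1
  | succ n ih => simpa [pow_succ] using ih.mul hf

theorem sum {α : Type*} (s : Finset α) {F : α → (V → ℤ) → ℤ} (h : ∀ a, Arith (F a)) :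
    Arith fun ρ => ∑ a ∈ s, F a ρ := by
  classical
  induction s using Finset.induction_on with
  | empty => simpa using const 0
  | insert a s ha ih => simpa [Finset.sum_insert ha] using (h a).add ih

theorem prod {α : Type*} (s : Finset α) {F : α → (V → ℤ) → ℤ} (h : ∀ a, Arith (F a)) :
    Arith fun ρ => ∏ a ∈ s, F a ρ := by
  classical
  induction s using Finset.induction_on with
  | empty => simpa using const 1
  | insert a s ha ih => simpa [Finset.prod_insert ha] using (h a).mul ih

theorem subst (hf : Arith f) {G : V → (V' → ℤ) → ℤ} (hG : ∀ v, Arith (G v)) :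
    Arith fun ρ => f fun v => G v ρ := by
  induction hf with
  | const c => exact const c
  | var v => exact hG v
  | bin o _ _ h₁ h₂ => exact bin o h₁ h₂

/-- Division rounds down here, so a negative `z` of absolute value at most `z * z + 1` gives
quotient `-1`, while `0 ≤ z < z * z + 1` gives `0`. Comparisons thereby become arithmetic, and
indicator functions need no branching. -/
theorem neg_indicator (z : ℤ) : -(z / (z * z + 1)) = if z < 0 then 1 else 0 := by
  split_ifs with h
  · rw [Int.ediv_eq_neg_one_of_neg_of_le h (by nlinarith)]; norm_num
  · rw [Int.ediv_eq_zero_of_lt (by omega) (by nlinarith)]; norm_num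

theorem lt (hf : Arith f) (hg : Arith g) : Arith fun ρ => if f ρ < g ρ then (1 : ℤ) else 0 := by
  have h := hf.sub hg
  have := (const 0).sub (h.div ((h.mul h).add (const 1)))
  simpa only [zero_sub, neg_indicator, sub_neg] using this

theorem eq (hf : Arith f) (hg : Arith g) : Arith fun ρ => if f ρ = g ρ then (1 : ℤ) else 0 := by
  have := ((const 1).sub (hf.lt hg)).mul ((const 1).sub (hg.lt hf))
  convert this using 2 with ρ
  split_ifs <;> omega

theorem ne (hf : Arith f) (hg : Arith g) : Arith fun ρ => if f ρ ≠ g ρ then (1 : ℤ) else 0 := by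
  have := (const 1).sub (hf.eq hg)
  convert this using 2 with ρ
  split_ifs <;> simp_all

theorem le (hf : Arith f) (hg : Arith g) : Arith fun ρ => if f ρ ≤ g ρ then (1 : ℤ) else 0 := by
  have := (const 1).sub (hg.lt hf)
  convert this using 2 with ρ
  split_ifs <;> omega

theorem and {p q : (V → ℤ) → Prop} [DecidablePred p] [DecidablePred q]
    (hp : Arith fun ρ => if p ρ then (1 : ℤ) else 0)
    (hq : Arith fun ρ => if q ρ then (1 : ℤ) else 0) :
    Arith fun ρ => if p ρ ∧ q ρ then (1 : ℤ) else 0 := by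
  convert hp.mul hq using 2 with ρ
  split_ifs <;> simp_all

theorem or {p q : (V → ℤ) → Prop} [DecidablePred p] [DecidablePred q]
    (hp : Arith fun ρ => if p ρ then (1 : ℤ) else 0)
    (hq : Arith fun ρ => if q ρ then (1 : ℤ) else 0) :
    Arith fun ρ => if p ρ ∨ q ρ then (1 : ℤ) else 0 := by
  convert (hp.add hq).sub (hp.mul hq) using 2 with ρ
  split_ifs <;> simp_all

end Arith

/-! ### Sizes of numbers and costs of expressions -/

/-- The integer `z` has at most `w * u` bits. -/
def Fits (w u : ℕ) (z : ℤ) : Prop := z.natAbs < 2 ^ (w * u)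

theorem Fits.mono {w u v : ℕ} {z : ℤ} (h : Fits w u z) (huv : u ≤ v) : Fits w v z :=
  lt_of_lt_of_le h (Nat.pow_le_pow_right (by norm_num) (Nat.mul_le_mul_left w huv))

theorem Fits.words_le {w u : ℕ} {z : ℤ} (h : Fits w u z) : words w z ≤ 1 + u := by
  unfold words
  have h1 : z.natAbs.size ≤ w * u := Nat.size_le.2 h
  have := Nat.div_le_of_le_mul h1
  omega

theorem Fits.const {w : ℕ} (hw : 0 < w) (c : ℤ) : Fits w c.natAbs c := by
  unfold Fits
  calc c.natAbs < 2 ^ c.natAbs := Nat.lt_two_pow_self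
    _ ≤ _ := Nat.pow_le_pow_right (by norm_num) (Nat.le_mul_of_pos_left _ hw)

/-- Products need `a + b` words; the additional word absorbs the carry of a sum or difference. -/
theorem Fits.bin {w a b : ℕ} (hw : 0 < w) {x y : ℤ} (hx : Fits w a x) (hy : Fits w b y)
    (o : ArithOp) : Fits w (a + b + 1) (o.eval x y) := by
  have hmax : Fits w (a + b) x ∧ Fits w (a + b) y :=
    ⟨hx.mono (by omega), hy.mono (by omega)⟩
  have hstep : 2 * 2 ^ (w * (a + b)) ≤ 2 ^ (w * (a + b + 1)) := by
    rw [← pow_succ']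
    exact Nat.pow_le_pow_right (by norm_num) (by nlinarith)
  unfold Fits at *
  have hpos : 0 < 2 ^ (w * (a + b)) := by positivity
  cases o with
  | add =>
    simp only [ArithOp.eval]
    omega
  | sub =>
    simp only [ArithOp.eval]
    omega
  | mul =>
    simp only [ArithOp.eval, Int.natAbs_mul]
    have : x.natAbs * y.natAbs < 2 ^ (w * a) * 2 ^ (w * b) := by
      exact Nat.mul_lt_mul'' hx hy
    rw [← pow_add, ← mul_add] at this
    omega
  | div =>
    simp only [ArithOp.eval]
    have : (x / y).natAbs ≤ x.natAbs := Int.natAbs_ediv_le_natAbs x y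
    omega
  | mod =>
    simp only [ArithOp.eval]
    rcases eq_or_ne y 0 with rfl | h
    · simp only [Int.emod_zero]; omega
    · have h1 := Int.emod_nonneg x h
      have h2 := Int.emod_lt x h
      omega

theorem Fits.cost_le {w a b : ℕ} {x y : ℤ} (hx : Fits w a x) (hy : Fits w b y)
    (o : ArithOp) : o.cost w x y ≤ 2 * (1 + a) * (1 + b) := by
  have h1 := hx.words_le
  have h2 := hy.words_le
  have h3 := Nat.mul_le_mul h1 h2
  cases o <;> simp only [ArithOp.cost] <;> nlinarith

/-- The constant precedes the choice of registers `τ`, because time bounds must be fixed before it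
is known which registers are free. The cost is quadratic in the number of words owing to schoolbook
multiplication. -/
theorem Arith.exists_expr {V : Type} {f : (V → ℤ) → ℤ} (hf : Arith f) :
    ∃ c : ℕ, ∀ τ : V → ℕ, ∃ e : Expr, ∀ σ : RAMState,
      e.eval σ = f (fun v => σ.reg (τ v)) ∧
      ∀ w u, 0 < w → 0 < u → (∀ v, Fits w u (σ.reg (τ v))) →
        Fits w (c * u) (e.eval σ) ∧ e.cost w σ ≤ c * u ^ 2 := by
  induction hf with
  | const c =>
    refine ⟨c.natAbs + 1, fun τ => ⟨.const c, fun σ => ⟨rfl, fun w u hw hu _ => ?_⟩⟩⟩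
    have h := Fits.const hw c
    refine ⟨h.mono ?_, h.words_le.trans ?_⟩
    · nlinarith [Nat.zero_le c.natAbs]
    · rw [add_comm]
      exact Nat.le_mul_of_pos_right _ (by positivity)
  | var v =>
    refine ⟨2, fun τ => ⟨.reg (τ v), fun σ => ⟨rfl, fun w u hw hu h => ?_⟩⟩⟩
    refine ⟨(h v).mono (by omega), (h v).words_le.trans ?_⟩
    nlinarith
  | bin o _ _ h₁ h₂ =>
    obtain ⟨c, h₁⟩ := h₁
    obtain ⟨d, h₂⟩ := h₂
    refine ⟨c + d + 2 * (1 + c) * (1 + d), fun τ => ?_⟩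
    obtain ⟨e₁, h₁⟩ := h₁ τ
    obtain ⟨e₂, h₂⟩ := h₂ τ
    refine ⟨.bin o e₁ e₂, fun σ => ⟨?_, fun w u hw hu h => ?_⟩⟩
    · simp only [Expr.eval, (h₁ σ).1, (h₂ σ).1]
    · obtain ⟨a1, a2⟩ := (h₁ σ).2 w u hw hu h
      obtain ⟨b1, b2⟩ := (h₂ σ).2 w u hw hu h
      refine ⟨(Fits.bin hw a1 b1 o).mono ?_, ?_⟩
      · nlinarith [Nat.zero_le (c * d * u), Nat.zero_le (c * u), Nat.zero_le (d * u)]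
      · simp only [Expr.cost]
        have h3 := Fits.cost_le a1 b1 o
        have h4 : 2 * (1 + c * u) * (1 + d * u) ≤ 2 * (1 + c) * (1 + d) * u ^ 2 := by
          calc 2 * (1 + c * u) * (1 + d * u)
              ≤ 2 * (u + c * u) * (u + d * u) := by gcongr <;> omega
            _ = _ := by ring
        calc _ ≤ c * u ^ 2 + d * u ^ 2 + 2 * (1 + c) * (1 + d) * u ^ 2 := by omega
          _ = _ := by ring

/-! ### Total correctness with time bounds -/

/-- Started in `σ`, the program halts within time `T` in a configuration satisfying `Post`. -/
def Run (O : Oracle) (w : ℕ) (p : Program) (σ : RAMState) (T : ℕ) (Post : RAMState → Prop) :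
    Prop :=
  ∃ σ' T' qs, Exec O w p σ σ' T' qs ∧ T' ≤ T ∧ Post σ'

section Run

variable {O : Oracle} {w : ℕ} {p q : Program} {σ : RAMState} {T T₁ T₂ : ℕ}
  {Post Post₁ Post₂ : RAMState → Prop}

theorem Run.mono (h : Run O w p σ T₁ Post₁) (hT : T₁ ≤ T₂) (hP : ∀ σ', Post₁ σ' → Post₂ σ') :
    Run O w p σ T₂ Post₂ := by
  obtain ⟨σ', T', qs, h1, h2, h3⟩ := h
  exact ⟨σ', T', qs, h1, h2.trans hT, hP _ h3⟩

theorem Run.skip (h : Post σ) (hT : 1 ≤ T) : Run O w .skip σ T Post :=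
  ⟨_, _, _, .skip σ, hT, h⟩

theorem Run.assign {r : ℕ} {e : Expr} (h : Post (σ.setReg r (e.eval σ)))
    (hT : 1 + e.cost w σ ≤ T) : Run O w (.assign r e) σ T Post :=
  ⟨_, _, _, .assign σ r e, hT, h⟩

theorem Run.store {b : ℕ} {a e : Expr} (h : Post (σ.setMem b (a.eval σ) (e.eval σ)))
    (hT : 1 + a.cost w σ + e.cost w σ ≤ T) : Run O w (.store b a e) σ T Post :=
  ⟨_, _, _, .store σ b a e, hT, h⟩

theorem Run.seq (h₁ : Run O w p σ T₁ Post₁) (h₂ : ∀ σ', Post₁ σ' → Run O w q σ' T₂ Post₂)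
    (hT : T₁ + T₂ ≤ T) : Run O w (.seq p q) σ T Post₂ := by
  obtain ⟨σ₁, t₁, qs₁, h1, h2, h3⟩ := h₁
  obtain ⟨σ₂, t₂, qs₂, h4, h5, h6⟩ := h₂ _ h3
  exact ⟨_, _, _, .seq _ _ _ _ _ _ _ _ _ h1 h4, by omega, h6⟩

/-- The number of rounds is prescribed and the invariant is indexed by the round, so termination
needs no separate argument. `Tc` bounds a test of the guard and `Tb` a run of the body. -/
theorem Run.loop {e₁ e₂ : Expr} {Tc Tb : ℕ} (Inv : ℕ → RAMState → Prop) (n : ℕ)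
    (hstep : ∀ k < n, ∀ σ, Inv k σ → e₁.eval σ < e₂.eval σ ∧
      1 + e₁.cost w σ + e₂.cost w σ ≤ Tc ∧ Run O w p σ Tb (Inv (k + 1)))
    (hend : ∀ σ, Inv n σ → ¬ e₁.eval σ < e₂.eval σ ∧ 1 + e₁.cost w σ + e₂.cost w σ ≤ Tc)
    (h0 : Inv 0 σ) (hT : n * (Tc + Tb) + Tc ≤ T) :
    Run O w (.loop e₁ e₂ p) σ T (Inv n) := by
  suffices H : ∀ j k, k + j = n → ∀ σ, Inv k σ →
      Run O w (.loop e₁ e₂ p) σ (j * (Tc + Tb) + Tc) (Inv n) from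
    (H n 0 (by omega) σ h0).mono hT fun _ h => h
  intro j
  induction j with
  | zero =>
    intro k hk σ hσ
    obtain rfl : k = n := by omega
    obtain ⟨h1, h2⟩ := hend σ hσ
    exact ⟨_, _, _, .loop_false σ e₁ e₂ p h1, by omega, hσ⟩
  | succ j ih =>
    intro k hk σ hσ
    obtain ⟨h1, h2, σ₁, t₁, qs₁, h3, h4, h5⟩ := hstep k (by omega) σ hσ
    obtain ⟨σ₂, t₂, qs₂, h6, h7, h8⟩ := ih (k + 1) (by omega) σ₁ h5
    refine ⟨_, _, _, .loop_true _ _ _ _ _ _ _ _ _ _ h1 h3 h6, ?_, h8⟩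
    rw [Nat.succ_mul]
    omega

end Run

end FineGrained

namespace FineGrained

/-! ### Set-multilinear polynomials -/

/-- Membership in the `p`-th block of `M` consecutive numbers. -/
def blockInd (M p : ℕ) (x : ℤ) : ℤ := if (p : ℤ) * M ≤ x ∧ x < (p : ℤ) * M + M then 1 else 0

theorem blockInd_eq_one_iff {M p : ℕ} {x : ℤ} :
    blockInd M p x = 1 ↔ (p : ℤ) * M ≤ x ∧ x < (p : ℤ) * M + M := by
  unfold blockInd; split_ifs with h <;> simp [h]

theorem blockInd_ne_zero_iff {M p : ℕ} {x : ℤ} : blockInd M p x ≠ 0 ↔ blockInd M p x = 1 := by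
  unfold blockInd; split_ifs <;> simp

/-- In a tuple over `{0, …, r}` the entry `0` stands for the factor 1; after subtracting one it is
the variable number `-1`, which must lie in no block. -/
theorem blockInd_neg_one (M p : ℕ) : blockInd M p (-1) = 0 := by
  unfold blockInd
  rw [if_neg]
  have : (0 : ℤ) ≤ (p : ℤ) * M := by positivity
  omega

theorem blockInd_unique {M p q : ℕ} {x : ℤ} (hp : blockInd M p x = 1) (hq : blockInd M q x = 1) :
    p = q := by
  rw [blockInd_eq_one_iff] at hp hq
  by_contra hne
  rcases Nat.lt_or_gt_of_ne hne with h | h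
  · have : ((p : ℤ) + 1) * M ≤ q * M := by gcongr; omega
    nlinarith
  · have : ((q : ℤ) + 1) * M ≤ p * M := by gcongr; omega
    nlinarith

theorem blockInd_eq_ite {M p q : ℕ} {x : ℤ} (h : blockInd M p x = 1) :
    blockInd M q x = if q = p then 1 else 0 := by
  split_ifs with hpq
  · rw [hpq, h]
  · by_contra h0
    exact hpq (blockInd_unique (blockInd_ne_zero_iff.1 h0) h)

/-- The sum of `c v * ∏ p, x (v p)` over the choices `v` of one variable from each of `Δ` blocks
of `M` consecutive variables. -/
noncomputable def blockPoly (Δ M : ℕ) (c : (Fin Δ → ℤ) → ℤ) (r : ℕ) : MvPolynomial (Fin r) ℤ :=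
  ∑ v : Fin Δ → Fin r,
    MvPolynomial.monomial (tupleMonomial fun p => (v p).succ)
      ((∏ p : Fin Δ, blockInd M p ((v p : ℕ) : ℤ)) * c fun p => ((v p : ℕ) : ℤ))

/-- Both sides add `h` over the variables of the monomial with multiplicity; `h0` discards the
entries that stand for the factor 1. Hence the right side depends on the monomial only and not on
the order of the tuple `e`. -/
theorem sum_tupleMonomial_mul {r Δ : ℕ} (e : Fin Δ → Fin (r + 1)) (h : ℤ → ℤ) (h0 : h (-1) = 0) :
    ∑ x : Fin r, (tupleMonomial e x : ℤ) * h ((x : ℕ) : ℤ) =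
      ∑ j, h (((e j : ℕ) : ℤ) - 1) := by
  unfold tupleMonomial
  simp only [Finsupp.coe_finsetSum, Finset.sum_apply, Nat.cast_sum, Finset.sum_mul]
  rw [Finset.sum_comm]
  refine Finset.sum_congr rfl fun j _ => ?_
  refine Fin.cases ?_ (fun i => ?_) (e j)
  · simp [h0]
  · simp [Finsupp.single_apply]

theorem prod_X_eq_monomial {r Δ : ℕ} (v : Fin Δ → Fin r) :
    ∏ p, (MvPolynomial.X (v p) : MvPolynomial (Fin r) ℤ) =
      MvPolynomial.monomial (tupleMonomial fun p => (v p).succ) 1 := by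
  simp only [tupleMonomial, Fin.cases_succ, MvPolynomial.X]
  rw [MvPolynomial.monomial_sum_one]

/-- This formula can be evaluated directly on an index of the coefficient table. A monomial with one
variable in each block comes from exactly one choice `v`, and the sums weighted by `blockInd`
recover that choice. For any other tuple some block is missed and the product vanishes. -/
theorem coeff_blockPoly (Δ M : ℕ) (c : (Fin Δ → ℤ) → ℤ) (r : ℕ) (e : Fin Δ → Fin (r + 1)) :
    (blockPoly Δ M c r).coeff (tupleMonomial e) =
      (∏ p : Fin Δ, ∑ j, blockInd M p (((e j : ℕ) : ℤ) - 1)) *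
        c fun p => ∑ j, blockInd M p (((e j : ℕ) : ℤ) - 1) * (((e j : ℕ) : ℤ) - 1) := by
  classical
  have key : ∀ v : Fin Δ → Fin r, (∀ p : Fin Δ, blockInd M p ((v p : ℕ) : ℤ) = 1) →
      tupleMonomial (fun p => (v p).succ) = tupleMonomial e →
      (∀ p : Fin Δ, ∑ j, blockInd M p (((e j : ℕ) : ℤ) - 1) = 1) ∧
      ∀ p : Fin Δ, ∑ j, blockInd M p (((e j : ℕ) : ℤ) - 1) * (((e j : ℕ) : ℤ) - 1) =
        ((v p : ℕ) : ℤ) := by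
    intro v hv h
    constructor
    · intro p
      rw [← sum_tupleMonomial_mul e (blockInd M p) (blockInd_neg_one M p), ← h,
        sum_tupleMonomial_mul _ _ (blockInd_neg_one M p)]
      simp only [Fin.val_succ, Nat.cast_add, Nat.cast_one, add_sub_cancel_right]
      simp only [blockInd_eq_ite (hv _), Fin.val_inj]
      simp
    · intro p
      have h0 : (fun x => blockInd M p x * x) (-1) = 0 := by simp [blockInd_neg_one]
      rw [← sum_tupleMonomial_mul e (fun x => blockInd M p x * x) h0, ← h,
        sum_tupleMonomial_mul _ (fun x => blockInd M p x * x) h0]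
      simp only [Fin.val_succ, Nat.cast_add, Nat.cast_one, add_sub_cancel_right]
      simp only [blockInd_eq_ite (hv _), Fin.val_inj]
      simp
  have hprod : ∀ v : Fin Δ → Fin r, (∏ p : Fin Δ, blockInd M p ((v p : ℕ) : ℤ)) ≠ 0 →
      ∀ p : Fin Δ, blockInd M p ((v p : ℕ) : ℤ) = 1 := fun v h p =>
    blockInd_ne_zero_iff.1 (Finset.prod_ne_zero_iff.1 h p (Finset.mem_univ p))
  simp only [blockPoly, MvPolynomial.coeff_sum, MvPolynomial.coeff_monomial]
  by_cases hex : ∃ v : Fin Δ → Fin r, (∀ p : Fin Δ, blockInd M p ((v p : ℕ) : ℤ) = 1) ∧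
      tupleMonomial (fun p => (v p).succ) = tupleMonomial e
  · obtain ⟨v, hv, hve⟩ := hex
    obtain ⟨h1, h2⟩ := key v hv hve
    rw [Finset.sum_eq_single v]
    · simp [hve, hv, h1, h2]
    · intro v' _ hne
      split_ifs with h
      · by_contra h0
        have hv' := hprod v' (left_ne_zero_of_mul h0)
        have h3 := (key v' hv' h).2
        refine hne (funext fun p => Fin.ext ?_)
        exact_mod_cast (h3 p).symm.trans (h2 p)
      · rfl
    · simp
  · rw [Finset.sum_eq_zero]
    · symm
      by_contra h0
      have h1 := left_ne_zero_of_mul h0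
      rw [Finset.prod_ne_zero_iff] at h1
      have h2 : ∀ p : Fin Δ, ∃ j, blockInd M p (((e j : ℕ) : ℤ) - 1) = 1 := by
        intro p
        obtain ⟨j, _, hj⟩ := Finset.exists_ne_zero_of_sum_ne_zero (h1 p (Finset.mem_univ p))
        exact ⟨j, blockInd_ne_zero_iff.1 hj⟩
      choose j hj using h2
      -- Blocks are disjoint, so `j` is injective, and with `Δ` entries for `Δ` blocks it is a
      -- bijection. Reordering `e` along it yields the choice excluded by `hex`.
      have hinj : Function.Injective j := by
        intro p q hpq
        have h3 := hj p
        rw [hpq] at h3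
        exact Fin.ext (blockInd_unique h3 (hj q))
      have hbij : Function.Bijective j := Finite.injective_iff_bijective.1 hinj
      have hne : ∀ p, e (j p) ≠ 0 := by
        intro p h3
        have := hj p
        rw [h3] at this
        simp [blockInd_neg_one] at this
      refine hex ⟨fun p => (e (j p)).pred (hne p), fun p => ?_, ?_⟩
      · have := hj p
        have h4 : 1 ≤ (e (j p) : ℕ) := Nat.pos_of_ne_zero fun h => hne p (Fin.ext h)
        rw [Fin.val_pred, Nat.cast_sub h4]
        exact this
      · simp only [Fin.succ_pred]
        unfold tupleMonomial
        exact Fintype.sum_bijective j hbij _ _ fun _ => rfl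
    · intro v _
      split_ifs with h
      · by_contra h0
        exact hex ⟨v, hprod v (left_ne_zero_of_mul h0), h⟩
      · rfl

/-- Each of the `r ^ Δ` choices contributes at most `C`; this crude count already meets the bound in
`Explicit`. -/
theorem abs_coeff_blockPoly_le {Δ M : ℕ} {c : (Fin Δ → ℤ) → ℤ} {C : ℕ} (hc : ∀ v, |c v| ≤ C)
    (r : ℕ) (μ : Fin r →₀ ℕ) : |(blockPoly Δ M c r).coeff μ| ≤ C * ((r : ℤ) + 1) ^ Δ := by
  simp only [blockPoly, MvPolynomial.coeff_sum, MvPolynomial.coeff_monomial]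
  refine (Finset.abs_sum_le_sum_abs _ _).trans ?_
  have h1 : ∀ v : Fin Δ → Fin r, |if (tupleMonomial fun p => (v p).succ) = μ then
      (∏ p : Fin Δ, blockInd M p ((v p : ℕ) : ℤ)) * (c fun p => ((v p : ℕ) : ℤ)) else 0| ≤ (C : ℤ) := by
    intro v
    have h2 : |∏ p : Fin Δ, blockInd M p ((v p : ℕ) : ℤ)| ≤ 1 := by
      rw [Finset.abs_prod]
      refine Finset.prod_le_one (fun _ _ => abs_nonneg _) fun p _ => ?_
      unfold blockInd
      split_ifs <;> simp
    split_ifs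
    · rw [abs_mul]
      calc _ ≤ 1 * (C : ℤ) := mul_le_mul h2 (hc _) (abs_nonneg _) (by norm_num)
        _ = C := one_mul _
    · simp
  refine (Finset.sum_le_sum fun v _ => h1 v).trans ?_
  simp only [Finset.sum_const, Finset.card_univ, Fintype.card_fun, Fintype.card_fin,
    nsmul_eq_mul, Nat.cast_pow]
  rw [mul_comm]
  gcongr
  omega

theorem totalDegree_blockPoly_le (Δ M : ℕ) (c : (Fin Δ → ℤ) → ℤ) (r : ℕ) :
    (blockPoly Δ M c r).totalDegree ≤ Δ := by
  unfold blockPoly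
  refine MvPolynomial.totalDegree_finsetSum_le fun v _ => ?_
  rw [← mul_one ((∏ p : Fin Δ, blockInd M p ((v p : ℕ) : ℤ)) * _), ← MvPolynomial.C_mul_monomial,
    ← prod_X_eq_monomial]
  refine (MvPolynomial.totalDegree_mul _ _).trans ?_
  rw [MvPolynomial.totalDegree_C, zero_add]
  refine (MvPolynomial.totalDegree_finsetProd _ _).trans ?_
  refine (Finset.sum_le_sum fun p _ => (MvPolynomial.totalDegree_X (R := ℤ) (v p)).le).trans ?_
  simp

/-- The largest `β` such that `Δ` blocks of `β ^ (g + 1)` variables fit into `r` variables. -/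
def blockBase (Δ g r : ℕ) : ℕ := Nat.findGreatest (fun β => Δ * β ^ (g + 1) ≤ r) r

theorem blockBase_le (Δ g r : ℕ) : blockBase Δ g r ≤ r := Nat.findGreatest_le r

theorem mul_blockBase_pow_le (Δ g r : ℕ) : Δ * blockBase Δ g r ^ (g + 1) ≤ r :=
  Nat.findGreatest_spec (P := fun β => Δ * β ^ (g + 1) ≤ r) (m := 0) (Nat.zero_le r) (by simp)

theorem le_blockBase_iff {Δ g r β : ℕ} (hΔ : 0 < Δ) :
    β ≤ blockBase Δ g r ↔ Δ * β ^ (g + 1) ≤ r := by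
  constructor
  · intro h
    refine le_trans ?_ (mul_blockBase_pow_le Δ g r)
    gcongr
  · intro h
    refine Nat.le_findGreatest ?_ h
    calc β ≤ β ^ (g + 1) := Nat.le_self_pow (by omega) β
      _ ≤ Δ * β ^ (g + 1) := Nat.le_mul_of_pos_left _ hΔ
      _ ≤ r := h

/-- The base is not an argument of the query: the polynomial recovers it from the number of its
variables. -/
theorem blockBase_eq {Δ g β : ℕ} (hΔ : 0 < Δ) : blockBase Δ g (Δ * β ^ (g + 1)) = β := by
  refine le_antisymm ?_ ((le_blockBase_iff hΔ).2 le_rfl)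
  have := mul_blockBase_pow_le Δ g (Δ * β ^ (g + 1))
  exact le_of_not_gt fun h => absurd this (not_le.2 (by gcongr))

/-! ### Computing the coefficient table of a block polynomial -/

theorem tupleIndex_div_mod {r Δ : ℕ} (e : Fin Δ → Fin (r + 1)) (j : Fin Δ) :
    (tupleIndex e / (r + 1) ^ (j : ℕ)) % (r + 1) = e j := by
  have h := congrFun (finFunctionFinEquiv.symm_apply_apply e) j
  have h2 := congrArg Fin.val h
  rw [finFunctionFinEquiv_symm_apply_val, finFunctionFinEquiv_apply] at h2
  exact h2

theorem tupleIndex_lt {r Δ : ℕ} (e : Fin Δ → Fin (r + 1)) : tupleIndex e < (r + 1) ^ Δ := by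
  have := (finFunctionFinEquiv e).isLt
  rwa [finFunctionFinEquiv_apply] at this

/-- The program finds the base by counting upwards, then runs through the `(r + 1) ^ Δ` indices of
the table. Each tuple is decoded from its index by digits in base `r + 1`, and the formula of
`coeff_blockPoly` is one fixed arithmetic expression. All registers hold numbers of at most `Δ + 1`
words, so every step takes constant time. -/
theorem explicit_blockPoly (Δ g : ℕ) (hΔ : 0 < Δ) (c : ℤ → (Fin Δ → ℤ) → ℤ)
    (hc : Arith (V := Option (Fin Δ)) fun ρ => c (ρ none) fun p => ρ (some p))
    (C₀ : ℕ) (hC₀ : ∀ β v, |c β v| ≤ C₀) :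
    Explicit fun r => blockPoly Δ (blockBase Δ g r ^ (g + 1)) (c (blockBase Δ g r)) r := by
  -- variables: `0` is `r`, `1` is the base, `2` is the index
  let r' : (Fin 3 → ℤ) → ℤ := fun ρ => ρ 0
  let b' : (Fin 3 → ℤ) → ℤ := fun ρ => ρ 1
  let i' : (Fin 3 → ℤ) → ℤ := fun ρ => ρ 2
  have hr' : Arith r' := .var 0
  have hb' : Arith b' := .var 1
  have hi' : Arith i' := .var 2
  -- Subtracting one turns the entry `i + 1` into the variable number `i`, and the entry `0` into
  -- `-1`.
  let ent (j : Fin Δ) : (Fin 3 → ℤ) → ℤ := fun ρ => (i' ρ / (r' ρ + 1) ^ (j : ℕ)) % (r' ρ + 1) - 1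
  have hent : ∀ j, Arith (ent j) := fun j =>
    ((hi'.div ((hr'.add (.const 1)).pow _)).mod (hr'.add (.const 1))).sub (.const 1)
  let ind (p j : Fin Δ) : (Fin 3 → ℤ) → ℤ := fun ρ =>
    if (p : ℤ) * b' ρ ^ (g + 1) ≤ ent j ρ ∧ ent j ρ < (p : ℤ) * b' ρ ^ (g + 1) + b' ρ ^ (g + 1)
    then 1 else 0
  have hind : ∀ p j, Arith (ind p j) := fun p j =>
    ((((Arith.const _).mul (hb'.pow _)).le (hent j))).and
      ((hent j).lt (((Arith.const _).mul (hb'.pow _)).add (hb'.pow _)))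
  let F : (Fin 3 → ℤ) → ℤ := fun ρ =>
    (∏ p : Fin Δ, ∑ j, ind p j ρ) * c (b' ρ) fun p => ∑ j, ind p j ρ * ent j ρ
  have hF : Arith F := by
    refine (Arith.prod _ fun p => Arith.sum _ fun j => hind p j).mul ?_
    exact hc.subst (G := fun v ρ => match v with
      | none => b' ρ
      | some p => ∑ j, ind p j ρ * ent j ρ) fun v => match v with
      | none => hb'
      | some p => Arith.sum _ fun j => (hind p j).mul (hent j)
  obtain ⟨c₁, h₁⟩ := ((Arith.const Δ).mul ((hb'.add (.const 1)).pow (g + 1))).exists_expr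
  obtain ⟨c₂, h₂⟩ := (hr'.add (.const 1)).exists_expr
  obtain ⟨c₃, h₃⟩ := (hb'.add (.const 1)).exists_expr
  obtain ⟨c₄, h₄⟩ := hi'.exists_expr
  obtain ⟨c₅, h₅⟩ := ((hr'.add (.const 1)).pow Δ).exists_expr
  obtain ⟨c₆, h₆⟩ := hF.exists_expr
  obtain ⟨c₇, h₇⟩ := (hi'.add (.const 1)).exists_expr
  let τ : Fin 3 → ℕ := fun v => v
  obtain ⟨e₁, h₁⟩ := h₁ τ
  obtain ⟨e₂, h₂⟩ := h₂ τ
  obtain ⟨e₃, h₃⟩ := h₃ τ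
  obtain ⟨e₄, h₄⟩ := h₄ τ
  obtain ⟨e₅, h₅⟩ := h₅ τ
  obtain ⟨e₆, h₆⟩ := h₆ τ
  obtain ⟨e₇, h₇⟩ := h₇ τ
  -- Registers fit into `Δ + 1` words, so an expression with constant `c` costs at most `c * U`. `K`
  -- and `K'` bound one round of the two loops.
  let U : ℕ := (Δ + 1) ^ 2
  let K : ℕ := (1 + c₁ * U + c₂ * U) + (1 + c₃ * U)
  let K' : ℕ := (1 + c₄ * U + c₅ * U) + ((1 + c₄ * U + c₆ * U) + (1 + c₇ * U))
  -- A single constant has to bound both the coefficients (by `C₀`) and the running time (by the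
  -- other summands).
  refine ⟨Δ, C₀ + (Δ + 5 + K + 2 * K'), fun r => totalDegree_blockPoly_le _ _ _ _, fun r μ => ?_,
    .seq (.assign 0 (.load 0 (.const 0))) (.seq (.loop e₁ e₂ (.assign 1 e₃))
      (.loop e₄ e₅ (.seq (.store 1 e₄ e₆) (.assign 2 e₇)))), fun r => ?_⟩
  · refine (abs_coeff_blockPoly_le (hC₀ _) r μ).trans ?_
    gcongr
    linarith [Nat.cast_nonneg (α := ℤ) (Δ + 5 + K + 2 * K')]
  · set β := blockBase Δ g r with hβ
    set w := wordSize r with hw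
    have hw0 : 0 < w := Nat.succ_pos _
    have hrw : r + 1 ≤ 2 ^ w := Nat.lt_pow_succ_log_self (by norm_num) r
    let vals (σ : RAMState) (x y z : ℤ) : Prop := σ.reg 0 = x ∧ σ.reg 1 = y ∧ σ.reg 2 = z
    have hpowle : (r + 1) ^ Δ < 2 ^ (w * (Δ + 1)) := by
      calc (r + 1) ^ Δ ≤ (2 ^ w) ^ Δ := by gcongr
        _ = 2 ^ (w * Δ) := by rw [pow_mul]
        _ < 2 ^ (w * (Δ + 1)) := Nat.pow_lt_pow_right (by norm_num) (by nlinarith)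
    have hr1 : r + 1 ≤ (r + 1) ^ Δ := Nat.le_self_pow (by omega) _
    have hfits : ∀ (σ : RAMState) (y z : ℕ), vals σ r y z → y ≤ r → z ≤ (r + 1) ^ Δ →
        ∀ v : Fin 3, Fits w (Δ + 1) (σ.reg (τ v)) := by
      intro σ y z hσ hy hz v
      unfold Fits
      obtain ⟨a1, a2, a3⟩ := hσ
      fin_cases v
      · simp only [τ, Fin.zero_eta, Fin.val_zero, a1]; omega
      · simp only [τ, Fin.mk_one, Fin.val_one, a2]; omega
      · simp only [τ, Fin.reduceFinMk, Fin.val_two, a3]; omega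
    have hvals : ∀ (σ : RAMState) (x y z : ℤ), vals σ x y z →
        (fun v : Fin 3 => σ.reg (τ v)) = ![x, y, z] := by
      intro σ x y z hσ
      obtain ⟨a1, a2, a3⟩ := hσ
      funext v
      fin_cases v
      · exact a1
      · exact a2
      · exact a3
    have run : Run Oracle.none w (.seq (.assign 0 (.load 0 (.const 0)))
        (.seq (.loop e₁ e₂ (.assign 1 e₃))
          (.loop e₄ e₅ (.seq (.store 1 e₄ e₆) (.assign 2 e₇))))) (initState [(r : ℤ)])
        ((Δ + 5 + K + 2 * K') * (r + 1) ^ Δ)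
        (fun σ => ∀ a < (r + 1) ^ Δ, σ.mem 1 (a : ℤ) = F ![r, β, a]) := by
      refine Run.seq (T₁ := Δ + 5) (T₂ := (r + 1) * K + ((r + 1) ^ Δ + 1) * K')
        (Post₁ := fun σ => vals σ r 0 0) (Run.assign ?_ ?_) (fun σ hσ => ?_) ?_
      · refine ⟨?_, ?_, ?_⟩ <;> simp [initState, RAMState.setReg, Expr.eval]
      · have hr2 : Fits w (Δ + 1) (r : ℤ) := by
          unfold Fits
          rw [Int.natAbs_natCast]
          omega
        have := hr2.words_le
        simp only [Expr.cost, Expr.eval, initState, le_refl, and_self, if_true, Int.toNat_zero,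
          List.getD_cons_zero]
        have h0 : words w 0 = 1 := by simp [words]
        omega
      refine Run.seq (T₁ := (r + 1) * K) (T₂ := ((r + 1) ^ Δ + 1) * K') 
        (Post₁ := fun σ => vals σ r β 0) ?_ ?_ le_rfl
      -- The guard `Δ * (k + 1) ^ (g + 1) < r + 1` says that the base can still be raised, so it
      -- first fails at `β`.
      · refine Run.loop (Tc := 1 + c₁ * U + c₂ * U) (Tb := 1 + c₃ * U)
          (fun k σ => vals σ r k 0) β ?_ ?_ ?_ ?_
        · intro k hk σ hσ
          have hf := hfits σ k 0 hσ (by have := blockBase_le Δ g r; omega) (Nat.zero_le _)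
          have hk' := (le_blockBase_iff (β := k + 1) hΔ).1 (by omega : k + 1 ≤ blockBase Δ g r)
          rw [(h₁ σ).1, (h₂ σ).1, hvals σ _ _ _ hσ]
          refine ⟨?_, ?_, Run.assign ?_ ?_⟩
          · simp only [b', r', Matrix.cons_val_zero, Matrix.cons_val_one]
            exact_mod_cast Nat.lt_succ_of_le hk'
          · have t1 := ((h₁ σ).2 w (Δ + 1) hw0 (Nat.succ_pos Δ) hf).2
            have t2 := ((h₂ σ).2 w (Δ + 1) hw0 (Nat.succ_pos Δ) hf).2
            simp only [U]; omega
          · obtain ⟨a1, a2, a3⟩ := hσ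
            rw [(h₃ σ).1, hvals σ _ _ _ ⟨a1, a2, a3⟩]
            refine ⟨?_, ?_, ?_⟩ <;> simp [RAMState.setReg, a1, a3, b']
          · have t3 := ((h₃ σ).2 w (Δ + 1) hw0 (Nat.succ_pos Δ) hf).2
            simp only [U]; omega
        · intro σ hσ
          have hf := hfits σ β 0 hσ (blockBase_le Δ g r) (Nat.zero_le _)
          have hk' := mt (le_blockBase_iff (g := g) (r := r) (β := β + 1) hΔ).2 (by omega)
          rw [(h₁ σ).1, (h₂ σ).1, hvals σ _ _ _ hσ]
          refine ⟨?_, ?_⟩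
          · simp only [b', r', Matrix.cons_val_zero, Matrix.cons_val_one]
            intro h
            refine hk' ?_
            have : Δ * (β + 1) ^ (g + 1) < r + 1 := by exact_mod_cast h
            omega
          · have t1 := ((h₁ σ).2 w (Δ + 1) hw0 (Nat.succ_pos Δ) hf).2
            have t2 := ((h₂ σ).2 w (Δ + 1) hw0 (Nat.succ_pos Δ) hf).2
            simp only [U]; omega
        · exact_mod_cast hσ
        · have : β * K ≤ r * K := Nat.mul_le_mul_right K (blockBase_le Δ g r)
          rw [Nat.succ_mul]
          simp only [K] at *
          omega
      · intro σ hσ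
        refine (Run.loop (Tc := 1 + c₄ * U + c₅ * U)
          (Tb := (1 + c₄ * U + c₆ * U) + (1 + c₇ * U))
          (fun k σ => vals σ r β k ∧ ∀ a < k, σ.mem 1 (a : ℤ) = F ![r, β, a])
          ((r + 1) ^ Δ) ?_ ?_ ?_ le_rfl).mono ?_ (fun σ' h => h.2)
        · rintro k hk σ ⟨hσ, hm⟩
          have hf := hfits σ β k hσ (blockBase_le Δ g r) hk.le
          have t4 := ((h₄ σ).2 w (Δ + 1) hw0 (Nat.succ_pos Δ) hf).2
          have t5 := ((h₅ σ).2 w (Δ + 1) hw0 (Nat.succ_pos Δ) hf).2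
          have t6 := ((h₆ σ).2 w (Δ + 1) hw0 (Nat.succ_pos Δ) hf).2
          refine ⟨?_, ?_, Run.seq (T₁ := 1 + c₄ * U + c₆ * U) (T₂ := 1 + c₇ * U)
            (Post₁ := fun σ => vals σ r β k ∧ ∀ a < k + 1, σ.mem 1 (a : ℤ) = F ![r, β, a])
            (Run.store ?_ ?_) ?_ le_rfl⟩
          · rw [(h₄ σ).1, (h₅ σ).1, hvals σ _ _ _ hσ]
            simp only [i', r', Matrix.cons_val]
            exact_mod_cast hk
          · simp only [U]; omega
          · refine ⟨hσ, fun a ha => ?_⟩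
            rw [(h₄ σ).1, (h₆ σ).1, hvals σ _ _ _ hσ]
            simp only [RAMState.setMem, Function.update_self, i', Matrix.cons_val]
            rcases eq_or_ne a k with rfl | hne
            · simp
            · rw [Function.update_of_ne (by exact_mod_cast hne)]
              exact hm a (by omega)
          · simp only [U]; omega
          · rintro σ' ⟨hσ', hm'⟩
            have hf' := hfits σ' β k hσ' (blockBase_le Δ g r) hk.le
            have t7 := ((h₇ σ').2 w (Δ + 1) hw0 (Nat.succ_pos Δ) hf').2
            refine Run.assign ⟨?_, fun a ha => hm' a ha⟩ (by simp only [U]; omega)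
            rw [(h₇ σ').1, hvals σ' _ _ _ hσ']
            obtain ⟨a1, a2, a3⟩ := hσ'
            refine ⟨?_, ?_, ?_⟩ <;> simp [RAMState.setReg, a1, a2, i']
        · rintro σ ⟨hσ, hm⟩
          have hf := hfits σ β ((r + 1) ^ Δ) (by exact_mod_cast hσ) (blockBase_le Δ g r) le_rfl
          have t4 := ((h₄ σ).2 w (Δ + 1) hw0 (Nat.succ_pos Δ) hf).2
          have t5 := ((h₅ σ).2 w (Δ + 1) hw0 (Nat.succ_pos Δ) hf).2
          refine ⟨?_, by simp only [U]; omega⟩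
          rw [(h₄ σ).1, (h₅ σ).1, hvals σ _ _ _ hσ]
          simp only [i', r', Matrix.cons_val]
          push_cast
          exact lt_irrefl _
        · exact ⟨hσ, fun a ha => absurd ha (Nat.not_lt_zero a)⟩
        · rw [Nat.succ_mul]
          simp only [K']
          omega
      · have t0 : Δ + 5 ≤ (r + 1) ^ Δ * (Δ + 5) := Nat.le_mul_of_pos_left _ (by positivity)
        have t1 : (r + 1) * K ≤ (r + 1) ^ Δ * K := Nat.mul_le_mul_right K hr1
        have t2 : ((r + 1) ^ Δ + 1) * K' ≤ (2 * (r + 1) ^ Δ) * K' :=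
          Nat.mul_le_mul_right K' (by omega)
        calc _ ≤ (r + 1) ^ Δ * (Δ + 5) + ((r + 1) ^ Δ * K + (2 * (r + 1) ^ Δ) * K') :=
              add_le_add t0 (add_le_add t1 t2)
          _ = _ := by ring
    obtain ⟨σ, T, qs, hex, hT, hσ⟩ := run
    refine ⟨σ, T, qs, hex, hT.trans (Nat.mul_le_mul_right _ (Nat.le_add_left _ _)), fun v => ?_⟩
    rw [hσ _ (tupleIndex_lt v), coeff_blockPoly]
    have hent' : ∀ j, ent j ![(r : ℤ), β, (tupleIndex v : ℕ)] = ((v j : ℕ) : ℤ) - 1 := by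
      intro j
      simp only [ent, i', r', Matrix.cons_val]
      rw [← tupleIndex_div_mod v j]
      push_cast
      rfl
    have hind' : ∀ p j, ind p j ![(r : ℤ), β, (tupleIndex v : ℕ)] =
        blockInd (β ^ (g + 1)) p (((v j : ℕ) : ℤ) - 1) := by
      intro p j
      simp only [ind, hent', blockInd, b', Matrix.cons_val]
      push_cast
      rfl
    simp only [F, hind', hent']
    rfl

end FineGrained

namespace FineGrained

/-! ### Counting problems -/

/-- A presentation of a decision problem as the question whether a weighted number of tuples of
elements is positive. A tuple has one element for each position `t`; the elements of position `t`
in the instance `x` are numbered by the `i < num x t`, and the `i`-th one has `F + 1` labels, the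
`f`-th of which is the entry of the input list at the place `pos x t f i`. The weight of a tuple
depends on the numbers and the labels of its elements. -/
structure Counting (A : Problem) where
  ι : Type
  fintype : Fintype ι
  decEq : DecidableEq ι
  nonempty : Nonempty ι
  F : ℕ
  G : (ι → ℤ) → (ι → Fin (F + 1) → ℤ) → ℤ
  arith_G : Arith (V := ι ⊕ ι × Fin (F + 1)) fun ρ =>
    G (fun t => ρ (.inl t)) fun t f => ρ (.inr (t, f))
  boundG : ℕ
  abs_G_le : ∀ i l, |G i l| ≤ boundG
  header : ℕ
  sz : ℤ → ℤ → ℤ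
  arith_sz : Arith (V := Fin 2) fun ρ => sz (ρ 0) (ρ 1)
  cnt : ι → ℤ → ℤ → ℤ
  arith_cnt : ∀ t, Arith (V := Fin 2) fun ρ => cnt t (ρ 0) (ρ 1)
  addr : ι → Fin (F + 1) → ℤ → ℤ → ℤ → ℤ
  arith_addr : ∀ t f, Arith (V := Fin 3) fun ρ => addr t f (ρ 0) (ρ 1) (ρ 2)
  num : A.Instance → ι → ℕ
  pos : A.Instance → ι → Fin (F + 1) → ℕ → ℕ
  header_lt : ∀ x, header < (A.encode x).length
  sz_eq : ∀ x, sz ((A.encode x).getD 0 0) ((A.encode x).getD header 0) = A.size x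
  cnt_eq : ∀ x t, cnt t ((A.encode x).getD 0 0) ((A.encode x).getD header 0) = num x t
  num_le : ∀ x t, num x t ≤ A.size x + 1
  addr_eq : ∀ x t f (i : ℕ), i < num x t →
    addr t f ((A.encode x).getD 0 0) ((A.encode x).getD header 0) i = pos x t f i
  pos_lt : ∀ x t f i, i < num x t → pos x t f i < (A.encode x).length
  bound : ℕ
  abs_le : ∀ x, ∀ a ∈ A.encode x, |a| ≤ bound * ((A.size x : ℤ) + 1) ^ bound
  yes_iff : ∀ x, A.Yes x ↔ 0 < ∑ i ∈ Fintype.piFinset fun t => Finset.range (num x t),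
    G (fun t => (i t : ℤ)) fun t f => (A.encode x).getD (pos x t f (i t)) 0

attribute [instance] Counting.fintype Counting.decEq Counting.nonempty

namespace Counting

variable {A : Problem} (K : Counting A)

/-- The number of blocks if labels have `D + 1` digits. -/
def numBlocks (D : ℕ) : ℕ := Fintype.card (K.ι × Fin (K.F + 1) × Fin (D + 1))

/-- The blocks are indexed by a position, a label, and a digit of the label. -/
noncomputable def blockEquiv (D : ℕ) :
    K.ι × Fin (K.F + 1) × Fin (D + 1) ≃ Fin (K.numBlocks D) := Fintype.equivFin _

theorem numBlocks_pos (D : ℕ) : 0 < K.numBlocks D := Fintype.card_pos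

/-- The coefficient of a product of variables, one from each block: the variable numbered
`i * β + d` of the block of `(t, f, j)` stands for the statement that the `j`-th digit of the
`f`-th label of the `i`-th element of position `t` is `d`. -/
noncomputable def coef (g D : ℕ) (β : ℤ) (v : Fin (K.numBlocks D) → ℤ) : ℤ :=
  let off (t f j) : ℤ := v (K.blockEquiv D (t, f, j)) -
    ((K.blockEquiv D (t, f, j) : ℕ) : ℤ) * β ^ (g + 1)
  -- The product checks that all digits guessed for a position belong to the same element. Labels
  -- may be negative, so their digits are taken after adding `β ^ D`, which is subtracted again
  -- here.
  (∏ t, ∏ f, ∏ j, if off t f j / β = off t 0 0 / β then (1 : ℤ) else 0) *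
    K.G (fun t => off t 0 0 / β) fun t f => ∑ j, off t f j % β * β ^ (j : ℕ) - β ^ D

theorem arith_coef (g D : ℕ) : Arith (V := Option (Fin (K.numBlocks D))) fun ρ =>
    K.coef g D (ρ none) fun p => ρ (some p) := by
  let β' : (Option (Fin (K.numBlocks D)) → ℤ) → ℤ := fun ρ => ρ none
  have hβ : Arith β' := .var _
  let off (t f j) : (Option (Fin (K.numBlocks D)) → ℤ) → ℤ := fun ρ =>
    ρ (some (K.blockEquiv D (t, f, j))) - ((K.blockEquiv D (t, f, j) : ℕ) : ℤ) * β' ρ ^ (g + 1)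
  have hoff : ∀ t f j, Arith (off t f j) := fun t f j =>
    (Arith.var _).sub ((Arith.const _).mul (hβ.pow _))
  refine Arith.mul (f := fun ρ => ∏ t, ∏ f, ∏ j,
    if off t f j ρ / β' ρ = off t 0 0 ρ / β' ρ then (1 : ℤ) else 0) ?_ ?_
  · exact Arith.prod _ fun t => Arith.prod _ fun f => Arith.prod _ fun j =>
      ((hoff t f j).div hβ).eq ((hoff t 0 0).div hβ)
  · exact K.arith_G.subst (G := fun v ρ => match v with
      | .inl t => off t 0 0 ρ / β' ρ
      | .inr (t, f) => ∑ j : Fin (D + 1), off t f j ρ % β' ρ * β' ρ ^ (j : ℕ) - β' ρ ^ D)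
      fun v => match v with
      | .inl t => (hoff t 0 0).div hβ
      | .inr (t, f) =>
        (Arith.sum _ fun j => ((hoff t f j).mod hβ).mul (hβ.pow _)).sub (hβ.pow _)

theorem abs_coef_le (g D : ℕ) (β : ℤ) (v : Fin (K.numBlocks D) → ℤ) :
    |K.coef g D β v| ≤ K.boundG := by
  unfold coef
  rw [abs_mul]
  refine (mul_le_mul (b := 1) ?_ (K.abs_G_le _ _) (abs_nonneg _) (by norm_num)).trans
    (one_mul _).le
  rw [Finset.abs_prod]
  refine Finset.prod_le_one (fun _ _ => abs_nonneg _) fun t _ => ?_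
  rw [Finset.abs_prod]
  refine Finset.prod_le_one (fun _ _ => abs_nonneg _) fun f _ => ?_
  rw [Finset.abs_prod]
  refine Finset.prod_le_one (fun _ _ => abs_nonneg _) fun j _ => ?_
  split_ifs <;> simp

/-- The polynomials for a counting problem. -/
noncomputable def family (g D : ℕ) : PolyFamily := fun r =>
  blockPoly (K.numBlocks D) (blockBase (K.numBlocks D) g r ^ (g + 1))
    (K.coef g D (blockBase (K.numBlocks D) g r)) r

theorem explicit_family (g D : ℕ) : Explicit (K.family g D) :=
  explicit_blockPoly (K.numBlocks D) g (K.numBlocks_pos D) (K.coef g D) (K.arith_coef g D)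
    K.boundG (K.abs_coef_le g D)

/-- The weighted number of tuples. -/
def total (x : A.Instance) : ℤ := ∑ i ∈ Fintype.piFinset fun t => Finset.range (K.num x t),
    K.G (fun t => (i t : ℤ)) fun t f => (A.encode x).getD (K.pos x t f (i t)) 0

/-- The variable standing for the `j`-th digit of the `f`-th label of the `i`-th element of
position `t`. -/
noncomputable def cell (g D : ℕ) (x : A.Instance) (β : ℤ) (t : K.ι) (f : Fin (K.F + 1))
    (j : Fin (D + 1)) (i : ℕ) : ℤ :=
  ((K.blockEquiv D (t, f, j) : ℕ) : ℤ) * β ^ (g + 1) + i * β +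
    ((A.encode x).getD (K.pos x t f i) 0 + β ^ D) / β ^ (j : ℕ) % β

end Counting

/-! ### Evaluating the polynomial at the table of digits -/

theorem sum_digits (β : ℤ) (hβ : 0 < β) (z : ℤ) (n : ℕ) :
    ∑ j : Fin n, z / β ^ (j : ℕ) % β * β ^ (j : ℕ) = z % β ^ n := by
  induction n with
  | zero => simp
  | succ n ih =>
    rw [Fin.sum_univ_castSucc]
    simp only [Fin.val_castSucc, Fin.val_last, ih]
    rw [pow_succ, Int.emod_def z (β ^ n * β), Int.emod_def z (β ^ n), Int.emod_def _ β,
      ← Int.ediv_ediv_of_nonneg (by positivity)]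
    ring

namespace Counting

variable {A : Problem} (K : Counting A)

/-- Nonzero terms of the count and of the polynomial correspond bijectively: a tuple selects in
every block the cell of its true digit. Conversely, a surviving choice selects cells with argument
1, the consistency factor makes all cells of a position name one element, and then `G` is applied to
the true labels. -/
theorem eval_family (g D : ℕ) (x : A.Instance) (β : ℕ) (hβ : 2 ≤ β)
    (hnum : ∀ t, K.num x t ≤ β ^ g) (hval : ∀ a ∈ A.encode x, |a| < (β : ℤ) ^ D)
    (L : List ℤ) (hL : L.length = K.numBlocks D * β ^ (g + 1)) (S : Set ℤ)
    [DecidablePred (· ∈ S)]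
    (hS : ∀ a, a ∈ S ↔ ∃ t f j, ∃ i < K.num x t, a = K.cell g D x β t f j i)
    (hLS : ∀ a (h : a < L.length), L[a] = if (a : ℤ) ∈ S then 1 else 0) :
    MvPolynomial.eval (fun i => L.get i) (K.family g D L.length) = K.total x := by
  have hβ0 : (0 : ℤ) < β := by exact_mod_cast (by omega : 0 < β)
  have hbase : blockBase (K.numBlocks D) g L.length = β := by
    rw [hL]; exact blockBase_eq (K.numBlocks_pos D)
  set Δ := K.numBlocks D with hΔ
  set M := β ^ (g + 1) with hM
  -- the place of a cell in its block
  have hcell : ∀ t f j, ∀ i < K.num x t, ∃ o : ℤ, 0 ≤ o ∧ o < M ∧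
      K.cell g D x β t f j i = ((K.blockEquiv D (t, f, j) : ℕ) : ℤ) * M + o ∧ o / β = i ∧
      o % β = ((A.encode x).getD (K.pos x t f i) 0 + (β : ℤ) ^ D) / (β : ℤ) ^ (j : ℕ) % β := by
    intro t f j i hi
    set d := ((A.encode x).getD (K.pos x t f i) 0 + (β : ℤ) ^ D) / (β : ℤ) ^ (j : ℕ) % β with hd
    have hd0 : 0 ≤ d := Int.emod_nonneg _ hβ0.ne'
    have hd1 : d < β := Int.emod_lt_of_pos _ hβ0
    refine ⟨i * β + d, by positivity, ?_, ?_, ?_, ?_⟩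
    · have h1 : (i : ℤ) + 1 ≤ (β : ℤ) ^ g := by exact_mod_cast hi.trans_le (hnum t)
      have h2 := mul_le_mul_of_nonneg_right h1 hβ0.le
      rw [hM]
      push_cast
      rw [pow_succ]
      linarith
    · rw [cell, hM]
      push_cast
      ring
    · rw [add_comm, Int.add_mul_ediv_right _ _ hβ0.ne', Int.ediv_eq_zero_of_lt hd0 hd1, zero_add]
    · rw [add_comm, Int.add_mul_emod_self_right, Int.emod_eq_of_lt hd0 hd1]
  have hblock : ∀ t f j, ∀ i < K.num x t,
      blockInd M (K.blockEquiv D (t, f, j)) (K.cell g D x β t f j i) = 1 := by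
    intro t f j i hi
    obtain ⟨o, h0, h1, h2, -⟩ := hcell t f j i hi
    rw [blockInd_eq_one_iff, h2]
    constructor <;> linarith
  have hcell_lt : ∀ t f j, ∀ i < K.num x t, 0 ≤ K.cell g D x β t f j i ∧
      (K.cell g D x β t f j i).toNat < L.length := by
    intro t f j i hi
    obtain ⟨o, h0, h1, h2, -⟩ := hcell t f j i hi
    have h3 : 0 ≤ K.cell g D x β t f j i := by rw [h2]; positivity
    refine ⟨h3, ?_⟩
    zify
    rw [Int.toNat_of_nonneg h3, h2, hL]
    have h4 : ((K.blockEquiv D (t, f, j) : ℕ) : ℤ) + 1 ≤ Δ := by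
      exact_mod_cast (K.blockEquiv D (t, f, j)).isLt
    have h5 := mul_le_mul_of_nonneg_right h4 (Nat.cast_nonneg (α := ℤ) M)
    push_cast at h5 ⊢
    linarith
  have hdigits : ∀ t f, ∀ i < K.num x t, ∑ j : Fin (D + 1),
      ((A.encode x).getD (K.pos x t f i) 0 + (β : ℤ) ^ D) / (β : ℤ) ^ (j : ℕ) % β *
        (β : ℤ) ^ (j : ℕ) - (β : ℤ) ^ D = (A.encode x).getD (K.pos x t f i) 0 := by
    intro t f i hi
    have h1 := hval _ (List.getElem_mem (K.pos_lt x t f i hi))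
    rw [← List.getD_eq_getElem _ 0] at h1
    rw [abs_lt] at h1
    rw [sum_digits _ hβ0, Int.emod_eq_of_lt (by linarith) ?_, add_sub_cancel_right]
    -- A shifted label lies between `0` and `2 * β ^ D`; because `β ≥ 2`, it has at most `D + 1`
    -- digits.
    have h2 : (2 : ℤ) * (β : ℤ) ^ D ≤ (β : ℤ) ^ (D + 1) := by
      rw [pow_succ']
      gcongr
      exact_mod_cast hβ
    linarith
  unfold family
  rw [hbase]
  simp only [blockPoly, map_sum]
  symm
  unfold total
  refine Finset.sum_bij_ne_zero
    (fun i hi _ p => ⟨(K.cell g D x β ((K.blockEquiv D).symm p).1 ((K.blockEquiv D).symm p).2.1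
      ((K.blockEquiv D).symm p).2.2 (i ((K.blockEquiv D).symm p).1)).toNat,
      (hcell_lt _ _ _ _ (Finset.mem_range.1 (Fintype.mem_piFinset.1 hi _))).2⟩)
    (fun _ _ _ => Finset.mem_univ _) ?_ ?_ ?_
  · intro i hi _ i' hi' _ h
    funext t
    have h1 := congrArg Fin.val (congrFun h (K.blockEquiv D (t, 0, 0)))
    simp only [Equiv.symm_apply_apply] at h1
    have hi1 := Finset.mem_range.1 (Fintype.mem_piFinset.1 hi t)
    have hi2 := Finset.mem_range.1 (Fintype.mem_piFinset.1 hi' t)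
    have h2 : K.cell g D x β t 0 0 (i t) = K.cell g D x β t 0 0 (i' t) := by
      rw [← Int.toNat_of_nonneg (hcell_lt t 0 0 _ hi1).1,
        ← Int.toNat_of_nonneg (hcell_lt t 0 0 _ hi2).1, h1]
    obtain ⟨o, _, _, h3, h4, _⟩ := hcell t 0 0 _ hi1
    obtain ⟨o', _, _, h3', h4', _⟩ := hcell t 0 0 _ hi2
    rw [h3, h3'] at h2
    have h5 : o = o' := by linarith
    rw [h5] at h4
    exact_mod_cast h4.symm.trans h4'
  · intro v _ hv
    rw [← mul_one ((∏ p : Fin Δ, blockInd M p ((v p : ℕ) : ℤ)) * _),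
      ← MvPolynomial.C_mul_monomial, ← prod_X_eq_monomial] at hv
    simp only [map_mul, MvPolynomial.eval_C, map_prod, MvPolynomial.eval_X] at hv
    have hv1 := left_ne_zero_of_mul (left_ne_zero_of_mul hv)
    have hv2 := right_ne_zero_of_mul (left_ne_zero_of_mul hv)
    have hv3 := right_ne_zero_of_mul hv
    have hc : ∀ t f j, ∃ i < K.num x t,
        ((v (K.blockEquiv D (t, f, j)) : ℕ) : ℤ) = K.cell g D x β t f j i := by
      intro t f j
      have h1 := blockInd_ne_zero_iff.1
        (Finset.prod_ne_zero_iff.1 hv1 (K.blockEquiv D (t, f, j)) (Finset.mem_univ _))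
      have h2 := Finset.prod_ne_zero_iff.1 hv3 (K.blockEquiv D (t, f, j)) (Finset.mem_univ _)
      rw [List.get_eq_getElem, hLS] at h2
      have h3 : ((v (K.blockEquiv D (t, f, j)) : ℕ) : ℤ) ∈ S := by
        by_contra h; exact h2 (if_neg h)
      obtain ⟨t', f', j', i, hi, h4⟩ := (hS _).1 h3
      rw [h4] at h1
      -- The cell with argument 1 could a priori come from another position, label or digit place;
      -- disjointness of the blocks excludes this.
      have h5 := (K.blockEquiv D).injective (Fin.ext (blockInd_unique h1 (hblock t' f' j' i hi)))
      simp only [Prod.mk.injEq] at h5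
      obtain ⟨rfl, rfl, rfl⟩ := h5
      exact ⟨i, hi, h4⟩
    choose i hi hiv using hc
    -- The coefficient is nonzero, so all its consistency factors are 1.
    have hcons : ∀ t f j, i t f j = i t 0 0 := by
      intro t f j
      have h1 := left_ne_zero_of_mul hv2
      have h2 := Finset.prod_ne_zero_iff.1 (Finset.prod_ne_zero_iff.1 (Finset.prod_ne_zero_iff.1
        h1 t (Finset.mem_univ _)) f (Finset.mem_univ _)) j (Finset.mem_univ _)
      have h3 := of_not_not fun h => h2 (if_neg h)
      have aux : ∀ t f j, (((v (K.blockEquiv D (t, f, j)) : ℕ) : ℤ) -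
          ((K.blockEquiv D (t, f, j) : ℕ) : ℤ) * (β : ℤ) ^ (g + 1)) / β = i t f j := by
        intro t f j
        obtain ⟨o, _, _, h4, h5, _⟩ := hcell t f j _ (hi t f j)
        rw [hiv, h4, hM]
        push_cast
        rw [add_sub_cancel_left, h5]
      rw [aux, aux] at h3
      exact_mod_cast h3
    have hmem : (fun t => i t 0 0) ∈ Fintype.piFinset fun t => Finset.range (K.num x t) :=
      Fintype.mem_piFinset.2 fun t => Finset.mem_range.2 (hi t 0 0)
    refine ⟨fun t => i t 0 0, hmem, ?_, ?_⟩
    · have h1 := right_ne_zero_of_mul hv2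
      convert h1 using 2
      · funext t
        obtain ⟨o, _, _, h4, h5, _⟩ := hcell t 0 0 _ (hi t 0 0)
        beta_reduce
        rw [hiv, h4, hM]
        push_cast
        rw [add_sub_cancel_left, h5]
      · funext t f
        rw [← hdigits t f _ (hi t 0 0)]
        congr 1
        refine Finset.sum_congr rfl fun j _ => ?_
        obtain ⟨o, _, _, h4, _, h5⟩ := hcell t f j _ (hi t f j)
        beta_reduce
        rw [hiv, h4, hM]
        push_cast
        rw [add_sub_cancel_left, h5, hcons t f j]
    · funext p
      obtain ⟨⟨t, f, j⟩, rfl⟩ := (K.blockEquiv D).surjective p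
      refine Fin.ext ?_
      simp only [Equiv.symm_apply_apply]
      rw [← hcons t f j, ← hiv, Int.toNat_natCast]
  · intro i hi _
    have hi' : ∀ t, i t < K.num x t := fun t => Finset.mem_range.1 (Fintype.mem_piFinset.1 hi t)
    set v : Fin Δ → Fin L.length := fun p =>
      ⟨(K.cell g D x β ((K.blockEquiv D).symm p).1 ((K.blockEquiv D).symm p).2.1
      ((K.blockEquiv D).symm p).2.2 (i ((K.blockEquiv D).symm p).1)).toNat,
      (hcell_lt _ _ _ _ (hi' _)).2⟩ with hv
    have hvc : ∀ t f j, ((v (K.blockEquiv D (t, f, j)) : ℕ) : ℤ) =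
        K.cell g D x β t f j (i t) := by
      intro t f j
      simp only [hv, Equiv.symm_apply_apply]
      exact Int.toNat_of_nonneg (hcell_lt _ _ _ _ (hi' _)).1
    rw [← mul_one ((∏ p : Fin Δ, blockInd M p ((v p : ℕ) : ℤ)) * _),
      ← MvPolynomial.C_mul_monomial, ← prod_X_eq_monomial]
    simp only [map_mul, MvPolynomial.eval_C, map_prod, MvPolynomial.eval_X]
    rw [Finset.prod_eq_one, Finset.prod_eq_one, one_mul, mul_one]
    · unfold coef
      dsimp only
      rw [Finset.prod_eq_one, one_mul]
      · congr 1
        · funext t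
          obtain ⟨o, _, _, h4, h5, _⟩ := hcell t 0 0 _ (hi' t)
          rw [hvc, h4, hM]
          push_cast
          rw [add_sub_cancel_left, h5]
        · funext t f
          rw [← hdigits t f _ (hi' t)]
          congr 1
          refine Finset.sum_congr rfl fun j _ => ?_
          obtain ⟨o, _, _, h4, _, h5⟩ := hcell t f j _ (hi' t)
          rw [hvc, h4, hM]
          push_cast
          rw [add_sub_cancel_left, h5]
      · intro t _
        refine Finset.prod_eq_one fun f _ => Finset.prod_eq_one fun j _ => if_pos ?_
        obtain ⟨o, _, _, h4, h5, _⟩ := hcell t f j _ (hi' t)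
        obtain ⟨o', _, _, h4', h5', _⟩ := hcell t 0 0 _ (hi' t)
        rw [hvc, hvc, h4, h4', hM]
        push_cast
        rw [add_sub_cancel_left, add_sub_cancel_left, h5, h5']
    · intro p _
      obtain ⟨⟨t, f, j⟩, rfl⟩ := (K.blockEquiv D).surjective p
      rw [List.get_eq_getElem, hLS, if_pos]
      rw [hvc, hS]
      exact ⟨t, f, j, i t, hi' t, rfl⟩
    · intro p _
      obtain ⟨⟨t, f, j⟩, rfl⟩ := (K.blockEquiv D).surjective p
      rw [hvc]
      exact hblock t f j _ (hi' t)

end Counting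

end FineGrained

namespace FineGrained

/-! ### A program solving a counting problem with one call of the polynomial -/

/-- The expression computes the function `f` of the registers `R, …, R + 4`, with cost at most
`c * u ^ 2` if these contain integers of at most `w * u` bits. -/
def Expr.Computes (e : Expr) (R c : ℕ) (f : (Fin 5 → ℤ) → ℤ) : Prop :=
  ∀ σ : RAMState, e.eval σ = f (fun v => σ.reg (R + v)) ∧
    ∀ w u, 0 < w → 0 < u → (∀ v : Fin 5, Fits w u (σ.reg (R + v))) → e.cost w σ ≤ c * u ^ 2

theorem Expr.Computes.mono {e : Expr} {R c d : ℕ} {f : (Fin 5 → ℤ) → ℤ} (h : e.Computes R c f)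
    (hcd : c ≤ d) : e.Computes R d f := fun σ =>
  ⟨(h σ).1, fun w u hw hu hf => ((h σ).2 w u hw hu hf).trans (Nat.mul_le_mul_right _ hcd)⟩

theorem Arith.exists_computes {f : (Fin 5 → ℤ) → ℤ} (hf : Arith f) :
    ∃ c : ℕ, ∀ R : ℕ, ∃ e : Expr, e.Computes R c f := by
  obtain ⟨c, h⟩ := hf.exists_expr
  refine ⟨c, fun R => ?_⟩
  obtain ⟨e, he⟩ := h fun v => R + v
  exact ⟨e, fun σ => ⟨(he σ).1, fun w u hw hu hf => ((he σ).2 w u hw hu hf).2⟩⟩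

theorem Arith.exists_computes_family {κ : Type*} [Fintype κ] {f : κ → (Fin 5 → ℤ) → ℤ}
    (hf : ∀ k, Arith (f k)) :
    ∃ c : ℕ, ∀ R : ℕ, ∃ e : κ → Expr, ∀ k, (e k).Computes R c (f k) := by
  choose c h using fun k => (hf k).exists_computes
  choose e he using h
  exact ⟨∑ k, c k, fun R => ⟨fun k => e k R, fun k => (he k R).mono
    (Finset.single_le_sum (f := c) (fun _ _ => Nat.zero_le _) (Finset.mem_univ k))⟩⟩

/-- The configuration agrees with `σ₀` in the registers below `R` and the banks below `B`, and the
registers `R, …, R + 4` contain the values `ρ`. -/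
def Workspace (R B : ℕ) (σ₀ : RAMState) (ρ : Fin 5 → ℤ) (σ : RAMState) : Prop :=
  (∀ r < R, σ.reg r = σ₀.reg r) ∧ (∀ b < B, σ.mem b = σ₀.mem b) ∧
    (fun v : Fin 5 => σ.reg (R + v)) = ρ

section Workspace

variable {R B : ℕ} {σ₀ σ : RAMState} {ρ : Fin 5 → ℤ}

theorem Workspace.setReg (h : Workspace R B σ₀ ρ σ) (v : Fin 5) (z : ℤ) :
    Workspace R B σ₀ (Function.update ρ v z) (σ.setReg (R + v) z) := by
  obtain ⟨h1, h2, h3⟩ := h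
  refine ⟨fun r hr => ?_, h2, ?_⟩
  · rw [← h1 r hr]
    exact Function.update_of_ne (by omega) _ _
  · funext v'
    rw [← h3]
    simp only [RAMState.setReg, Function.update_apply, Nat.add_left_cancel_iff, Fin.val_inj]

theorem Workspace.setMem (h : Workspace R B σ₀ ρ σ) (a z : ℤ) :
    Workspace R B σ₀ ρ (σ.setMem B a z) := by
  obtain ⟨h1, h2, h3⟩ := h
  refine ⟨h1, fun b hb => ?_, h3⟩
  rw [← h2 b hb]
  exact Function.update_of_ne (by omega) _ _

theorem Workspace.eval_eq (h : Workspace R B σ₀ ρ σ) {e : Expr} {c : ℕ} {f : (Fin 5 → ℤ) → ℤ}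
    (he : e.Computes R c f) : e.eval σ = f ρ := by
  rw [(he σ).1, h.2.2]

theorem Workspace.cost_le (h : Workspace R B σ₀ ρ σ) {e : Expr} {c w u : ℕ}
    {f : (Fin 5 → ℤ) → ℤ} (he : e.Computes R c f) (hw : 0 < w) (hu : 0 < u)
    (hρ : ∀ v, Fits w u (ρ v)) : e.cost w σ ≤ c * u ^ 2 :=
  (he σ).2 w u hw hu fun v => by
    have := congrFun h.2.2 v
    rw [this]
    exact hρ v

end Workspace

theorem RAMState.segment_eq (σ : RAMState) (b len : ℕ) :
    σ.segment b len = (List.range len).map fun i : ℕ => σ.mem b (i : ℤ) := by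
  simp [RAMState.segment, List.map_eq_flatMap, List.flatMap_assoc]

theorem RAMState.length_segment (σ : RAMState) (b len : ℕ) : (σ.segment b len).length = len := by
  simp [RAMState.segment_eq]

theorem RAMState.getElem_segment (σ : RAMState) (b len i : ℕ) (h : i < (σ.segment b len).length) :
    (σ.segment b len)[i] = σ.mem b (i : ℤ) := by
  simp [RAMState.segment_eq]

/-- Loops over index sets of constant size are unrolled into the program. The set `S` records which
cells have been marked so far and grows by `E a` with each piece. -/
theorem Run.list {O : Oracle} {w : ℕ} {α : Type*} (body : α → Program) (E : α → Set ℤ)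
    (P : Set ℤ → RAMState → Prop) (T : ℕ) (l : List α)
    (h : ∀ a ∈ l, ∀ S σ, P S σ → Run O w (body a) σ T (P (S ∪ E a))) (S : Set ℤ) (σ : RAMState)
    (hσ : P S σ) :
    Run O w (l.foldr (fun a q => .seq (body a) q) .skip) σ (l.length * T + 1)
      (P (S ∪ ⋃ a ∈ l, E a)) := by
  induction l generalizing S σ with
  | nil => exact Run.skip (by simpa using hσ) (by simp)
  | cons a l ih =>
    refine Run.seq (h a (by simp) S σ hσ)
      (fun σ' hσ' => ih (fun a' ha' => h a' (by simp [ha'])) (S ∪ E a) σ' hσ') ?_ |>.mono le_rfl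
        fun σ' hσ' => ?_
    · simp only [List.length_cons]
      rw [Nat.succ_mul]
      omega
    · simpa [Set.union_assoc] using hσ'

namespace Counting

variable {A : Problem} (K : Counting A)

set_option maxHeartbeats 2000000 in
-- The program searches for the least `β ≥ 2` with `s < β ^ g`, clears an array in the free bank
-- `B`, marks the cells of all digits of all labels, asks one question and tests the sign of the
-- answer. Here `β = n + 2`, as the search starts at `2` and makes `n` steps. Arguments are 0 or 1,
-- so `bits = 0` is enough. The word length `w` is arbitrary because the solver will run inside a
-- reduction, where `w` belongs to the outer instance; the assumed bounds put all numbers below `2 ^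
-- u`, hence into `u` words.
theorem exists_solver (g D : ℕ) :
    ∃ c : ℕ, ∀ ro b R B : ℕ, ∃ prog : Program, ∀ (w u : ℕ) (x : A.Instance) (σ : RAMState)
      (n : ℕ), 0 < w → 0 < u → ro < R → b < B →
      (∀ i (h : i < (A.encode x).length), σ.mem b (i : ℤ) = (A.encode x)[i]) →
      A.size x < (n + 2) ^ g → (∀ k < n, (k + 2) ^ g ≤ A.size x) →
      (∀ a ∈ A.encode x, |a| < ((n + 2 : ℕ) : ℤ) ^ D) →
      K.numBlocks D * (n + 2) ^ (g + 1) < 2 ^ u → A.size x + 2 < 2 ^ u →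
      (∀ a ∈ A.encode x, |a| < 2 ^ u) → |K.total x| < 2 ^ u →
      Run (polyOracle (K.family g D) fun _ => 0) w prog σ
        (c * (K.numBlocks D * (n + 2) ^ (g + 1) + A.size x + 1) * u ^ 2)
        fun σ' => (∀ r < R, r ≠ ro → σ'.reg r = σ.reg r) ∧ (∀ b' < B, σ'.mem b' = σ.mem b') ∧
          σ'.reg ro = truthValue (A.Yes x) := by
  classical
  set Δ := K.numBlocks D with hΔ
  have hΔ0 : 0 < Δ := K.numBlocks_pos D
  have v0 : Arith (V := Fin 5) fun ρ => ρ 0 := .var 0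
  have v1 : Arith (V := Fin 5) fun ρ => ρ 1 := .var 1
  have v2 : Arith (V := Fin 5) fun ρ => ρ 2 := .var 2
  have v3 : Arith (V := Fin 5) fun ρ => ρ 3 := .var 3
  have v4 : Arith (V := Fin 5) fun ρ => ρ 4 := .var 4
  have hsz : Arith (V := Fin 5) fun ρ => K.sz (ρ 0) (ρ 1) :=
    K.arith_sz.subst (G := fun v ρ => ρ (![0, 1] v)) fun v => .var _
  have hcnt : ∀ t, Arith (V := Fin 5) fun ρ => K.cnt t (ρ 0) (ρ 1) := fun t =>
    (K.arith_cnt t).subst (G := fun v ρ => ρ (![0, 1] v)) fun v => .var _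
  have haddr : ∀ p : K.ι × Fin (K.F + 1),
      Arith (V := Fin 5) fun ρ => K.addr p.1 p.2 (ρ 0) (ρ 1) (ρ 3) := fun p =>
    (K.arith_addr p.1 p.2).subst (G := fun v ρ => ρ (![0, 1, 3] v)) fun v => .var _
  let cl (p : K.ι × Fin (K.F + 1) × Fin (D + 1)) : (Fin 5 → ℤ) → ℤ := fun ρ =>
    ((K.blockEquiv D p : ℕ) : ℤ) * ρ 2 ^ (g + 1) + ρ 3 * ρ 2 +
      (ρ 4 + ρ 2 ^ D) / ρ 2 ^ (p.2.2 : ℕ) % ρ 2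
  have hcl : ∀ p, Arith (cl p) := fun p =>
    (((Arith.const _).mul (v2.pow _)).add (v3.mul v2)).add
      (((v4.add (v2.pow _)).div (v2.pow _)).mod v2)
  obtain ⟨c₁, h₁⟩ := (v2.pow g).exists_computes
  obtain ⟨c₂, h₂⟩ := (hsz.add (.const 1)).exists_computes
  obtain ⟨c₃, h₃⟩ := (v2.add (.const 1)).exists_computes
  obtain ⟨c₄, h₄⟩ := ((Arith.const Δ).mul (v2.pow (g + 1))).exists_computes
  obtain ⟨c₅, h₅⟩ := v3.exists_computes
  obtain ⟨c₆, h₆⟩ := (v3.add (.const 1)).exists_computes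
  obtain ⟨c₇, h₇⟩ := Arith.exists_computes_family hcnt
  obtain ⟨c₈, h₈⟩ := Arith.exists_computes_family haddr
  obtain ⟨c₉, h₉⟩ := Arith.exists_computes_family hcl
  obtain ⟨c, hc⟩ : ∃ c, c = c₁ + c₂ + c₃ + c₄ + c₅ + c₆ + c₇ + c₈ + c₉ + K.header := ⟨_, rfl⟩
  obtain ⟨K₁, hK₁⟩ : ∃ K₁, K₁ = (K.F + 1) * (2 + 2 * (D + 1)) + 1 := ⟨_, rfl⟩
  obtain ⟨N, hN⟩ : ∃ N, N = Fintype.card K.ι := ⟨_, rfl⟩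
  refine ⟨(c + 6) * (30 + N * (K₁ + 10)), fun ro b R B => ?_⟩
  obtain ⟨e₁, h₁⟩ := h₁ R
  obtain ⟨e₂, h₂⟩ := h₂ R
  obtain ⟨e₃, h₃⟩ := h₃ R
  obtain ⟨e₄, h₄⟩ := h₄ R
  obtain ⟨e₅, h₅⟩ := h₅ R
  obtain ⟨e₆, h₆⟩ := h₆ R
  obtain ⟨e₇, h₇⟩ := h₇ R
  obtain ⟨e₈, h₈⟩ := h₈ R
  obtain ⟨e₉, h₉⟩ := h₉ R
  replace h₁ := h₁.mono (show c₁ ≤ c by omega)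
  replace h₂ := h₂.mono (show c₂ ≤ c by omega)
  replace h₃ := h₃.mono (show c₃ ≤ c by omega)
  replace h₄ := h₄.mono (show c₄ ≤ c by omega)
  replace h₅ := h₅.mono (show c₅ ≤ c by omega)
  replace h₆ := h₆.mono (show c₆ ≤ c by omega)
  replace h₇ := fun t => (h₇ t).mono (show c₇ ≤ c by omega)
  replace h₈ := fun t => (h₈ t).mono (show c₈ ≤ c by omega)
  replace h₉ := fun t => (h₉ t).mono (show c₉ ≤ c by omega)
  let digits (t : K.ι) (f : Fin (K.F + 1)) : Program :=
    (Finset.univ.toList : List (Fin (D + 1))).foldr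
      (fun j q => .seq (.store B (e₉ (t, f, j)) (.const 1)) q) .skip
  let labels (t : K.ι) : Program :=
    (Finset.univ.toList : List (Fin (K.F + 1))).foldr
      (fun f q => .seq (.seq (.assign (R + (4 : Fin 5)) (.load b (e₈ (t, f)))) (digits t f)) q)
      .skip
  let positions : Program :=
    (Finset.univ.toList : List K.ι).foldr
      (fun t q => .seq (.seq (.assign (R + (3 : Fin 5)) (.const 0))
        (.loop e₅ (e₇ t) (.seq (labels t) (.assign (R + (3 : Fin 5)) e₆)))) q) .skip
  refine ⟨.seq (.assign (R + (0 : Fin 5)) (.load b (.const 0)))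
    (.seq (.assign (R + (1 : Fin 5)) (.load b (.const K.header)))
    (.seq (.assign (R + (2 : Fin 5)) (.const 2))
    (.seq (.assign (R + (3 : Fin 5)) (.const 0))
    (.seq (.assign (R + (4 : Fin 5)) (.const 0))
    (.seq (.loop e₁ e₂ (.assign (R + (2 : Fin 5)) e₃))
    (.seq (.loop e₅ e₄ (.seq (.store B e₅ (.const 0)) (.assign (R + (3 : Fin 5)) e₆)))
    (.seq positions
    (.seq (.query (R + 5) B e₄)
    (.ite (.const 0) (.reg (R + 5)) (.assign ro (.const 1)) (.assign ro (.const 0))))))))))), ?_⟩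
  intro w u x σ n hw hu hro hb hin hβs hβk hval hru hsu hcell htot
  set β : ℕ := n + 2 with hβ
  set L := A.encode x with hL
  set s := A.size x with hs
  set r := Δ * β ^ (g + 1) with hr
  set h0 := L.getD 0 0 with hh0
  set h1 := L.getD K.header 0 with hh1
  -- `E` is the unit of time: it bounds the cost of every expression of the program and leaves room
  -- for the constants and the unit charged per instruction.
  obtain ⟨E, hE⟩ : ∃ E, E = (c + 6) * u ^ 2 := ⟨_, rfl⟩
  have hu2 : u ≤ u ^ 2 := Nat.le_self_pow (by norm_num) u
  have hE0 : c * u ^ 2 + 6 * u ^ 2 = E := by rw [hE]; ring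
  have hcu : c ≤ c * u ^ 2 := Nat.le_mul_of_pos_right _ (by positivity)
  have fits_of : ∀ z : ℤ, |z| < 2 ^ u → Fits w u z := by
    intro z hz
    have h1 : z.natAbs < 2 ^ u := by
      zify
      exact hz
    exact h1.trans_le (Nat.pow_le_pow_right (by norm_num) (Nat.le_mul_of_pos_left _ hw))
  have fits_nat : ∀ z : ℕ, z < 2 ^ u → Fits w u (z : ℤ) := by
    intro z hz
    refine fits_of _ ?_
    rw [abs_of_nonneg (by positivity)]
    exact_mod_cast hz
  have hread : ∀ i < L.length, σ.mem b (i : ℤ) = L.getD i 0 := by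
    intro i hi
    rw [hin i hi, List.getD_eq_getElem _ _ hi]
  have hfitL : ∀ i < L.length, Fits w u (L.getD i 0) := by
    intro i hi
    rw [List.getD_eq_getElem _ _ hi]
    exact fits_of _ (hcell _ (List.getElem_mem hi))
  have hL0 : 0 < L.length := lt_of_le_of_lt (Nat.zero_le _) (K.header_lt x)
  have hfit0 : Fits w u h0 := hfitL _ hL0
  have hfit1 : Fits w u h1 := hfitL _ (K.header_lt x)
  have hβr : β ≤ r := (Nat.le_self_pow (by omega) β).trans (Nat.le_mul_of_pos_left _ hΔ0)
  have hfitβ : ∀ k ≤ β, Fits w u (k : ℤ) := fun k hk => fits_nat k (by omega)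
  have hfitr : ∀ k ≤ r, Fits w u (k : ℤ) := fun k hk => fits_nat k (by omega)
  have hfits : ∀ k ≤ s + 1, Fits w u (k : ℤ) := fun k hk => fits_nat k (by omega)
  have hfit5 : ∀ {y i z : ℤ}, Fits w u y → Fits w u i → Fits w u z →
      ∀ v, Fits w u (![h0, h1, y, i, z] v) := by
    intro y i z hy hi hz v
    fin_cases v <;> assumption
  have up2 : ∀ y i z y' : ℤ, Function.update ![h0, h1, y, i, z] (2 : Fin 5) y' =
      ![h0, h1, y', i, z] := by
    intro y i z y'; funext v; fin_cases v <;> rfl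
  have up3 : ∀ y i z y' : ℤ, Function.update ![h0, h1, y, i, z] (3 : Fin 5) y' =
      ![h0, h1, y, y', z] := by
    intro y i z y'; funext v; fin_cases v <;> rfl
  have up4 : ∀ y i z y' : ℤ, Function.update ![h0, h1, y, i, z] (4 : Fin 5) y' =
      ![h0, h1, y, i, y'] := by
    intro y i z y'; funext v; fin_cases v <;> rfl
  have words0 : words w 0 = 1 := by simp [words]
  have words1 : words w 1 ≤ 2 := (Fits.const hw 1).words_le
  have words2 : words w 2 ≤ 3 := (Fits.const hw 2).words_le
  have wordsh : words w (K.header : ℤ) ≤ 1 + c :=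
    (Fits.const hw (K.header : ℤ)).words_le.trans (by rw [Int.natAbs_natCast]; omega)
  let Q := polyOracle (K.family g D) fun _ => 0
  let W₀ := Workspace R B σ
  -- initialization
  have init : ∀ p T Post, (∀ σ', W₀ ![h0, h1, 2, 0, 0] σ' → Run Q w p σ' T Post) →
      Run Q w (.seq (.assign (R + (0 : Fin 5)) (.load b (.const 0)))
        (.seq (.assign (R + (1 : Fin 5)) (.load b (.const K.header)))
        (.seq (.assign (R + (2 : Fin 5)) (.const 2))
        (.seq (.assign (R + (3 : Fin 5)) (.const 0))
        (.seq (.assign (R + (4 : Fin 5)) (.const 0)) p))))) σ (5 * E + T) Post := by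
    intro p T Post h
    have hw0 : W₀ (fun v => σ.reg (R + v)) σ := ⟨fun _ _ => rfl, fun _ _ => rfl, rfl⟩
    have m0 : σ.mem b 0 = h0 := by exact_mod_cast hread 0 hL0
    have m1 : σ.mem b (K.header : ℤ) = h1 := hread _ (K.header_lt x)
    have w0 := hfit0.words_le
    have w1 := hfit1.words_le
    refine Run.seq (T₁ := E) (Post₁ := (· = σ.setReg (R + (0 : Fin 5)) h0)) (Run.assign ?_ ?_)
      (T₂ := 4 * E + T) ?_ (by omega)
    · simp only [Expr.eval, m0]
    · simp only [Expr.cost, Expr.eval, m0, words0]; omega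
    rintro _ rfl
    refine Run.seq (T₁ := E) (Post₁ := (· = (σ.setReg (R + (0 : Fin 5)) h0).setReg
      (R + (1 : Fin 5)) h1)) (Run.assign ?_ ?_) (T₂ := 3 * E + T) ?_ (by omega)
    · simp only [Expr.eval]
      rw [← m1]
      rfl
    · simp only [Expr.cost, Expr.eval]
      have : (σ.setReg (R + (0 : Fin 5)) h0).mem b K.header = h1 := m1
      rw [this]
      omega
    rintro _ rfl
    refine Run.seq (T₁ := E) (Post₁ := (· = ((σ.setReg (R + (0 : Fin 5)) h0).setReg
      (R + (1 : Fin 5)) h1).setReg (R + (2 : Fin 5)) 2)) (Run.assign rfl ?_)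
      (T₂ := 2 * E + T) ?_ (by omega)
    · simp only [Expr.cost]; omega
    rintro _ rfl
    refine Run.seq (T₁ := E) (Post₁ := (· = (((σ.setReg (R + (0 : Fin 5)) h0).setReg
      (R + (1 : Fin 5)) h1).setReg (R + (2 : Fin 5)) 2).setReg (R + (3 : Fin 5)) 0))
      (Run.assign rfl ?_) (T₂ := E + T) ?_ (by omega)
    · simp only [Expr.cost]; omega
    rintro _ rfl
    refine Run.seq (T₁ := E) (Post₁ := W₀ ![h0, h1, 2, 0, 0]) (Run.assign ?_ ?_) h le_rfl
    · have := ((((hw0.setReg 0 h0).setReg 1 h1).setReg 2 2).setReg 3 0).setReg 4 0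
      convert this using 1
      · funext v
        fin_cases v <;> rfl
      · rfl
    · simp only [Expr.cost]; omega
  refine (init _ ((3 * n + 2) * E + ((5 * r + 2) * E + ((N * ((s + 1) * (K₁ + 3) + 3) + 1) * E +
    (2 * E + r + 3 * E)))) _ fun σ₁ hσ₁ => ?_).mono ?_ fun _ h => h
  swap
  · have hn : n ≤ r := by omega
    have e1 : (c + 6) * (30 + N * (K₁ + 10)) * (r + s + 1) * u ^ 2 =
        E * ((30 + N * (K₁ + 10)) * (r + s + 1)) := by rw [hE]; ring
    rw [e1]
    have hrE : r ≤ E * r := Nat.le_mul_of_pos_left _ (by omega)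
    calc _ = E * (5 + (3 * n + 2) + (5 * r + 2) + (N * ((s + 1) * (K₁ + 3) + 3) + 1) + 5) + r := by
          ring
      _ ≤ E * (5 + (3 * n + 2) + (5 * r + 2) + (N * ((s + 1) * (K₁ + 3) + 3) + 1) + 5) + E * r := by
          omega
      _ = E * (5 + (3 * n + 2) + (5 * r + 2) + (N * ((s + 1) * (K₁ + 3) + 3) + 1) + 5 + r) := by
          ring
      _ ≤ E * ((30 + N * (K₁ + 10)) * (r + s + 1)) := by
          refine Nat.mul_le_mul_left _ ?_
          have e2 : N * ((s + 1) * (K₁ + 3) + 3) ≤ N * (K₁ + 10) * (r + s + 1) := by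
            rw [mul_assoc]
            refine Nat.mul_le_mul_left _ ?_
            calc (s + 1) * (K₁ + 3) + 3 ≤ (s + 1) * (K₁ + 3) + 3 * (s + 1) := by omega
              _ = (K₁ + 6) * (s + 1) := by ring
              _ ≤ (K₁ + 10) * (r + s + 1) := Nat.mul_le_mul (by omega) (by omega)
          calc _ ≤ 30 * (r + s + 1) + N * (K₁ + 10) * (r + s + 1) := by omega
            _ = _ := by ring
  -- the base
  refine Run.seq (T₁ := (3 * n + 2) * E) (Post₁ := W₀ ![h0, h1, β, 0, 0])
    (Run.loop (Tc := 2 * E) (Tb := E) (fun k => W₀ ![h0, h1, (k + 2 : ℕ), 0, 0]) n ?_ ?_ hσ₁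
      (le_of_eq (by ring))) ?_ le_rfl
  · intro k hk σ' hσ'
    have hf := hfit5 (hfitβ (k + 2) (by omega)) (hfitβ 0 (by omega)) (hfitβ 0 (by omega))
    have t1 := hσ'.cost_le h₁ hw hu hf
    have t2 := hσ'.cost_le h₂ hw hu hf
    have t3 := hσ'.cost_le h₃ hw hu hf
    refine ⟨?_, by omega, Run.assign ?_ (by omega)⟩
    · rw [hσ'.eval_eq h₁, hσ'.eval_eq h₂]
      simp only [Matrix.cons_val]
      rw [K.sz_eq]
      have := hβk k hk
      exact_mod_cast Nat.lt_succ_of_le this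
    · have := hσ'.setReg 2 (e₃.eval σ')
      rw [up2] at this
      rw [hσ'.eval_eq h₃] at this ⊢
      simpa [add_right_comm] using this
  · intro σ' hσ'
    have hf := hfit5 (hfitβ β le_rfl) (hfitβ 0 (by omega)) (hfitβ 0 (by omega))
    have t1 := hσ'.cost_le h₁ hw hu hf
    have t2 := hσ'.cost_le h₂ hw hu hf
    refine ⟨?_, by omega⟩
    rw [hσ'.eval_eq h₁, hσ'.eval_eq h₂]
    simp only [Matrix.cons_val]
    rw [K.sz_eq]
    have : ¬ (n + 2) ^ g < s + 1 := not_lt.2 (Nat.succ_le_of_lt hβs)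
    exact_mod_cast this
  -- clearing the array
  intro σ₂ hσ₂
  refine Run.seq (T₁ := (5 * r + 2) * E)
    (Post₁ := fun σ' => W₀ ![h0, h1, β, r, 0] σ' ∧ ∀ a : ℤ, 0 ≤ a → a < r → σ'.mem B a = 0)
    (Run.loop (Tc := 2 * E) (Tb := 2 * E + E)
      (fun k σ' => W₀ ![h0, h1, β, k, 0] σ' ∧ ∀ a : ℤ, 0 ≤ a → a < k → σ'.mem B a = 0) r ?_ ?_
      ⟨hσ₂, fun a h1 h2 => absurd h2 (not_lt.2 h1)⟩
      (le_of_eq (by ring))) ?_ le_rfl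
  · rintro k hk σ' ⟨hσ', hm⟩
    have hf := hfit5 (hfitβ β le_rfl) (hfitr k hk.le) (hfitβ 0 (by omega))
    have t4 := hσ'.cost_le h₄ hw hu hf
    have t5 := hσ'.cost_le h₅ hw hu hf
    refine ⟨?_, by omega, Run.seq (T₁ := 2 * E) (T₂ := E)
      (Post₁ := fun σ' => W₀ ![h0, h1, β, k, 0] σ' ∧
        ∀ a : ℤ, 0 ≤ a → a < (k + 1 : ℕ) → σ'.mem B a = 0)
      (Run.store ⟨hσ'.setMem _ _, ?_⟩ (by simp only [Expr.cost]; omega)) ?_ le_rfl⟩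
    · rw [hσ'.eval_eq h₄, hσ'.eval_eq h₅]
      simp only [Matrix.cons_val]
      exact_mod_cast hk
    · intro a ha0 ha1
      rw [hσ'.eval_eq h₅]
      simp only [Matrix.cons_val, RAMState.setMem, Function.update_self, Expr.eval]
      rcases eq_or_ne a k with rfl | hne
      · simp
      · rw [Function.update_of_ne hne]
        exact hm a ha0 (by push_cast at ha1; omega)
    · rintro σ'' ⟨hσ'', hm'⟩
      have t6 := hσ''.cost_le h₆ hw hu hf
      refine Run.assign ⟨?_, hm'⟩ (by omega)
      have := hσ''.setReg 3 (e₆.eval σ'')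
      rw [up3] at this
      rw [hσ''.eval_eq h₆] at this ⊢
      simpa using this
  · rintro σ' ⟨hσ', hm⟩
    have hf := hfit5 (hfitβ β le_rfl) (hfitr r le_rfl) (hfitβ 0 (by omega))
    have t4 := hσ'.cost_le h₄ hw hu hf
    have t5 := hσ'.cost_le h₅ hw hu hf
    refine ⟨?_, by omega⟩
    rw [hσ'.eval_eq h₄, hσ'.eval_eq h₅]
    simp only [Matrix.cons_val]
    rw [hr]
    push_cast
    exact lt_irrefl _
  -- filling the array
  rintro σ₃ ⟨hσ₃, hm₃⟩
  let Mem (S : Set ℤ) (σ' : RAMState) : Prop :=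
    ∀ a : ℤ, 0 ≤ a → a < r → σ'.mem B a = if a ∈ S then 1 else 0
  let cl' (t f j) (i : ℕ) : ℤ := K.cell g D x β t f j i
  -- Between two positions the loop counter and the last label read are irrelevant; they only have
  -- to stay small enough for the cost bounds.
  let P (S : Set ℤ) (σ' : RAMState) : Prop :=
    ∃ i z : ℤ, Fits w u i ∧ Fits w u z ∧ W₀ ![h0, h1, β, i, z] σ' ∧ Mem S σ'
  have run_digits : ∀ t f, ∀ i < K.num x t, ∀ S σ',
      W₀ ![h0, h1, β, i, L.getD (K.pos x t f i) 0] σ' → Mem S σ' →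
      Run Q w (digits t f) σ' (2 * (D + 1) * E + 1)
        (fun σ'' => W₀ ![h0, h1, β, i, L.getD (K.pos x t f i) 0] σ'' ∧
          Mem (S ∪ ⋃ j ∈ (Finset.univ.toList : List (Fin (D + 1))), {cl' t f j i}) σ'') := by
    intro t f i hi S σ' hσ' hm
    have hnumle := K.num_le x t
    have hf := hfit5 (hfitβ β le_rfl) (hfits i (by omega)) (hfitL _ (K.pos_lt x t f i hi))
    refine (Run.list _ (fun j => {cl' t f j i}) (fun S σ'' =>
      W₀ ![h0, h1, β, i, L.getD (K.pos x t f i) 0] σ'' ∧ Mem S σ'') (2 * E) _ ?_ S σ'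
      ⟨hσ', hm⟩).mono ?_ fun _ h => h
    · rintro j - S σ'' ⟨hσ'', hm''⟩
      have t9 := hσ''.cost_le (h₉ (t, f, j)) hw hu hf
      refine Run.store ⟨hσ''.setMem _ _, ?_⟩ (by simp only [Expr.cost]; omega)
      intro a ha0 ha1
      have hev : (e₉ (t, f, j)).eval σ'' = cl' t f j i := hσ''.eval_eq (h₉ (t, f, j))
      rw [hev]
      simp only [RAMState.setMem, Function.update_self, Expr.eval, Function.update_apply]
      split_ifs with h1 h2 h2
      · rfl
      · exact absurd (Or.inr h1) h2
      · rw [hm'' a ha0 ha1, if_pos (h2.resolve_right h1)]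
      · rw [hm'' a ha0 ha1, if_neg fun h => h2 (Or.inl h)]
    · simp only [Finset.length_toList, Finset.card_univ, Fintype.card_fin]
      exact le_of_eq (by ring)
  have run_labels : ∀ t, ∀ i < K.num x t, ∀ S σ',
      (∃ z, Fits w u z ∧ W₀ ![h0, h1, β, i, z] σ' ∧ Mem S σ') →
      Run Q w (labels t) σ' (K₁ * E)
        (fun σ'' => ∃ z, Fits w u z ∧ W₀ ![h0, h1, β, i, z] σ'' ∧
          Mem (S ∪ ⋃ f ∈ (Finset.univ.toList : List (Fin (K.F + 1))),
            ⋃ j ∈ (Finset.univ.toList : List (Fin (D + 1))), {cl' t f j i}) σ'') := by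
    intro t i hi S σ' hσ'
    have hnumle := K.num_le x t
    refine (Run.list _
      (fun f => ⋃ j ∈ (Finset.univ.toList : List (Fin (D + 1))), {cl' t f j i}) (fun S σ'' =>
      ∃ z, Fits w u z ∧ W₀ ![h0, h1, β, i, z] σ'' ∧ Mem S σ'') (E + (2 * (D + 1) * E + 1)) _ ?_
      S σ' hσ').mono ?_ fun _ h => h
    · rintro f - S σ'' ⟨z, hz, hσ'', hm''⟩
      have hf := hfit5 (hfitβ β le_rfl) (hfits i (by omega)) hz
      have t8 := hσ''.cost_le (h₈ (t, f)) hw hu hf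
      have hev : (e₈ (t, f)).eval σ'' = (K.pos x t f i : ℕ) := by
        rw [hσ''.eval_eq (h₈ (t, f))]
        exact K.addr_eq x t f i hi
      have hld : σ''.mem b ((K.pos x t f i : ℕ) : ℤ) = L.getD (K.pos x t f i) 0 := by
        rw [hσ''.2.1 b hb]
        exact hread _ (K.pos_lt x t f i hi)
      have hfl := hfitL _ (K.pos_lt x t f i hi)
      refine Run.seq (T₁ := E) (Post₁ := fun σ''' =>
        W₀ ![h0, h1, β, i, L.getD (K.pos x t f i) 0] σ''' ∧ Mem S σ''') (Run.assign ⟨?_, hm''⟩ ?_)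
        (fun σ''' h => (run_digits t f i hi S σ''' h.1 h.2).mono le_rfl
          fun σ4 h => ⟨_, hfl, h.1, h.2⟩) le_rfl
      · have := hσ''.setReg 4 ((Expr.load b (e₈ (t, f))).eval σ'')
        rw [up4] at this
        simp only [Expr.eval, hev, hld] at this ⊢
        exact this
      · have := hfl.words_le
        simp only [Expr.cost, hev, hld]
        omega
    · simp only [Finset.length_toList, Finset.card_univ, Fintype.card_fin]
      have h1 : E + (2 * (D + 1) * E + 1) ≤ (2 + 2 * (D + 1)) * E := by
        rw [add_mul]; omega
      calc _ ≤ (K.F + 1) * ((2 + 2 * (D + 1)) * E) + 1 * E := by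
            have := Nat.mul_le_mul_left (K.F + 1) h1
            omega
        _ = K₁ * E := by rw [hK₁]; ring
  have run_positions : Run Q w positions σ₃ ((N * ((s + 1) * (K₁ + 3) + 3) + 1) * E)
      (P (∅ ∪ ⋃ t ∈ (Finset.univ.toList : List K.ι), ⋃ i, ⋃ (_ : i < K.num x t),
        ⋃ f ∈ (Finset.univ.toList : List (Fin (K.F + 1))),
          ⋃ j ∈ (Finset.univ.toList : List (Fin (D + 1))), {cl' t f j i})) := by
    refine (Run.list _ (fun t => ⋃ i, ⋃ (_ : i < K.num x t),
        ⋃ f ∈ (Finset.univ.toList : List (Fin (K.F + 1))),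
          ⋃ j ∈ (Finset.univ.toList : List (Fin (D + 1))), {cl' t f j i}) P
      (E + ((s + 1) * (2 * E + (K₁ * E + E)) + 2 * E)) _ ?_ ∅ σ₃
      ⟨r, 0, hfitr r le_rfl, hfitr 0 (Nat.zero_le _), hσ₃, ?_⟩).mono ?_ fun _ h => h
    · rintro t - S σ' ⟨i₀, z₀, hi₀, hz₀, hσ', hm'⟩
      have hnumle := K.num_le x t
      refine Run.seq (T₁ := E) (Post₁ := fun σ'' => ∃ z, Fits w u z ∧
        W₀ ![h0, h1, β, (0 : ℕ), z] σ'' ∧ Mem S σ'') (Run.assign ⟨z₀, hz₀, ?_, hm'⟩ ?_)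
        (T₂ := (s + 1) * (2 * E + (K₁ * E + E)) + 2 * E) (fun σ'' hσ'' => ?_) le_rfl
      · have := hσ'.setReg 3 0
        rw [up3] at this
        exact this
      · simp only [Expr.cost, words0]; omega
      refine (Run.loop (Tc := 2 * E) (Tb := K₁ * E + E) (fun k σ3 => ∃ z, Fits w u z ∧
        W₀ ![h0, h1, β, k, z] σ3 ∧ Mem (S ∪ ⋃ i, ⋃ (_ : i < k),
          ⋃ f ∈ (Finset.univ.toList : List (Fin (K.F + 1))),
          ⋃ j ∈ (Finset.univ.toList : List (Fin (D + 1))), {cl' t f j i}) σ3) (K.num x t)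
          ?_ ?_ ?_ ?_).mono le_rfl ?_
      · rintro k hk σ3 ⟨z, hz, hσ3, hm3⟩
        have hf := hfit5 (hfitβ β le_rfl) (hfits k (by omega)) hz
        have t5 := hσ3.cost_le h₅ hw hu hf
        have t7 := hσ3.cost_le (h₇ t) hw hu hf
        refine ⟨?_, by omega, Run.seq (run_labels t k hk _ σ3 ⟨z, hz, hσ3, hm3⟩) (T₂ := E) ?_
          le_rfl⟩
        · rw [hσ3.eval_eq h₅, hσ3.eval_eq (h₇ t)]
          simp only [Matrix.cons_val]
          rw [K.cnt_eq]
          exact_mod_cast hk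
        · rintro σ4 ⟨z', hz', hσ4, hm4⟩
          have hf' := hfit5 (hfitβ β le_rfl) (hfits k (by omega)) hz'
          have t6 := hσ4.cost_le h₆ hw hu hf'
          refine Run.assign ⟨z', hz', ?_, ?_⟩ (by omega)
          · have := hσ4.setReg 3 (e₆.eval σ4)
            rw [up3] at this
            rw [hσ4.eval_eq h₆] at this ⊢
            simpa using this
          · have hset : ∀ (X : ℕ → Set ℤ), ⋃ i, ⋃ (_ : i < k + 1), X i =
                (⋃ i, ⋃ (_ : i < k), X i) ∪ X k := fun X => Set.biUnion_lt_succ X k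
            rw [hset, ← Set.union_assoc]
            exact hm4
      · rintro σ3 ⟨z, hz, hσ3, hm3⟩
        have hf := hfit5 (hfitβ β le_rfl) (hfits _ hnumle) hz
        have t5 := hσ3.cost_le h₅ hw hu hf
        have t7 := hσ3.cost_le (h₇ t) hw hu hf
        refine ⟨?_, by omega⟩
        rw [hσ3.eval_eq h₅, hσ3.eval_eq (h₇ t)]
        simp only [Matrix.cons_val]
        rw [K.cnt_eq]
        exact lt_irrefl _
      · simpa using hσ''
      · have := Nat.mul_le_mul_right (2 * E + (K₁ * E + E)) hnumle
        exact Nat.add_le_add_right this _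
      · rintro σ3 ⟨z, hz, hσ3, hm3⟩
        exact ⟨_, z, hfits _ hnumle, hz, hσ3, hm3⟩
    · intro a ha0 ha1
      rw [hm₃ a ha0 ha1, if_neg (Set.notMem_empty a)]
    · simp only [Finset.length_toList, Finset.card_univ, ← hN]
      calc _ ≤ N * (E + ((s + 1) * (2 * E + (K₁ * E + E)) + 2 * E)) + E := by omega
        _ = _ := by ring
  refine Run.seq run_positions ?_ le_rfl
  -- the call of the oracle
  rintro σ₄ ⟨i, z, hi, hz, hσ₄, hm₄⟩
  generalize hS' : (∅ ∪ ⋃ t ∈ (Finset.univ.toList : List K.ι), ⋃ i, ⋃ (_ : i < K.num x t),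
        ⋃ f ∈ (Finset.univ.toList : List (Fin (K.F + 1))),
          ⋃ j ∈ (Finset.univ.toList : List (Fin (D + 1))), {cl' t f j i} : Set ℤ) = S at hm₄
  have hS : ∀ a, a ∈ S ↔ ∃ t f j, ∃ i < K.num x t, a = K.cell g D x β t f j i := by
    intro a
    rw [← hS']
    simp only [Finset.mem_toList, Finset.mem_univ, Set.iUnion_true, Set.empty_union,
      Set.mem_iUnion, Set.mem_singleton_iff, exists_prop]
    constructor
    · rintro ⟨t, i, hi, f, j, h⟩; exact ⟨t, f, j, i, hi, h⟩
    · rintro ⟨t, f, j, i, hi, h⟩; exact ⟨t, i, hi, f, j, h⟩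
  have hf := hfit5 (hfitβ β le_rfl) hi hz
  have t4 := hσ₄.cost_le h₄ hw hu hf
  have hlen : (e₄.eval σ₄).toNat = r := by
    rw [hσ₄.eval_eq h₄]
    simp only [Matrix.cons_val]
    rw [hr]
    exact_mod_cast Int.toNat_natCast (Δ * β ^ (g + 1))
  have hseg : (σ₄.segment B r).length = r := σ₄.length_segment B r
  have hentry : ∀ a (h : a < (σ₄.segment B r).length), (σ₄.segment B r)[a] =
      if (a : ℤ) ∈ S then 1 else 0 := by
    intro a h
    rw [σ₄.getElem_segment]
    exact hm₄ a (by positivity) (by rw [hseg] at h; exact_mod_cast h)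
  -- There can be `s + 1` elements at a position, and `s < β ^ g` leaves room for exactly that many.
  have hnum : ∀ t, K.num x t ≤ β ^ g := fun t => (K.num_le x t).trans hβs
  have hans : (polyOracle (K.family g D) fun _ => 0).answer (σ₄.segment B r) (K.total x) := by
    refine ⟨fun a ha => ?_, ?_⟩
    · obtain ⟨k, hk, rfl⟩ := List.getElem_of_mem ha
      rw [hentry k hk]
      split_ifs <;> simp
    · exact (K.eval_family g D x β (by omega) hnum hval _ hseg S hS hentry).symm
  have hcost : (polyOracle (K.family g D) fun _ => 0).cost (σ₄.segment B r) = r := hseg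
  refine Run.seq (T₁ := 2 * E + r) (T₂ := 3 * E) (Post₁ := (· = σ₄.setReg (R + 5) (K.total x)))
    ⟨_, _, _, Exec.query σ₄ (R + 5) B e₄ _ _ rfl (by rw [hlen]; exact hans), ?_, rfl⟩ ?_ le_rfl
  · rw [hlen, hcost]; omega
  rintro _ rfl
  set σ₅ := σ₄.setReg (R + 5) (K.total x) with hσ₅
  have hreg : σ₅.reg (R + 5) = K.total x := Function.update_self _ _ _
  have hwords := (fits_of _ htot).words_le
  have hfin : ∀ y, (∀ r < R, r ≠ ro → (σ₅.setReg ro y).reg r = σ.reg r) ∧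
      (∀ b' < B, (σ₅.setReg ro y).mem b' = σ.mem b') ∧ (σ₅.setReg ro y).reg ro = y := by
    intro y
    refine ⟨fun r hr hne => ?_, fun b' hb' => hσ₄.2.1 b' hb', Function.update_self _ _ _⟩
    have e1 : (σ₅.setReg ro y).reg r = σ₅.reg r := Function.update_of_ne hne _ _
    have e2 : σ₅.reg r = σ₄.reg r := Function.update_of_ne (by omega) _ _
    rw [e1, e2]
    exact hσ₄.1 r hr
  by_cases hyes : A.Yes x
  · have hpos : 0 < K.total x := (K.yes_iff x).1 hyes
    refine ⟨_, _, _, Exec.ite_true σ₅ _ _ _ _ _ _ _ (by simpa [Expr.eval, hreg] using hpos)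
      (Exec.assign _ _ _), ?_, ?_⟩
    · simp only [Expr.cost, hreg, words0]; omega
    · simp only [Expr.eval, truthValue, if_pos hyes]
      exact hfin 1
  · have hpos : ¬ 0 < K.total x := fun h => hyes ((K.yes_iff x).2 h)
    refine ⟨_, _, _, Exec.ite_false σ₅ _ _ _ _ _ _ _ (by simpa [Expr.eval, hreg] using hpos)
      (Exec.assign _ _ _), ?_, ?_⟩
    · simp only [Expr.cost, hreg, words0]; omega
    · simp only [Expr.eval, truthValue, if_neg hyes]
      exact hfin 0

end Counting

end FineGrained

namespace FineGrained

/-! ### Replacing the calls of an oracle by a subprogram -/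

/-- All registers and banks occurring in the expression are below `R` and `B`. -/
def Expr.Below (R B : ℕ) : Expr → Prop
  | .const _ => True
  | .reg r => r < R
  | .load b e => b < B ∧ e.Below R B
  | .bin _ e₁ e₂ => e₁.Below R B ∧ e₂.Below R B

/-- All registers and banks occurring in the program are below `R` and `B`. -/
def Program.Below (R B : ℕ) : Program → Prop
  | .skip => True
  | .assign r e => r < R ∧ e.Below R B
  | .store b a e => b < B ∧ a.Below R B ∧ e.Below R B
  | .query r b e => r < R ∧ b < B ∧ e.Below R B
  | .seq p q => p.Below R B ∧ q.Below R B
  | .ite e₁ e₂ p q => e₁.Below R B ∧ e₂.Below R B ∧ p.Below R B ∧ q.Below R B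
  | .loop e₁ e₂ p => e₁.Below R B ∧ e₂.Below R B ∧ p.Below R B

theorem Expr.Below.mono {R B R' B' : ℕ} (hR : R ≤ R') (hB : B ≤ B') :
    ∀ {e : Expr}, e.Below R B → e.Below R' B'
  | .const _, _ => trivial
  | .reg _, h => lt_of_lt_of_le h hR
  | .load _ _, h => ⟨h.1.trans_le hB, h.2.mono hR hB⟩
  | .bin _ _ _, h => ⟨h.1.mono hR hB, h.2.mono hR hB⟩

theorem Program.Below.mono {R B R' B' : ℕ} (hR : R ≤ R') (hB : B ≤ B') :
    ∀ {p : Program}, p.Below R B → p.Below R' B'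
  | .skip, _ => trivial
  | .assign _ _, h => ⟨h.1.trans_le hR, h.2.mono hR hB⟩
  | .store _ _ _, h => ⟨h.1.trans_le hB, h.2.1.mono hR hB, h.2.2.mono hR hB⟩
  | .query _ _ _, h => ⟨h.1.trans_le hR, h.2.1.trans_le hB, h.2.2.mono hR hB⟩
  | .seq _ _, h => ⟨h.1.mono hR hB, h.2.mono hR hB⟩
  | .ite _ _ _ _, h =>
    ⟨h.1.mono hR hB, h.2.1.mono hR hB, h.2.2.1.mono hR hB, h.2.2.2.mono hR hB⟩
  | .loop _ _ _, h => ⟨h.1.mono hR hB, h.2.1.mono hR hB, h.2.2.mono hR hB⟩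

theorem Expr.exists_below (e : Expr) : ∃ N, e.Below N N := by
  induction e with
  | const c => exact ⟨0, trivial⟩
  | reg r => exact ⟨r + 1, Nat.lt_succ_self r⟩
  | load b e ih =>
    obtain ⟨N, h⟩ := ih
    exact ⟨N + b + 1, by omega, h.mono (by omega) (by omega)⟩
  | bin o e₁ e₂ h₁ h₂ =>
    obtain ⟨N₁, h₁⟩ := h₁
    obtain ⟨N₂, h₂⟩ := h₂
    exact ⟨N₁ + N₂, h₁.mono (by omega) (by omega), h₂.mono (by omega) (by omega)⟩

theorem Program.exists_below (p : Program) : ∃ N, p.Below N N := by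
  induction p with
  | skip => exact ⟨0, trivial⟩
  | assign r e =>
    obtain ⟨N, h⟩ := e.exists_below
    exact ⟨N + r + 1, by omega, h.mono (by omega) (by omega)⟩
  | store b a e =>
    obtain ⟨N₁, h₁⟩ := a.exists_below
    obtain ⟨N₂, h₂⟩ := e.exists_below
    exact ⟨N₁ + N₂ + b + 1, by omega, h₁.mono (by omega) (by omega),
      h₂.mono (by omega) (by omega)⟩
  | query r b e =>
    obtain ⟨N, h⟩ := e.exists_below
    exact ⟨N + r + b + 1, by omega, by omega, h.mono (by omega) (by omega)⟩
  | seq p q h₁ h₂ =>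
    obtain ⟨N₁, h₁⟩ := h₁
    obtain ⟨N₂, h₂⟩ := h₂
    exact ⟨N₁ + N₂, h₁.mono (by omega) (by omega), h₂.mono (by omega) (by omega)⟩
  | ite e₁ e₂ p q h₁ h₂ =>
    obtain ⟨N₁, h₁⟩ := h₁
    obtain ⟨N₂, h₂⟩ := h₂
    obtain ⟨N₃, h₃⟩ := e₁.exists_below
    obtain ⟨N₄, h₄⟩ := e₂.exists_below
    exact ⟨N₁ + N₂ + N₃ + N₄, h₃.mono (by omega) (by omega), h₄.mono (by omega) (by omega),
      h₁.mono (by omega) (by omega), h₂.mono (by omega) (by omega)⟩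
  | loop e₁ e₂ p h₁ =>
    obtain ⟨N₁, h₁⟩ := h₁
    obtain ⟨N₃, h₃⟩ := e₁.exists_below
    obtain ⟨N₄, h₄⟩ := e₂.exists_below
    exact ⟨N₁ + N₃ + N₄, h₃.mono (by omega) (by omega), h₄.mono (by omega) (by omega),
      h₁.mono (by omega) (by omega)⟩

/-- Agreement of configurations on the registers below `R` and the banks below `B`. -/
def RAMState.Agree (R B : ℕ) (σ τ : RAMState) : Prop :=
  (∀ r < R, σ.reg r = τ.reg r) ∧ ∀ b < B, σ.mem b = τ.mem b

namespace RAMState.Agree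

variable {R B : ℕ} {σ τ : RAMState}

theorem setReg (h : Agree R B σ τ) (r : ℕ) (v : ℤ) : Agree R B (σ.setReg r v) (τ.setReg r v) := by
  refine ⟨fun r' hr' => ?_, h.2⟩
  simp only [RAMState.setReg, Function.update_apply, h.1 r' hr']

theorem setMem (h : Agree R B σ τ) {b : ℕ} (hb : b < B) (a v : ℤ) :
    Agree R B (σ.setMem b a v) (τ.setMem b a v) := by
  refine ⟨h.1, fun b' hb' => ?_⟩
  simp only [RAMState.setMem, Function.update_apply, h.2 b' hb', h.2 b hb]

theorem eval_eq (h : Agree R B σ τ) : ∀ {e : Expr}, e.Below R B → e.eval τ = e.eval σ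
  | .const _, _ => rfl
  | .reg r, he => (h.1 r he).symm
  | .load b e, he => by simp only [Expr.eval, h.eval_eq he.2, h.2 b he.1]
  | .bin o e₁ e₂, he => by simp only [Expr.eval, h.eval_eq he.1, h.eval_eq he.2]

theorem cost_eq (h : Agree R B σ τ) (w : ℕ) :
    ∀ {e : Expr}, e.Below R B → e.cost w τ = e.cost w σ
  | .const _, _ => rfl
  | .reg r, he => by simp only [Expr.cost, h.1 r he]
  | .load b e, he => by simp only [Expr.cost, h.eval_eq he.2, h.cost_eq w he.2, h.2 b he.1]
  | .bin o e₁ e₂, he => by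
    simp only [Expr.cost, h.eval_eq he.1, h.eval_eq he.2, h.cost_eq w he.1, h.cost_eq w he.2]

end RAMState.Agree

/-- Replacement of the calls of the oracle by subprograms. -/
def Program.replaceQueries (S : ℕ → ℕ → Program) : Program → Program
  | .skip => .skip
  | .assign r e => .assign r e
  | .store b a e => .store b a e
  | .query r b _ => S r b
  | .seq p q => .seq (p.replaceQueries S) (q.replaceQueries S)
  | .ite e₁ e₂ p q => .ite e₁ e₂ (p.replaceQueries S) (q.replaceQueries S)
  | .loop e₁ e₂ p => .loop e₁ e₂ (p.replaceQueries S)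

/-- Each query instruction takes at least one unit of time. This bounds the number of calls, and so
pays for the additive constant in the cost of answering each of them. -/
theorem Exec.length_le {O : Oracle} {w : ℕ} {p : Program} {σ σ' : RAMState} {T : ℕ}
    {qs : List (List ℤ)} (h : Exec O w p σ σ' T qs) : qs.length ≤ T := by
  induction h <;>
    first
    | omega
    | (simp only [List.length_append, List.length_nil, List.length_singleton]; omega)

/-- `S r b` answers the question in bank `b` about the problem `A`, writing the answer into
register `r` and preserving the other registers below `R` and the banks below `B`. -/
def Answers (A : Problem) (O : Oracle) (w R B : ℕ) (cost : A.Instance → ℕ)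
    (S : ℕ → ℕ → Program) : Prop :=
  ∀ r < R, ∀ b < B, ∀ (y : A.Instance) (σ : RAMState),
    (∀ i (h : i < (A.encode y).length), σ.mem b (i : ℤ) = (A.encode y)[i]) →
    Run O w (S r b) σ (cost y) fun σ' => (∀ r' < R, r' ≠ r → σ'.reg r' = σ.reg r') ∧
      (∀ b' < B, σ'.mem b' = σ.mem b') ∧ σ'.reg r = truthValue (A.Yes y)

/-- Induction over the execution: the subprograms use only registers and banks outside the range of
`p`, apart from the answer register, so the simulated configuration keeps agreeing with the original
one on that range. -/
theorem Exec.replaceQueries {A : Problem} {O : Oracle} {w R B : ℕ} {cost : A.Instance → ℕ}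
    {S : ℕ → ℕ → Program} (hS : Answers A O w R B cost S) {p : Program} {σ σ' : RAMState}
    {T : ℕ} {qs : List (List ℤ)} (h : Exec A.oracle w p σ σ' T qs) (hp : p.Below R B)
    (τ : RAMState) (hτ : RAMState.Agree R B σ τ) (ys : List A.Instance)
    (hys : qs = ys.map A.encode) :
    Run O w (p.replaceQueries S) τ (T + (ys.map cost).sum) (RAMState.Agree R B σ') := by
  induction h generalizing τ ys with
  | skip σ => exact Run.skip hτ (by omega)
  | assign σ r e =>
    refine Run.assign ?_ ?_
    · rw [hτ.eval_eq hp.2]; exact hτ.setReg _ _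
    · rw [hτ.cost_eq w hp.2]; omega
  | store σ b a e =>
    refine Run.store ?_ ?_
    · rw [hτ.eval_eq hp.2.1, hτ.eval_eq hp.2.2]; exact hτ.setMem hp.1 _ _
    · rw [hτ.cost_eq w hp.2.1, hτ.cost_eq w hp.2.2]; omega
  | query σ r b len L v hL hv =>
    obtain ⟨y, rfl, rfl⟩ := hv
    obtain ⟨hr, hb, -⟩ := hp
    -- The instance behind a question is determined by its encoding.
    have hy : ys = [y] := by
      have : List.map A.encode ys = List.map A.encode [y] := hys.symm
      exact List.map_injective_iff.2 A.encode_injective this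
    subst hy
    refine (hS r hr b hb y τ ?_).mono (by simp) ?_
    · intro i hi
      rw [← hτ.2 b hb, ← σ.getElem_segment b _ i (by rwa [← hL])]
      congr 1
      exact hL.symm
    · rintro τ' ⟨h1, h2, h3⟩
      refine ⟨fun r' hr' => ?_, fun b' hb' => (hτ.2 b' hb').trans (h2 b' hb').symm⟩
      simp only [RAMState.setReg, Function.update_apply]
      split_ifs with hrr
      · rw [hrr, h3]
      · rw [h1 r' hr' hrr, hτ.1 r' hr']
  | seq σ σ₁ σ₂ p q T₁ T₂ qs₁ qs₂ _ _ ih₁ ih₂ =>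
    obtain ⟨ys₁, ys₂, rfl, h1, h2⟩ := List.map_eq_append_iff.1 hys.symm
    refine Run.seq (ih₁ hp.1 τ hτ ys₁ h1.symm)
      (fun τ' hτ' => ih₂ hp.2 τ' hτ' ys₂ h2.symm) ?_
    simp only [List.map_append, List.sum_append]
    omega
  | ite_true σ σ' e₁ e₂ p q T qs hc _ ih =>
    obtain ⟨he₁, he₂, hp, -⟩ := hp
    obtain ⟨τ', T', qs', h1, h2, h3⟩ := ih hp τ hτ ys hys
    refine ⟨τ', _, _, .ite_true _ _ _ _ _ _ _ _ ?_ h1, ?_, h3⟩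
    · rwa [hτ.eval_eq he₁, hτ.eval_eq he₂]
    · rw [hτ.cost_eq w he₁, hτ.cost_eq w he₂]; omega
  | ite_false σ σ' e₁ e₂ p q T qs hc _ ih =>
    obtain ⟨he₁, he₂, -, hp⟩ := hp
    obtain ⟨τ', T', qs', h1, h2, h3⟩ := ih hp τ hτ ys hys
    refine ⟨τ', _, _, .ite_false _ _ _ _ _ _ _ _ ?_ h1, ?_, h3⟩
    · rwa [hτ.eval_eq he₁, hτ.eval_eq he₂]
    · rw [hτ.cost_eq w he₁, hτ.cost_eq w he₂]; omega
  | loop_true σ σ₁ σ₂ e₁ e₂ p T₁ T₂ qs₁ qs₂ hc _ _ ih₁ ih₂ =>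
    obtain ⟨ys₁, ys₂, rfl, h1, h2⟩ := List.map_eq_append_iff.1 hys.symm
    obtain ⟨τ', T', qs', h3, h4, h5⟩ := ih₁ hp.2.2 τ hτ ys₁ h1.symm
    obtain ⟨τ'', T'', qs'', h6, h7, h8⟩ := ih₂ hp τ' h5 ys₂ h2.symm
    refine ⟨τ'', _, _, .loop_true _ _ _ _ _ _ _ _ _ _ ?_ h3 h6, ?_, h8⟩
    · rwa [hτ.eval_eq hp.1, hτ.eval_eq hp.2.1]
    · rw [hτ.cost_eq w hp.1, hτ.cost_eq w hp.2.1]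
      simp only [List.map_append, List.sum_append]
      omega
  | loop_false σ e₁ e₂ p hc =>
    refine ⟨τ, _, _, .loop_false _ _ _ _ ?_, ?_, hτ⟩
    · rwa [hτ.eval_eq hp.1, hτ.eval_eq hp.2.1]
    · rw [hτ.cost_eq w hp.1, hτ.cost_eq w hp.2.1]; omega

/-! ### Running times -/

/-- Absorbs the factor `u ^ 2`, the price of arithmetic on numbers of `O(log s)` bits, into a small
power of `s`. -/
theorem exists_log_sq_le {η : ℝ} (hη : 0 < η) :
    ∃ C : ℝ, 0 ≤ C ∧ ∀ m : ℕ, 1 ≤ m → ((Nat.log 2 m + 1 : ℕ) : ℝ) ^ 2 ≤ C * (m : ℝ) ^ η := by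
  have hη2 : 0 < η / 2 := by positivity
  have hl2 : 0 < Real.log 2 := Real.log_pos (by norm_num)
  refine ⟨(1 / (η / 2) / Real.log 2 + 1) ^ 2, by positivity, fun m hm => ?_⟩
  have hm0 : (1 : ℝ) ≤ m := by exact_mod_cast hm
  have h1 : (Nat.log 2 m : ℝ) ≤ Real.log m / Real.log 2 := by
    rw [le_div_iff₀ hl2, ← Real.log_pow]
    refine Real.log_le_log (by positivity) ?_
    exact_mod_cast Nat.pow_log_le_self 2 (by omega)
  have h2 : Real.log m ≤ (m : ℝ) ^ (η / 2) / (η / 2) :=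
    Real.log_le_rpow_div (by positivity) hη2
  have h3 : (1 : ℝ) ≤ (m : ℝ) ^ (η / 2) := Real.one_le_rpow hm0 hη2.le
  have h4 : ((Nat.log 2 m + 1 : ℕ) : ℝ) ≤ (1 / (η / 2) / Real.log 2 + 1) * (m : ℝ) ^ (η / 2) := by
    push_cast
    calc (Nat.log 2 m : ℝ) + 1 ≤ (m : ℝ) ^ (η / 2) / (η / 2) / Real.log 2 + (m : ℝ) ^ (η / 2) := by
          gcongr
          exact h1.trans (by gcongr)
      _ = _ := by ring
  calc _ ≤ ((1 / (η / 2) / Real.log 2 + 1) * (m : ℝ) ^ (η / 2)) ^ 2 := by gcongr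
    _ = (1 / (η / 2) / Real.log 2 + 1) ^ 2 * ((m : ℝ) ^ (η / 2)) ^ 2 := by ring
    _ = _ := by
      rw [← Real.rpow_natCast ((m : ℝ) ^ (η / 2)) 2, ← Real.rpow_mul (by positivity)]
      norm_num

/-- Bounds arise in terms of `s + 1` and are wanted in terms of `s`; the summand `1` covers `s = 0`.
-/
theorem succ_rpow_le {a : ℝ} (ha : 0 ≤ a) (s : ℕ) :
    ((s : ℝ) + 1) ^ a ≤ 2 ^ a * ((s : ℝ) ^ a + 1) := by
  rcases Nat.eq_zero_or_pos s with rfl | hs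
  · have : (1 : ℝ) ≤ 2 ^ a := Real.one_le_rpow (by norm_num) ha
    have h0 : (0 : ℝ) ≤ (0 : ℝ) ^ a := Real.rpow_nonneg le_rfl a
    simp only [Nat.cast_zero, zero_add, Real.one_rpow]
    nlinarith
  · have h1 : (1 : ℝ) ≤ s := by exact_mod_cast hs
    calc ((s : ℝ) + 1) ^ a ≤ (2 * s) ^ a :=
          Real.rpow_le_rpow (by positivity) (by linarith) ha
      _ = 2 ^ a * (s : ℝ) ^ a := Real.mul_rpow (by norm_num) (by positivity)
      _ ≤ _ := by gcongr; linarith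

namespace Counting

theorem abs_total_le {A : Problem} (K : Counting A) (x : A.Instance) :
    |K.total x| ≤ K.boundG * ((A.size x : ℤ) + 1) ^ Fintype.card K.ι := by
  unfold total
  refine (Finset.abs_sum_le_sum_abs _ _).trans
    ((Finset.sum_le_sum fun i _ => K.abs_G_le _ _).trans ?_)
  rw [Finset.sum_const, Fintype.card_piFinset, nsmul_eq_mul, mul_comm]
  gcongr
  simp only [Finset.card_range]
  push_cast
  calc ∏ t, (K.num x t : ℤ) ≤ ∏ _t : K.ι, ((A.size x : ℤ) + 1) :=
        Finset.prod_le_prod (fun _ _ => by positivity) fun t _ => by exact_mod_cast K.num_le x t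
    _ = _ := by simp

/-- The table has `O(s * β)` cells with `β` of order `s ^ (1 / g)`. For `g > 2 / γ` this is `O(s ^
(1 + γ / 2))`, and the other half of `γ` pays for the logarithms. The family and `C` are fixed
before `R`, `B` and the word length. -/
theorem exists_fast_solver {A : Problem} (K : Counting A) {γ : ℝ} (hγ : 0 < γ) :
    ∃ Q : PolyFamily, Explicit Q ∧ ∃ C : ℝ, 0 ≤ C ∧ ∀ R B : ℕ, ∃ S : ℕ → ℕ → Program,
      ∀ w, 0 < w → Answers A (polyOracle Q fun _ => 0) w R B
        (fun y => ⌊C * ((A.size y : ℝ) ^ (1 + γ) + 1)⌋₊) S := by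
  obtain ⟨g, hg⟩ := exists_nat_gt (2 / γ)
  have hg0 : (0 : ℝ) < g := lt_trans (by positivity) hg
  have hg1 : g ≠ 0 := by rintro rfl; simp at hg0
  have hgγ : 1 / (g : ℝ) ≤ γ / 2 := by
    rw [div_lt_iff₀ hγ] at hg
    rw [div_le_iff₀ hg0]
    linarith
  -- With `b = K.bound`, labels are at most `b * (s + 1) ^ b`, which is less than `2 ^ b * (β ^ g) ^
  -- b ≤ β ^ (b + g * b)`.
  set D := K.bound + g * K.bound with hD
  obtain ⟨c, hc⟩ := K.exists_solver g D
  set Δ := K.numBlocks D with hΔ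
  obtain ⟨C₁, hC₁, hlog⟩ := exists_log_sq_le (η := γ / 2) (by positivity)
  -- `P` and `e` dominate the factors and exponents of all polynomial bounds that occur, so that
  -- every number is less than `2 ^ (P + e * ℓ)`, where `s + 1 < 2 ^ ℓ`.
  set P := Δ * 2 ^ (g + 1) + K.bound + K.boundG + 3 with hP
  set e := 2 + K.bound + Fintype.card K.ι with he
  choose S hS using hc
  refine ⟨K.family g D, K.explicit_family g D,
    c * (Δ * 2 ^ (g + 1) + 1) * ((P + e) ^ 2 * C₁) * 2 ^ (1 + γ), by positivity,
    fun R B => ⟨fun r b => S r b R B, fun w hw r hr b hb x σ hσ => ?_⟩⟩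
  set s := A.size x with hs
  have hex : ∃ n, s < (n + 2) ^ g :=
    ⟨s, lt_of_lt_of_le (by omega) (Nat.le_self_pow hg1 (s + 2))⟩
  classical
  -- Minimality of `n` gives `(n + 1) ^ g ≤ s + 1`, so the base `n + 2 ≤ 2 * (n + 1)` is of order `s
  -- ^ (1 / g)`.
  obtain ⟨n, hn, hmin⟩ : ∃ n, s < (n + 2) ^ g ∧ ∀ k < n, (k + 2) ^ g ≤ s :=
    ⟨Nat.find hex, Nat.find_spec hex, fun k hk => not_lt.1 (Nat.find_min hex hk)⟩
  have hng : (n + 1) ^ g ≤ s + 1 := by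
    cases n with
    | zero => simp
    | succ m => exact (hmin m (Nat.lt_succ_self m)).trans (Nat.le_succ s)
  have hns : n + 1 ≤ s + 1 := (Nat.le_self_pow hg1 _).trans hng
  have hβ : (n + 2) ^ (g + 1) ≤ 2 ^ (g + 1) * ((s + 1) * (n + 1)) := by
    calc (n + 2) ^ (g + 1) ≤ (2 * (n + 1)) ^ (g + 1) := Nat.pow_le_pow_left (by omega) _
      _ = 2 ^ (g + 1) * ((n + 1) ^ g * (n + 1)) := by rw [mul_pow, pow_succ (n + 1)]
      _ ≤ _ := by gcongr
  set ℓ := Nat.log 2 (s + 1) + 1 with hℓ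
  set u := P + e * ℓ with hu
  have hsℓ : s + 1 < 2 ^ ℓ := Nat.lt_pow_succ_log_self (by norm_num) _
  have hpoly : ∀ q k, q ≤ P → k ≤ e → q * (s + 1) ^ k < 2 ^ u := by
    intro q k hq hk
    calc q * (s + 1) ^ k ≤ P * (s + 1) ^ e :=
          Nat.mul_le_mul hq (Nat.pow_le_pow_right (by omega) hk)
      _ < 2 ^ P * (s + 1) ^ e := Nat.mul_lt_mul_of_pos_right Nat.lt_two_pow_self (by positivity)
      _ ≤ 2 ^ P * (2 ^ ℓ) ^ e := by gcongr
      _ = 2 ^ u := by rw [hu, pow_add 2 P, ← pow_mul, mul_comm ℓ e]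
  have hr' : Δ * (n + 2) ^ (g + 1) ≤ (Δ * 2 ^ (g + 1)) * ((s + 1) * (n + 1)) := by
    rw [mul_assoc]; gcongr
  refine (hS r b R B w u x σ n hw (by omega) hr hb hσ hn hmin ?_ ?_ ?_ ?_ ?_).mono ?_
    fun _ h => h
  · intro a ha
    refine (K.abs_le x a ha).trans_lt ?_
    have h1 : K.bound * (s + 1) ^ K.bound < (n + 2) ^ D := by
      calc K.bound * (s + 1) ^ K.bound < 2 ^ K.bound * (s + 1) ^ K.bound :=
            Nat.mul_lt_mul_of_pos_right Nat.lt_two_pow_self (by positivity)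
        _ ≤ (n + 2) ^ K.bound * ((n + 2) ^ g) ^ K.bound := by gcongr <;> omega
        _ = (n + 2) ^ D := by rw [hD, pow_add, pow_mul]
    exact_mod_cast h1
  · refine lt_of_le_of_lt ?_ (hpoly (Δ * 2 ^ (g + 1)) 2 (by omega) (by omega))
    refine hr'.trans ?_
    rw [pow_two]
    gcongr
  · refine lt_of_le_of_lt ?_ (hpoly 2 1 (by omega) (by omega))
    rw [pow_one]
    change s + 2 ≤ _
    omega
  · intro a ha
    refine (K.abs_le x a ha).trans_lt ?_
    exact_mod_cast hpoly K.bound K.bound (by omega) (by omega)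
  · refine (K.abs_total_le x).trans_lt ?_
    exact_mod_cast hpoly K.boundG (Fintype.card K.ι) (by omega) (by omega)
  · refine Nat.le_floor ?_
    have hs1 : (1 : ℝ) ≤ (s : ℝ) + 1 := by linarith [Nat.cast_nonneg (α := ℝ) s]
    have hn1 : ((n : ℝ) + 1) ≤ ((s : ℝ) + 1) ^ (γ / 2) := by
      calc ((n : ℝ) + 1) = (((n : ℝ) + 1) ^ g) ^ (1 / (g : ℝ)) := by
            rw [one_div, Real.pow_rpow_inv_natCast (by positivity) hg1]
        _ ≤ ((s : ℝ) + 1) ^ (1 / (g : ℝ)) := by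
            refine Real.rpow_le_rpow (by positivity) ?_ (by positivity)
            exact_mod_cast hng
        _ ≤ _ := Real.rpow_le_rpow_of_exponent_le hs1 hgγ
    have hpow : (0 : ℝ) ≤ ((s : ℝ) + 1) ^ (γ / 2) := by positivity
    have hpow1 : (1 : ℝ) ≤ ((s : ℝ) + 1) ^ (γ / 2) := Real.one_le_rpow hs1 (by positivity)
    have h1 : ((Δ * (n + 2) ^ (g + 1) + s + 1 : ℕ) : ℝ) ≤
        (Δ * 2 ^ (g + 1) + 1) * (((s : ℝ) + 1) * ((s : ℝ) + 1) ^ (γ / 2)) := by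
      have h2 : ((Δ * (n + 2) ^ (g + 1) : ℕ) : ℝ) ≤
          (Δ * 2 ^ (g + 1)) * (((s : ℝ) + 1) * ((n : ℝ) + 1)) := by exact_mod_cast hr'
      have h3 : (Δ * 2 ^ (g + 1) : ℝ) * (((s : ℝ) + 1) * ((n : ℝ) + 1)) ≤
          (Δ * 2 ^ (g + 1)) * (((s : ℝ) + 1) * ((s : ℝ) + 1) ^ (γ / 2)) := by gcongr
      have h4 : (s : ℝ) + 1 ≤ ((s : ℝ) + 1) * ((s : ℝ) + 1) ^ (γ / 2) :=
        le_mul_of_one_le_right (by positivity) hpow1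
      rw [add_assoc, Nat.cast_add]
      push_cast at h2 ⊢
      linarith
    have h2 : (u : ℝ) ^ 2 ≤ (P + e) ^ 2 * (C₁ * ((s : ℝ) + 1) ^ (γ / 2)) := by
      have hl : (ℓ : ℝ) ^ 2 ≤ C₁ * ((s + 1 : ℕ) : ℝ) ^ (γ / 2) := hlog (s + 1) (by omega)
      have h3 : u ≤ (P + e) * ℓ := by
        rw [hu, add_mul P e ℓ]
        have : P ≤ P * ℓ := Nat.le_mul_of_pos_right _ (Nat.succ_pos _)
        omega
      calc (u : ℝ) ^ 2 ≤ (((P + e) * ℓ : ℕ) : ℝ) ^ 2 := by gcongr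
        _ = (P + e) ^ 2 * (ℓ : ℝ) ^ 2 := by push_cast; ring
        _ ≤ _ := by
          gcongr
          push_cast at hl
          exact hl
    have h3 : ((s : ℝ) + 1) * ((s : ℝ) + 1) ^ (γ / 2) * ((s : ℝ) + 1) ^ (γ / 2) =
        ((s : ℝ) + 1) ^ (1 + γ) := by
      rw [mul_assoc, ← Real.rpow_add (by positivity), add_halves,
        Real.rpow_add (by positivity), Real.rpow_one]
    have h4 := succ_rpow_le (a := 1 + γ) (by positivity) s
    rw [Nat.cast_mul, Nat.cast_mul, Nat.cast_pow]
    calc _ ≤ (c : ℝ) * ((Δ * 2 ^ (g + 1) + 1) * (((s : ℝ) + 1) * ((s : ℝ) + 1) ^ (γ / 2))) *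
          ((P + e) ^ 2 * (C₁ * ((s : ℝ) + 1) ^ (γ / 2))) := by gcongr
      _ = c * (Δ * 2 ^ (g + 1) + 1) * ((P + e) ^ 2 * C₁) *
          (((s : ℝ) + 1) * ((s : ℝ) + 1) ^ (γ / 2) * ((s : ℝ) + 1) ^ (γ / 2)) := by ring
      _ ≤ c * (Δ * 2 ^ (g + 1) + 1) * ((P + e) ^ 2 * C₁) *
          (2 ^ (1 + γ) * ((s : ℝ) ^ (1 + γ) + 1)) := by
        rw [h3]; gcongr
      _ = _ := by ring

end Counting

/-! ### Consequences for problems with a counting presentation -/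

theorem wordSize_pos (n : ℕ) : 0 < wordSize n := Nat.succ_pos _

theorem bits_zero (γ : ℝ) :
    (fun s : ℕ => (((fun _ => 0 : ℕ → ℕ) s : ℕ) : ℝ)) =O[atTop] fun s : ℕ => (s : ℝ) ^ γ := by
  simpa using isBigO_zero (E' := ℝ) (fun s : ℕ => (s : ℝ) ^ γ) atTop

/-- The input stands in bank `0` just as a question would, so the solver is itself the algorithm. -/
theorem Counting.exists_mem_POTIME {A : Problem} (K : Counting A) {ε : ℝ} (hε : 0 < ε) :
    ∃ Q : PolyFamily, Explicit Q ∧ A ∈ POTIME (fun s => (s : ℝ) ^ (1 + ε)) Q := by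
  obtain ⟨Q, hQ, C, hC, h⟩ := K.exists_fast_solver hε
  obtain ⟨S, hS⟩ := h 1 1
  refine ⟨Q, hQ, S 0 0, fun _ => 0, C, fun γ _ => bits_zero γ, fun x => ?_⟩
  obtain ⟨σ, T, qs, h1, h2, -, -, h3⟩ := hS _ (wordSize_pos _) 0 one_pos 0 one_pos x
    (initState (A.encode x)) fun i hi => by simp [initState, hi]
  refine ⟨σ, T, qs, h1, h3, (Nat.cast_le.2 h2).trans (Nat.floor_le (by positivity))⟩

/-- By `hγ`, the cost `y ^ (1 + γ)` of answering a question of size `y` is `(y ^ (1 + ε)) ^ (1 -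
ε')`, the quantity whose sum the reduction keeps below `2 ^ ((1 - δ ε') n)` up to a constant. The
solver is deterministic, so subtracting its final answer from 1 turns satisfiability into
unsatisfiability. -/
theorem kTAUT_mem_POTIME {A : Problem} {γ : ℝ} {Q : PolyFamily} {C : ℝ}
    (hC : 0 ≤ C)
    (hsolve : ∀ R B : ℕ, ∃ S : ℕ → ℕ → Program, ∀ w, 0 < w →
      Answers A (polyOracle Q fun _ => 0) w R B
        (fun y => ⌊C * ((A.size y : ℝ) ^ (1 + γ) + 1)⌋₊) S)
    {ε ε' : ℝ} (hγ : (1 + ε) * (1 - ε') = 1 + γ) (hε' : 0 < ε') {δ : ℝ → ℝ} {k : ℕ}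
    (hred : FineGrainedReduces δ (kSAT k) (fun n => (2 : ℝ) ^ (n : ℝ)) A
      fun s => (s : ℝ) ^ (1 + ε)) :
    kTAUT k ∈ POTIME (fun n => (2 : ℝ) ^ ((1 - δ ε') * (n : ℝ))) Q := by
  obtain ⟨prog, d, t, hprog⟩ := hred ε' hε'
  obtain ⟨N, hN⟩ := prog.exists_below
  -- The successor ensures that the output register `0` belongs to the protected range.
  obtain ⟨S, hS⟩ := hsolve (N + 1) (N + 1)
  -- In the constant, `d` pays for the reduction itself, one `C * d` for the sizes of the questions,
  -- the other for the additive constant per question, and `20` for the final subtraction.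
  refine ⟨.seq (prog.replaceQueries S) (.assign 0 (.bin .sub (.const 1) (.reg 0))), fun _ => 0,
    (d + C * d + C * d) + 20, fun γ _ => bits_zero γ, fun φ => ?_⟩
  obtain ⟨σ, T, ys, hex, hans, hT, -, hsum⟩ := hprog φ
  set n := (kSAT k).size φ with hn
  have hsize : (kTAUT k).size φ = n := rfl
  have henc : (kTAUT k).encode φ = (kSAT k).encode φ := rfl
  rw [hsize, henc]
  set w := wordSize n with hw
  obtain ⟨τ, T', qs', h1, h2, h3⟩ := Exec.replaceQueries (hS w (wordSize_pos n)) hex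
    (hN.mono (Nat.le_succ N) (Nat.le_succ N)) _ ⟨fun _ _ => rfl, fun _ _ => rfl⟩ ys rfl
  have hτ0 : τ.reg 0 = truthValue ((kSAT k).Yes φ) := by
    rw [← h3.1 0 (Nat.succ_pos N), hans]
  refine ⟨_, _, _, Exec.seq _ _ _ _ _ _ _ _ _ h1 (Exec.assign τ 0 _), ?_, ?_⟩
  · simp only [RAMState.setReg, Function.update_self, Expr.eval, ArithOp.eval, hτ0]
    change 1 - truthValue φ.Satisfiable = truthValue ¬ φ.Satisfiable
    unfold truthValue
    split_ifs <;> simp_all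
  · have hlen : ys.length ≤ T := by simpa using hex.length_le
    have hcostw : ∀ z : ℤ, z = 0 ∨ z = 1 → words w z ≤ 2 := by
      intro z hz
      refine (Fits.words_le (u := 1) ?_)
      have h0 := wordSize_pos n
      unfold Fits
      have : 1 < 2 ^ (w * 1) := Nat.one_lt_two_pow (by omega)
      rcases hz with rfl | rfl
      · simp
      · simpa using this
    have hlast : 1 + Expr.cost w τ (.bin .sub (.const 1) (.reg 0)) ≤ 20 := by
      simp only [Expr.cost, ArithOp.cost, Expr.eval]
      have h4 : words w (τ.reg 0) ≤ 2 := hcostw _ (by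
        rw [hτ0]; unfold truthValue; split_ifs <;> simp)
      have h5 := hcostw 1 (Or.inr rfl)
      omega
    have hrate : ((2 : ℝ) ^ (n : ℝ)) ^ (1 - δ ε') = 2 ^ ((1 - δ ε') * (n : ℝ)) := by
      rw [← Real.rpow_mul (by norm_num), mul_comm]
    simp only [hrate] at hT hsum
    set X := (2 : ℝ) ^ ((1 - δ ε') * (n : ℝ)) with hX
    have hX0 : 0 ≤ X := by positivity
    have hcost : (((ys.map fun y => ⌊C * ((A.size y : ℝ) ^ (1 + γ) + 1)⌋₊).sum : ℕ) : ℝ) ≤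
        C * (ys.map fun y => ((A.size y : ℝ) ^ (1 + ε)) ^ (1 - ε')).sum + C * ys.length := by
      clear hex hlen hsum h2
      induction ys with
      | nil => simp
      | cons y ys ih =>
        simp only [List.map_cons, List.sum_cons, List.length_cons]
        push_cast at ih ⊢
        have h4 : (⌊C * ((A.size y : ℝ) ^ (1 + γ) + 1)⌋₊ : ℝ) ≤
            C * ((A.size y : ℝ) ^ (1 + γ) + 1) := Nat.floor_le (by positivity)
        rw [← Real.rpow_mul (by positivity), hγ]
        linarith
    have hlenR : (ys.length : ℝ) ≤ d * X := (Nat.cast_le.2 hlen).trans hT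
    have hT' : (T' : ℝ) ≤ T + ((ys.map fun y =>
        ⌊C * ((A.size y : ℝ) ^ (1 + γ) + 1)⌋₊).sum : ℕ) := by exact_mod_cast h2
    have hdX : 0 ≤ d * X := le_trans (Nat.cast_nonneg _) hT
    have h5 : C * (ys.map fun y => ((A.size y : ℝ) ^ (1 + ε)) ^ (1 - ε')).sum ≤ C * (d * X) := by
      gcongr
    have h6 : C * (ys.length : ℝ) ≤ C * (d * X) := by gcongr
    have h7 : ((1 + Expr.cost w τ (.bin .sub (.const 1) (.reg 0)) : ℕ) : ℝ) ≤ 20 := by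
      exact_mod_cast hlast
    rw [Nat.cast_add]
    have hX1 : 0 < X := by positivity
    have hd : 0 ≤ d := nonneg_of_mul_nonneg_left hdX hX1
    calc _ ≤ (d + C * d + C * d) * X + 20 := by linarith
      _ ≤ _ := by
        have h8 : 0 ≤ (d + C * d + C * d) := by positivity
        nlinarith

/-- A solver of exponent `1 + ε / 2` beats the exponent `1 + ε`; the value `ε' = ε / (2 * (1 + ε))`
solves `(1 + ε) * (1 - ε') = 1 + ε / 2`. Neither `Q` nor `δ ε'` depends on `k`, as the order of
quantifiers in POSETH requires. -/
theorem Counting.not_SETHHard {A : Problem} (K : Counting A) {ε : ℝ} (hε : 0 < ε)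
    (h : POSETH) : ¬ SETHHard (fun s => (s : ℝ) ^ (1 + ε)) A := by
  rintro ⟨δ, hδ, hred⟩
  obtain ⟨Q, hQ, C, hC, hsolve⟩ := K.exists_fast_solver (half_pos hε)
  have hε' : 0 < ε / (2 * (1 + ε)) := by positivity
  obtain ⟨k, hk⟩ := h (δ (ε / (2 * (1 + ε)))) (hδ _ hε') Q hQ
  refine hk (kTAUT_mem_POTIME hC hsolve ?_ hε' (hred k))
  field_simp
  ring

end FineGrained

namespace FineGrained

/-! ### `k`-SUM and Collinearity -/

/-- The finitely many values before the asymptotic bound sets in are absorbed by their sum. The same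
number serves as factor and exponent, and `n + 1` in place of `n` takes care of `n = 0`. -/
theorem exists_poly_bound {W : ℕ → ℕ}
    (hW : ∃ c : ℕ, (fun n => (W n : ℝ)) =O[atTop] fun n : ℕ => (n : ℝ) ^ c) :
    ∃ c : ℕ, ∀ n, (W n : ℤ) ≤ c * ((n : ℤ) + 1) ^ c := by
  obtain ⟨c, hc⟩ := hW
  obtain ⟨C, hC⟩ := hc.bound
  obtain ⟨N, hN⟩ := eventually_atTop.1 hC
  set S := ∑ n ∈ Finset.range N, W n with hS
  refine ⟨c + ⌈|C|⌉₊ + S, fun n => ?_⟩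
  have h1 : W n ≤ (⌈|C|⌉₊ + S) * (n + 1) ^ c := by
    rcases lt_or_ge n N with h | h
    · have h2 : W n ≤ S :=
        Finset.single_le_sum (f := W) (fun _ _ => Nat.zero_le _) (Finset.mem_range.2 h)
      calc W n ≤ S := h2
        _ ≤ ⌈|C|⌉₊ + S := by omega
        _ ≤ _ := Nat.le_mul_of_pos_right _ (by positivity)
    · have h2 := hN n h
      rw [Real.norm_of_nonneg (by positivity), Real.norm_of_nonneg (by positivity)] at h2
      have h3 : (W n : ℝ) ≤ ((⌈|C|⌉₊ * (n + 1) ^ c : ℕ) : ℝ) := by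
        push_cast
        calc (W n : ℝ) ≤ C * (n : ℝ) ^ c := h2
          _ ≤ ⌈|C|⌉₊ * ((n : ℝ) + 1) ^ c := by
            gcongr
            · exact (le_abs_self C).trans (Nat.le_ceil _)
            · linarith
      have h4 : W n ≤ ⌈|C|⌉₊ * (n + 1) ^ c := by exact_mod_cast h3
      exact h4.trans (Nat.mul_le_mul_right _ (by omega))
  have h2 : (⌈|C|⌉₊ + S) * (n + 1) ^ c ≤
      (c + ⌈|C|⌉₊ + S) * (n + 1) ^ (c + ⌈|C|⌉₊ + S) :=
    Nat.mul_le_mul (by omega) (Nat.pow_le_pow_right (by omega) (by omega))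
  exact_mod_cast h1.trans h2

theorem poly_bound_mono {c d s t : ℕ} (hc : c ≤ d) (hs : s ≤ t) :
    (c : ℤ) * ((s : ℤ) + 1) ^ c ≤ d * ((t : ℤ) + 1) ^ d := by
  have : c * (s + 1) ^ c ≤ d * (t + 1) ^ d :=
    Nat.mul_le_mul hc ((Nat.pow_le_pow_left (by omega) c).trans
      (Nat.pow_le_pow_right (by omega) hc))
  exact_mod_cast this

theorem le_poly_bound {s t : ℕ} (d : ℕ) (hs : s ≤ t) :
    (s : ℤ) ≤ (d + 1 : ℕ) * ((t : ℤ) + 1) ^ (d + 1) := by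
  have h : s ≤ (d + 1) * (t + 1) ^ (d + 1) :=
    calc s ≤ t + 1 := by omega
      _ ≤ (t + 1) ^ (d + 1) := Nat.le_self_pow (by omega) _
      _ ≤ _ := Nat.le_mul_of_pos_left _ (by omega)
  exact_mod_cast h

theorem sum_indicator_pos_iff {α : Type*} (s : Finset α) (p : α → Prop) [DecidablePred p] :
    (0 : ℤ) < ∑ i ∈ s, (if p i then (1 : ℤ) else 0) ↔ ∃ i ∈ s, p i := by
  rw [Finset.sum_boole, Nat.cast_pos, Finset.card_pos, Finset.filter_nonempty_iff]

theorem SumInput.getD_encode {k : ℕ} {W : ℕ → ℕ} (x : SumInput k W) (t : Fin k) {i : ℕ}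
    (hi : i < x.n) : x.encode.getD (1 + t * x.n + i) 0 = x.elt t ⟨i, hi⟩ := by
  have h1 : (t : ℕ) * x.n + i < k * x.n := by
    calc (t : ℕ) * x.n + i < t * x.n + x.n := by omega
      _ = (t + 1) * x.n := by ring
      _ ≤ k * x.n := Nat.mul_le_mul_right _ t.isLt
  have h2 : (⟨(t : ℕ) * x.n + i, h1⟩ : Fin (k * x.n)) = finProdFinEquiv (t, ⟨i, hi⟩) := by
    ext
    simp [finProdFinEquiv_apply_val, add_comm, mul_comm]
  rw [SumInput.encode, add_assoc, add_comm 1, List.getD_cons_succ,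
    List.getD_eq_getElem _ _ (by simpa using h1), List.getElem_ofFn, h2,
    Equiv.symm_apply_apply]

/-- The presentation of `k`-SUM as a counting problem. -/
def kSumCounting (k : ℕ) (W : ℕ → ℕ) (c : ℕ) (hc : ∀ n, (W n : ℤ) ≤ c * ((n : ℤ) + 1) ^ c) :
    Counting (kSum k W) where
  -- The additional position has a single element and no influence; it makes the set of positions
  -- nonempty also for `k = 0`.
  ι := Option (Fin k)
  fintype := inferInstance
  decEq := inferInstance
  nonempty := inferInstance
  F := 0
  G _ l := if ∑ t, l (some t) 0 = 0 then 1 else 0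
  arith_G := (Arith.sum _ fun _ => Arith.var _).eq (Arith.const 0)
  boundG := 1
  abs_G_le i l := by split_ifs <;> simp
  header := 0
  sz a _ := a
  arith_sz := Arith.var _
  cnt t a _ := t.elim 1 fun _ => a
  arith_cnt t := by
    cases t
    · exact Arith.const 1
    · exact Arith.var _
  addr t _ a _ i := t.elim 0 fun t => 1 + (t : ℕ) * a + i
  arith_addr t _ := by
    cases t
    · exact Arith.const 0
    · exact ((Arith.const _).add ((Arith.const _).mul (Arith.var _))).add (Arith.var _)
  num x t := t.elim 1 fun _ => x.n
  pos x t _ i := t.elim 0 fun t => 1 + (t : ℕ) * x.n + i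
  header_lt x := Nat.succ_pos _
  sz_eq x := rfl
  cnt_eq x t := by cases t <;> rfl
  num_le x t := by
    cases t
    · exact Nat.le_add_left _ _
    · exact Nat.le_succ _
  addr_eq x t _ i _ := by
    cases t
    · rfl
    · simp [kSum, SumInput.encode]
  pos_lt x t _ i hi := by
    cases t with
    | none => exact Nat.succ_pos _
    | some t =>
      have h1 : i < x.n := hi
      have h2 : ((t : ℕ) + 1) * x.n ≤ k * x.n := Nat.mul_le_mul_right _ t.isLt
      simp only [Option.elim, kSum, SumInput.encode, List.length_cons, List.length_ofFn]
      rw [add_mul] at h2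
      omega
  bound := c + 1
  abs_le x a ha := by
    change a ∈ x.encode at ha
    change |a| ≤ ((c + 1 : ℕ) : ℤ) * ((x.n : ℤ) + 1) ^ (c + 1)
    simp only [SumInput.encode, List.mem_cons, List.mem_ofFn] at ha
    rcases ha with rfl | ⟨t, rfl⟩
    · rw [abs_of_nonneg (by positivity)]
      exact le_poly_bound c le_rfl
    · exact (x.elt_le _ _).trans ((hc _).trans (poly_bound_mono (by omega) le_rfl))
  yes_iff x := by
    rw [sum_indicator_pos_iff]
    constructor
    · rintro ⟨e, he⟩
      refine ⟨fun t => t.elim 0 fun t => (e t : ℕ), ?_, ?_⟩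
      · rw [Fintype.mem_piFinset]
        rintro (_ | t)
        · simp
        · simp
      · exact (Finset.sum_congr rfl fun t _ => x.getD_encode t (e t).isLt).trans he
    · rintro ⟨i, hi, h⟩
      rw [Fintype.mem_piFinset] at hi
      have hi' : ∀ t, i (some t) < x.n := fun t => Finset.mem_range.1 (hi (some t))
      exact ⟨fun t => ⟨i (some t), hi' t⟩,
        (Finset.sum_congr rfl fun t _ => (x.getD_encode t (hi' t)).symm).trans h⟩

/-- The equation is the vanishing of the cross product of `b - a` and `c - a`. Conversely `b - a`
serves as direction, and the multiple giving `c - a` is read off from a coordinate in which `b - a`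
does not vanish. -/
theorem collinear_toPlane_iff {a b c : ℤ × ℤ} (hab : a ≠ b) :
    Collinear ℝ {toPlane a, toPlane b, toPlane c} ↔
      (b.1 - a.1) * (c.2 - a.2) = (b.2 - a.2) * (c.1 - a.1) := by
  have hcast : ((b.1 - a.1) * (c.2 - a.2) = (b.2 - a.2) * (c.1 - a.1)) ↔
      ((b.1 : ℝ) - a.1) * (c.2 - a.2) = (b.2 - a.2) * (c.1 - a.1) := by
    exact_mod_cast Iff.rfl
  rw [hcast, collinear_iff_of_mem (p₀ := toPlane a) (by simp)]
  simp only [Set.mem_insert_iff, Set.mem_singleton_iff, forall_eq_or_imp, forall_eq, toPlane,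
    vadd_eq_add]
  constructor
  · rintro ⟨⟨v₁, v₂⟩, -, ⟨r, hr⟩, ⟨q, hq⟩⟩
    simp only [Prod.smul_mk, smul_eq_mul, Prod.mk_add_mk, Prod.mk.injEq] at hr hq
    rw [hr.1, hr.2, hq.1, hq.2]
    ring
  · intro h
    refine ⟨((b.1 : ℝ) - a.1, (b.2 : ℝ) - a.2), ⟨0, by simp⟩, ⟨1, by simp⟩, ?_⟩
    by_cases h1 : (b.1 : ℝ) - a.1 = 0
    · have h2 : (b.2 : ℝ) - a.2 ≠ 0 := by
        intro h2
        refine hab (Prod.ext ?_ ?_)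
        · exact_mod_cast (sub_eq_zero.1 h1).symm
        · exact_mod_cast (sub_eq_zero.1 h2).symm
      refine ⟨(c.2 - a.2) / (b.2 - a.2), ?_⟩
      have h3 : (c.1 : ℝ) - a.1 = 0 := by
        rw [h1, zero_mul] at h
        exact (mul_eq_zero.1 h.symm).resolve_left h2
      simp only [Prod.smul_mk, smul_eq_mul, Prod.mk_add_mk, Prod.mk.injEq]
      constructor
      · rw [h1]; linarith
      · field_simp; ring
    · refine ⟨(c.1 - a.1) / (b.1 - a.1), ?_⟩
      simp only [Prod.smul_mk, smul_eq_mul, Prod.mk_add_mk, Prod.mk.injEq]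
      constructor
      · field_simp; ring
      · field_simp; linarith

theorem PointsInput.getD_encode {W : ℕ → ℕ} (x : PointsInput W) {i : ℕ} (hi : i < x.n) :
    x.encode.getD (1 + 0 * x.n + i) 0 = (x.pt ⟨i, hi⟩).1 ∧
      x.encode.getD (1 + 1 * x.n + i) 0 = (x.pt ⟨i, hi⟩).2 := by
  constructor
  · rw [PointsInput.encode, add_assoc, add_comm 1, List.getD_cons_succ,
      List.getD_append _ _ _ _ (by simpa using hi), List.getD_eq_getElem _ _ (by simpa using hi)]
    simp
  · rw [PointsInput.encode, add_assoc, add_comm 1, List.getD_cons_succ,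
      List.getD_append_right _ _ _ _ (by simp), List.getD_eq_getElem _ _ (by simpa using hi)]
    simp

/-- The presentation of Collinearity as a counting problem. -/
def collinearityCounting (W : ℕ → ℕ) (c : ℕ) (hc : ∀ n, (W n : ℤ) ≤ c * ((n : ℤ) + 1) ^ c) :
    Counting (collinearity W) where
  ι := Fin 3
  fintype := inferInstance
  decEq := inferInstance
  nonempty := inferInstance
  F := 1
  G i l := if i 0 ≠ i 1 ∧ i 0 ≠ i 2 ∧ i 1 ≠ i 2 ∧
    (l 1 0 - l 0 0) * (l 2 1 - l 0 1) = (l 1 1 - l 0 1) * (l 2 0 - l 0 0) then 1 else 0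
  arith_G := ((Arith.var _).ne (Arith.var _)).and (((Arith.var _).ne (Arith.var _)).and
    (((Arith.var _).ne (Arith.var _)).and
      ((((Arith.var _).sub (Arith.var _)).mul ((Arith.var _).sub (Arith.var _))).eq
      (((Arith.var _).sub (Arith.var _)).mul ((Arith.var _).sub (Arith.var _))))))
  boundG := 1
  abs_G_le i l := by split_ifs <;> simp
  header := 0
  sz a _ := a
  arith_sz := Arith.var _
  cnt _ a _ := a
  arith_cnt _ := Arith.var _
  addr _ f a _ i := 1 + (f : ℕ) * a + i
  arith_addr _ _ := ((Arith.const _).add ((Arith.const _).mul (Arith.var _))).add (Arith.var _)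
  num x _ := x.n
  pos x _ f i := 1 + (f : ℕ) * x.n + i
  header_lt x := Nat.succ_pos _
  sz_eq x := rfl
  cnt_eq x t := rfl
  num_le x t := Nat.le_succ _
  addr_eq x t _ i _ := by simp [collinearity, PointsInput.encode]
  pos_lt x t f i hi := by
    have h2 : (f : ℕ) * x.n ≤ 1 * x.n := Nat.mul_le_mul_right _ (by omega)
    simp only [collinearity, PointsInput.encode, List.length_cons, List.length_append,
      List.length_ofFn]
    omega
  bound := c + 1
  abs_le x a ha := by
    change a ∈ x.encode at ha
    change |a| ≤ ((c + 1 : ℕ) : ℤ) * ((x.n : ℤ) + 1) ^ (c + 1)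
    simp only [PointsInput.encode, List.mem_cons, List.mem_append, List.mem_ofFn] at ha
    rcases ha with rfl | ⟨t, rfl⟩ | ⟨t, rfl⟩
    · rw [abs_of_nonneg (by positivity)]
      exact le_poly_bound c le_rfl
    · exact (x.pt_le _).1.trans ((hc _).trans (poly_bound_mono (by omega) le_rfl))
    · exact (x.pt_le _).2.trans ((hc _).trans (poly_bound_mono (by omega) le_rfl))
  yes_iff x := by
    rw [sum_indicator_pos_iff]
    have key : ∀ i j l : Fin x.n, i ≠ j →
        (Collinear ℝ {toPlane (x.pt i), toPlane (x.pt j), toPlane (x.pt l)} ↔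
        (x.encode.getD (1 + 0 * x.n + j) 0 - x.encode.getD (1 + 0 * x.n + i) 0) *
          (x.encode.getD (1 + 1 * x.n + l) 0 - x.encode.getD (1 + 1 * x.n + i) 0) =
        (x.encode.getD (1 + 1 * x.n + j) 0 - x.encode.getD (1 + 1 * x.n + i) 0) *
          (x.encode.getD (1 + 0 * x.n + l) 0 - x.encode.getD (1 + 0 * x.n + i) 0)) := by
      intro i j l hij
      rw [collinear_toPlane_iff (fun h => hij (x.pt_injective h)),
        (x.getD_encode i.isLt).1, (x.getD_encode i.isLt).2, (x.getD_encode j.isLt).1,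
        (x.getD_encode j.isLt).2, (x.getD_encode l.isLt).1, (x.getD_encode l.isLt).2]
    constructor
    · rintro ⟨i, j, l, hij, hil, hjl, h⟩
      refine ⟨![i, j, l], ?_, ?_, ?_, ?_, ?_⟩
      · rw [Fintype.mem_piFinset]
        intro t
        fin_cases t <;> simp
      · simpa [Fin.val_inj] using hij
      · simpa [Fin.val_inj] using hil
      · simpa [Fin.val_inj] using hjl
      · exact (key i j l hij).1 h
    · rintro ⟨i, hi, h01, h02, h12, h⟩
      rw [Fintype.mem_piFinset] at hi
      have hi' : ∀ t, i t < x.n := fun t => Finset.mem_range.1 (hi t)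
      have h01' : (⟨i 0, hi' 0⟩ : Fin x.n) ≠ ⟨i 1, hi' 1⟩ := by
        simpa using h01
      refine ⟨⟨i 0, hi' 0⟩, ⟨i 1, hi' 1⟩, ⟨i 2, hi' 2⟩, h01', ?_, ?_, ?_⟩
      · simpa using h02
      · simpa using h12
      · exact (key _ _ _ h01').2 h

end FineGrained

namespace FineGrained

/-! ### Induced subgraphs -/

/-- A graph on an initial segment of the natural numbers. -/
abbrev Pattern := Σ k : ℕ, SimpleGraph (Fin k)

/-- Adjacency in a pattern. -/
def Pattern.Adj (H : Pattern) (a c : ℕ) : Prop :=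
  ∃ (ha : a < H.1) (hc : c < H.1), H.2.Adj ⟨a, ha⟩ ⟨c, hc⟩

/-- The pairs `u, v` and `x, y` coincide up to order. -/
def Joins (u v x y : ℤ) : Prop := (x = u ∧ y = v) ∨ (x = v ∧ y = u)

instance (u v x y : ℤ) : Decidable (Joins u v x y) :=
  inferInstanceAs (Decidable ((x = u ∧ y = v) ∨ (x = v ∧ y = u)))

/-- The factor for the pair `a, c` of vertices of the pattern, mapped to the vertices `u - 1` and
`v - 1`, and the edge `e - 1` with ends `x` and `y`; here `e = 0` means that there is no edge.
The sum over all `e` is `1` if the pair is mapped correctly, and `0` otherwise. -/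
noncomputable def pairWeight (H : Pattern) (a c : ℕ) (u v e x y : ℤ) : ℤ :=
  open Classical in
  if a < c ∧ c < H.1 then
    (if u ≠ v then 1 else 0) *
      if H.Adj a c then if e ≠ 0 ∧ Joins (u - 1) (v - 1) x y then 1 else 0
      -- Non-edges are not listed in the input; summed over `e` this is one minus the number of
      -- joining edges.
      else (if e = 0 then 1 else 0) - if e ≠ 0 ∧ Joins (u - 1) (v - 1) x y then 1 else 0
  -- Pairs that play no role are forced to the symbol "no edge", so that they are counted once.
  else if e = 0 then 1 else 0

theorem abs_pairWeight_le (H : Pattern) (a c : ℕ) (u v e x y : ℤ) :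
    |pairWeight H a c u v e x y| ≤ 1 := by
  unfold pairWeight
  split_ifs <;> simp_all

theorem arith_joins {V : Type} {u v x y : (V → ℤ) → ℤ} (hu : Arith u) (hv : Arith v)
    (hx : Arith x) (hy : Arith y) :
    Arith fun ρ => if Joins (u ρ) (v ρ) (x ρ) (y ρ) then (1 : ℤ) else 0 :=
  ((hx.eq hu).and (hy.eq hv)).or ((hx.eq hv).and (hy.eq hu))

theorem arith_pairWeight (H : Pattern) (a c : ℕ) {V : Type} {u v e x y : (V → ℤ) → ℤ}
    (hu : Arith u) (hv : Arith v) (he : Arith e) (hx : Arith x) (hy : Arith y) :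
    Arith fun ρ => pairWeight H a c (u ρ) (v ρ) (e ρ) (x ρ) (y ρ) := by
  have h0 := he.eq (Arith.const 0)
  have h1 := (he.ne (Arith.const 0)).and
    (arith_joins (hu.sub (Arith.const 1)) (hv.sub (Arith.const 1)) hx hy)
  unfold pairWeight
  by_cases hac : a < c ∧ c < H.1
  · simp only [hac, and_self, if_true]
    refine (hu.ne hv).mul ?_
    by_cases hadj : H.Adj a c
    · simpa only [hadj, if_true] using h1
    · simpa only [hadj, if_false] using h0.sub h1
  · simpa only [hac, if_false] using h0

/-- The positions of a tuple: one for the threshold, one for each vertex of the pattern and one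
for each pair of vertices. -/
abbrev GraphPos (h : ℕ) := Option (Fin h ⊕ Fin h × Fin h)

section Tuple

variable (h : ℕ) (Good : ℤ → ℤ → ℤ → Prop) [∀ a b c, Decidable (Good a b c)]

/-- The weight of a tuple of vertices and edges. -/
noncomputable def tupleWeight (H : Pattern) (i : GraphPos h → ℤ) (l : GraphPos h → Fin 3 → ℤ) :
    ℤ :=
  open Classical in
  -- Patterns of different sizes share the same `h` vertex positions; superfluous positions must
  -- carry the number `0`, which denotes no vertex.
  (∏ a : Fin h, if (a : ℕ) < H.1 ↔ i (some (.inl a)) ≠ 0 then 1 else 0) *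
  (∏ p : Fin h × Fin h, pairWeight H p.1 p.2 (i (some (.inl p.1))) (i (some (.inl p.2)))
    (i (some (.inr p))) (l (some (.inr p)) 0) (l (some (.inr p)) 1)) *
  if Good (∑ p : Fin h × Fin h, if p.1 < p.2 ∧ H.Adj p.1 p.2 then l (some (.inr p)) 2 else 0)
    (∑ a : Fin h, if (a : ℕ) < H.1 then l (some (.inl a)) 0 else 0) (l none 0) then 1 else 0

theorem abs_tupleWeight_le (H : Pattern) (i : GraphPos h → ℤ) (l : GraphPos h → Fin 3 → ℤ) :
    |tupleWeight h Good H i l| ≤ 1 := by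
  unfold tupleWeight
  rw [abs_mul, abs_mul, Finset.abs_prod, Finset.abs_prod]
  refine mul_le_one₀ (mul_le_one₀ (Finset.prod_le_one (fun _ _ => abs_nonneg _) fun a _ => ?_)
    (Finset.prod_nonneg fun _ _ => abs_nonneg _)
    (Finset.prod_le_one (fun _ _ => abs_nonneg _) fun p _ => abs_pairWeight_le _ _ _ _ _ _ _ _))
    (abs_nonneg _) ?_
  all_goals split_ifs <;> simp

theorem arith_tupleWeight
    (hGood : Arith (V := Fin 3) fun ρ => if Good (ρ 0) (ρ 1) (ρ 2) then (1 : ℤ) else 0)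
    (H : Pattern) : Arith (V := GraphPos h ⊕ GraphPos h × Fin 3) fun ρ =>
      tupleWeight h Good H (fun t => ρ (.inl t)) fun t f => ρ (.inr (t, f)) := by
  classical
  unfold tupleWeight
  refine ((Arith.prod _ fun a => ?_).mul (Arith.prod _ fun p => arith_pairWeight _ _ _
    (Arith.var _) (Arith.var _) (Arith.var _) (Arith.var _) (Arith.var _))).mul ?_
  · by_cases ha : (a : ℕ) < H.1
    · simpa only [ha, true_iff] using (Arith.var _).ne (Arith.const 0)
    · simpa only [ha, false_iff, not_not] using (Arith.var _).eq (Arith.const 0)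
  · let G : Fin 3 → (GraphPos h ⊕ GraphPos h × Fin 3 → ℤ) → ℤ :=
      ![fun ρ => ∑ p : Fin h × Fin h,
          if p.1 < p.2 ∧ H.Adj p.1 p.2 then ρ (.inr (some (.inr p), 2)) else 0,
        fun ρ => ∑ a : Fin h, if (a : ℕ) < H.1 then ρ (.inr (some (.inl a), 0)) else 0,
        fun ρ => ρ (.inr (none, 0))]
    have hG : ∀ v, Arith (G v) := by
      intro v
      fin_cases v
      · change Arith fun ρ : GraphPos h ⊕ GraphPos h × Fin 3 → ℤ => ∑ p : Fin h × Fin h,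
          if p.1 < p.2 ∧ H.Adj p.1 p.2 then ρ (.inr (some (.inr p), 2)) else 0
        refine Arith.sum _ fun p => ?_
        by_cases hp : p.1 < p.2 ∧ H.Adj p.1 p.2
        · simpa only [hp, and_self, if_true] using Arith.var _
        · simpa only [hp, if_false] using Arith.const 0
      · change Arith fun ρ : GraphPos h ⊕ GraphPos h × Fin 3 → ℤ => ∑ a : Fin h,
          if (a : ℕ) < H.1 then ρ (.inr (some (.inl a), 0)) else 0
        refine Arith.sum _ fun a => ?_
        by_cases ha : (a : ℕ) < H.1
        · simpa only [ha, if_true] using Arith.var _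
        · simpa only [ha, if_false] using Arith.const 0
      · exact Arith.var _
    exact hGood.subst hG

end Tuple

namespace GraphInput

variable (X : GraphInput)

theorem adj_iff {u v : Fin X.n} :
    X.graph.Adj u v ↔ ∃ e, Joins (u : ℕ) (v : ℕ) (X.edge e).1 (X.edge e).2 := by
  have h1 : ∀ (e) (u v : Fin X.n), X.edge e = (u, v) ↔
      (((X.edge e).1 : ℕ) : ℤ) = (u : ℕ) ∧ (((X.edge e).2 : ℕ) : ℤ) = (v : ℕ) := by
    intro e u v
    simp [Prod.ext_iff, Fin.ext_iff]
  simp only [graph, SimpleGraph.fromRel_adj, h1, Joins, ← exists_or]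
  constructor
  · rintro ⟨-, e, he⟩
    exact ⟨e, he⟩
  · rintro ⟨e, he⟩
    refine ⟨?_, e, he⟩
    rintro rfl
    have := X.edge_lt e
    rw [Fin.lt_def] at this
    omega

theorem joins_unique {u v : ℤ} {e e' : Fin X.m}
    (h : Joins u v (X.edge e).1 (X.edge e).2) (h' : Joins u v (X.edge e').1 (X.edge e').2) :
    e = e' := by
  refine X.edge_injective (Prod.ext (Fin.ext ?_) (Fin.ext ?_)) <;>
  · have h1 := X.edge_lt e
    have h2 := X.edge_lt e'
    rw [Fin.lt_def] at h1 h2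
    unfold Joins at h h'
    omega

/-- Total weight of the edges joining `u` and `v`; there is at most one. -/
def edgeWeight (w : Fin X.m → ℤ) (u v : ℤ) : ℤ :=
  ∑ e, if Joins u v (X.edge e).1 (X.edge e).2 then w e else 0

theorem edgeWeight_eq {w : Fin X.m → ℤ} {u v : ℤ} {e : Fin X.m}
    (h : Joins u v (X.edge e).1 (X.edge e).2) : X.edgeWeight w u v = w e := by
  unfold edgeWeight
  rw [Finset.sum_eq_single e, if_pos h]
  · intro e' _ hne
    exact if_neg fun h' => hne (X.joins_unique h' h)
  · simp

theorem ite_mul_ite_mul_ite (p q r : Prop) [Decidable p] [Decidable q] [Decidable r]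
    [Decidable (p ∧ q ∧ r)] :
    (if p then (1 : ℤ) else 0) * (if q then 1 else 0) * (if r then 1 else 0) =
      if p ∧ q ∧ r then 1 else 0 := by
  split_ifs <;> simp_all

section Sum

variable {h : ℕ} {Good : ℤ → ℤ → ℤ → Prop} [∀ a b c, Decidable (Good a b c)] {E₁ E₂ lE : ℕ → ℤ}
  {lV : ℕ → ℤ} {thr : ℤ}

/-- At most one listed edge joins a given pair, so the number of joining edges is an indicator. -/
theorem sum_joins (h₁ : ∀ e : Fin X.m, E₁ (e + 1) = ((X.edge e).1 : ℕ))
    (h₂ : ∀ e : Fin X.m, E₂ (e + 1) = ((X.edge e).2 : ℕ)) (u v : ℤ) :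
    open Classical in
    ∑ x ∈ Finset.range (X.m + 1), (if (x : ℤ) ≠ 0 ∧ Joins u v (E₁ x) (E₂ x) then (1 : ℤ) else 0) =
      if ∃ e, Joins u v (X.edge e).1 (X.edge e).2 then 1 else 0 := by
  classical
  rw [Finset.sum_range_succ', Finset.sum_range]
  simp only [h₁, h₂]
  have h0 : ∀ x : ℕ, ((x + 1 : ℕ) : ℤ) ≠ 0 := fun x => by positivity
  simp only [h0, ne_eq, not_false_eq_true, true_and, Nat.cast_zero, not_true_eq_false, false_and,
    if_false, add_zero]
  split_ifs with hex
  · obtain ⟨e, he⟩ := hex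
    exact X.edgeWeight_eq (w := fun _ => 1) he
  · exact Finset.sum_eq_zero fun e _ => if_neg fun he => hex ⟨e, he⟩

/-- The map `a ↦ v a - 1` embeds the pattern as an induced subgraph of admissible weight. -/
def Valid (h : ℕ) (Good : ℤ → ℤ → ℤ → Prop) (lE lV : ℕ → ℤ) (thr : ℤ) (H : Pattern)
    (v : Fin h → ℕ) : Prop :=
  open Classical in
  (∀ a : Fin h, (a : ℕ) < H.1 ↔ (v a : ℤ) ≠ 0) ∧
  (∀ p : Fin h × Fin h, (p.1 : ℕ) < p.2 ∧ (p.2 : ℕ) < H.1 → (v p.1 : ℤ) ≠ v p.2 ∧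
    (H.Adj p.1 p.2 ↔ ∃ e, Joins ((v p.1 : ℤ) - 1) ((v p.2 : ℤ) - 1) (X.edge e).1 (X.edge e).2)) ∧
  Good (∑ p : Fin h × Fin h, if p.1 < p.2 ∧ H.Adj p.1 p.2 then
      X.edgeWeight (fun e => lE (e + 1)) ((v p.1 : ℤ) - 1) ((v p.2 : ℤ) - 1) else 0)
    (∑ a : Fin h, if (a : ℕ) < H.1 then lV (v a) else 0) thr

/-- The numbers of the elements of a tuple. -/
def index (v : Fin h → ℕ) (e : Fin h × Fin h → ℕ) : GraphPos h → ℕ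
  | none => 0
  | some (.inl a) => v a
  | some (.inr p) => e p

/-- The labels of the elements of a tuple. -/
def label (E₁ E₂ lE lV : ℕ → ℤ) (thr : ℤ) (i : GraphPos h → ℕ) : GraphPos h → Fin 3 → ℤ
  | none => fun _ => thr
  | some (.inl a) => fun _ => lV (i (some (.inl a)))
  | some (.inr p) => ![E₁ (i (some (.inr p))), E₂ (i (some (.inr p))), lE (i (some (.inr p)))]

/-- With the vertices fixed, the sum over the edges factors over the pairs, and each factor is the
indicator that its pair is mapped correctly. The last factor also involves the chosen edges; but
wherever the product does not vanish, the edge chosen for an adjacent pair is the one joining its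
images, so its weight is determined by `v`. -/
theorem sum_tupleWeight_edges (h₁ : ∀ e : Fin X.m, E₁ (e + 1) = ((X.edge e).1 : ℕ))
    (h₂ : ∀ e : Fin X.m, E₂ (e + 1) = ((X.edge e).2 : ℕ)) (H : Pattern) (v : Fin h → ℕ) :
    open Classical in
    ∑ e ∈ Fintype.piFinset fun _ : Fin h × Fin h => Finset.range (X.m + 1),
      tupleWeight h Good H (fun t => (index v e t : ℤ))
        (label E₁ E₂ lE lV thr (index v e)) =
      if X.Valid h Good lE lV thr H v then 1 else 0 := by
  classical
  set A : ℤ := ∏ a : Fin h, if (a : ℕ) < H.1 ↔ (v a : ℤ) ≠ 0 then 1 else 0 with hA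
  let f (p : Fin h × Fin h) (x : ℕ) : ℤ := pairWeight H p.1 p.2 (v p.1) (v p.2) x (E₁ x) (E₂ x)
  set B : ℤ := if Good (∑ p : Fin h × Fin h, if p.1 < p.2 ∧ H.Adj p.1 p.2 then
      X.edgeWeight (fun e => lE (e + 1)) ((v p.1 : ℤ) - 1) ((v p.2 : ℤ) - 1) else 0)
    (∑ a : Fin h, if (a : ℕ) < H.1 then lV (v a) else 0) thr then 1 else 0 with hB
  have hterm : ∀ e ∈ Fintype.piFinset fun _ : Fin h × Fin h => Finset.range (X.m + 1),
      tupleWeight h Good H (fun t => (index v e t : ℤ))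
        (label E₁ E₂ lE lV thr (index v e)) = A * (∏ p, f p (e p)) * B := by
    intro e he
    rw [Fintype.mem_piFinset] at he
    by_cases h0 : ∏ p, f p (e p) = 0
    · rw [h0, mul_zero, zero_mul]
      unfold tupleWeight
      have h0' : (∏ p : Fin h × Fin h, pairWeight H p.1 p.2 (index v e (some (.inl p.1)))
        (index v e (some (.inl p.2))) (index v e (some (.inr p)))
        (label E₁ E₂ lE lV thr (index v e) (some (.inr p)) 0)
        (label E₁ E₂ lE lV thr (index v e) (some (.inr p)) 1)) = 0 := h0
      rw [h0', mul_zero, zero_mul]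
    · have h3 : ∀ p : Fin h × Fin h, p.1 < p.2 ∧ H.Adj p.1 p.2 →
          lE (e p) =
            X.edgeWeight (fun e => lE (e + 1)) ((v p.1 : ℤ) - 1) ((v p.2 : ℤ) - 1) := by
        rintro p ⟨hlt, hadj⟩
        have h4 := Finset.prod_ne_zero_iff.1 h0 p (Finset.mem_univ _)
        have h5 : (p.2 : ℕ) < H.1 := hadj.2.1
        simp only [f, pairWeight] at h4
        rw [if_pos ⟨hlt, h5⟩, if_pos hadj] at h4
        have h6 := right_ne_zero_of_mul h4
        have h7 := of_not_not fun h => h6 (if_neg h)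
        obtain ⟨h8, h9⟩ := h7
        obtain ⟨k, hk⟩ := Nat.exists_eq_succ_of_ne_zero (fun h => h8 (by exact_mod_cast h))
        have h10 : k < X.m := by
          have := Finset.mem_range.1 (he p)
          omega
        rw [hk] at h9 ⊢
        have h11 := h₁ ⟨k, h10⟩
        have h12 := h₂ ⟨k, h10⟩
        simp only at h11 h12
        rw [Nat.succ_eq_add_one, h11, h12] at h9
        exact (X.edgeWeight_eq (w := fun e => lE (e + 1)) h9).symm
      have h13 : (∑ p : Fin h × Fin h, if p.1 < p.2 ∧ H.Adj p.1 p.2 then lE (e p) else 0) =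
          ∑ p : Fin h × Fin h, if p.1 < p.2 ∧ H.Adj p.1 p.2 then
            X.edgeWeight (fun e => lE (e + 1)) ((v p.1 : ℤ) - 1) ((v p.2 : ℤ) - 1) else 0 := by
        refine Finset.sum_congr rfl fun p _ => ?_
        split_ifs with hp
        · exact h3 p hp
        · rfl
      rw [hB, ← h13]
      rfl
  rw [Finset.sum_congr rfl hterm, ← Finset.sum_mul, ← Finset.mul_sum, ← Finset.prod_univ_sum]
  have hpair : ∀ p : Fin h × Fin h, ∑ x ∈ Finset.range (X.m + 1), f p x =
      if (p.1 : ℕ) < p.2 ∧ (p.2 : ℕ) < H.1 → (v p.1 : ℤ) ≠ v p.2 ∧ (H.Adj p.1 p.2 ↔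
        ∃ e, Joins ((v p.1 : ℤ) - 1) ((v p.2 : ℤ) - 1) (X.edge e).1 (X.edge e).2)
      then 1 else 0 := by
    intro p
    have hzero : ∑ x ∈ Finset.range (X.m + 1), (if (x : ℤ) = 0 then (1 : ℤ) else 0) = 1 := by
      rw [Finset.sum_eq_single 0] <;> simp
    simp only [f, pairWeight]
    by_cases hp : (p.1 : ℕ) < p.2 ∧ (p.2 : ℕ) < H.1
    · simp only [hp, and_self, if_true, true_imp_iff]
      rw [← Finset.mul_sum]
      by_cases hadj : H.Adj p.1 p.2
      · simp only [hadj, if_true, true_iff]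
        rw [X.sum_joins h₁ h₂]
        split_ifs <;> simp_all
      · simp only [hadj, if_false, false_iff]
        rw [Finset.sum_sub_distrib, hzero, X.sum_joins h₁ h₂]
        split_ifs <;> simp_all
    · simp only [hp, if_false, false_imp_iff, if_true]
      exact hzero
  simp only [hpair]
  rw [hA, Finset.prod_ite_zero, Finset.prod_ite_zero, hB]
  simp only [Finset.mem_univ, true_imp_iff, Finset.prod_const_one]
  exact (ite_mul_ite_mul_ite _ _ _).trans (if_congr Iff.rfl rfl rfl)

theorem sum_tupleWeight (h₁ : ∀ e : Fin X.m, E₁ (e + 1) = ((X.edge e).1 : ℕ))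
    (h₂ : ∀ e : Fin X.m, E₂ (e + 1) = ((X.edge e).2 : ℕ)) (H : Pattern)
    (num : GraphPos h → ℕ) (hnone : num none = 1) (hv : ∀ a, num (some (.inl a)) = X.n + 1)
    (he : ∀ p, num (some (.inr p)) = X.m + 1) :
    open Classical in
    ∑ i ∈ Fintype.piFinset fun t => Finset.range (num t),
      tupleWeight h Good H (fun t => (i t : ℤ)) (label E₁ E₂ lE lV thr i) =
      ∑ v ∈ Fintype.piFinset fun _ : Fin h => Finset.range (X.n + 1),
        if X.Valid h Good lE lV thr H v then 1 else 0 := by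
  classical
  simp only [← X.sum_tupleWeight_edges h₁ h₂]
  rw [← Finset.sum_product']
  symm
  refine Finset.sum_bij' (fun q _ => index q.1 q.2)
    (fun i _ => (fun a => i (some (.inl a)), fun p => i (some (.inr p)))) ?_ ?_ ?_ ?_ ?_
  · rintro ⟨v, e⟩ hq
    rw [Finset.mem_product, Fintype.mem_piFinset, Fintype.mem_piFinset] at hq
    rw [Fintype.mem_piFinset]
    rintro (_ | a | p)
    · rw [hnone]; simp [index]
    · rw [hv]; exact hq.1 a
    · rw [he]; exact hq.2 p
  · intro i hi
    rw [Fintype.mem_piFinset] at hi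
    rw [Finset.mem_product, Fintype.mem_piFinset, Fintype.mem_piFinset]
    refine ⟨fun a => ?_, fun p => ?_⟩
    · rw [← hv a]; exact hi _
    · rw [← he p]; exact hi _
  · intro q _
    rfl
  · intro i hi
    rw [Fintype.mem_piFinset] at hi
    funext t
    rcases t with _ | a | p
    · have := Finset.mem_range.1 (hi none)
      rw [hnone] at this
      change 0 = i none
      omega
    · rfl
    · rfl
  · intro q _
    rfl

end Sum

/-- Embeddings and maps correspond by `v a = f a + 1`, extended by `0` outside the pattern; checking
pairs `a < c` gives injectivity and preservation of both edges and non-edges. The weights agree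
since every edge inside the image comes from exactly one pair `a < c` of adjacent pattern vertices.
-/
theorem exists_valid_iff {h : ℕ} {Good : ℤ → ℤ → ℤ → Prop} {lE lV : ℕ → ℤ} {thr : ℤ} (H : Pattern) (hH : H.1 ≤ h) :
    (∃ v ∈ Fintype.piFinset fun _ : Fin h => Finset.range (X.n + 1),
      X.Valid h Good lE lV thr H v) ↔
    ∃ f : H.2 ↪g X.graph,
      Good (∑ e with (X.edge e).1 ∈ Finset.univ.map f.toEmbedding ∧
        (X.edge e).2 ∈ Finset.univ.map f.toEmbedding, lE (e + 1))
      (∑ a, lV (f a + 1)) thr := by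
  classical
  -- the sums agree for corresponding maps
  have hsum : ∀ (f : H.2 ↪g X.graph) (v : Fin h → ℕ),
      (∀ a : Fin H.1, v (Fin.castLE hH a) = f a + 1) →
      (∑ p : Fin h × Fin h, if p.1 < p.2 ∧ H.Adj p.1 p.2 then
        X.edgeWeight (fun e => lE (e + 1)) ((v p.1 : ℤ) - 1) ((v p.2 : ℤ) - 1) else 0) =
      (∑ e with (X.edge e).1 ∈ Finset.univ.map f.toEmbedding ∧
        (X.edge e).2 ∈ Finset.univ.map f.toEmbedding, lE (e + 1)) ∧
      (∑ a : Fin h, if (a : ℕ) < H.1 then lV (v a) else 0) = ∑ a, lV (f a + 1) := by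
    intro f v hfv
    have hfv' : ∀ (a : Fin h) (ha : (a : ℕ) < H.1), (v a : ℤ) - 1 = (f ⟨a, ha⟩ : ℕ) := by
      intro a ha
      have : v a = f ⟨a, ha⟩ + 1 := hfv ⟨a, ha⟩
      omega
    constructor
    · rw [Finset.sum_filter]
      have h1 : ∀ p : Fin h × Fin h, (if p.1 < p.2 ∧ H.Adj p.1 p.2 then
          X.edgeWeight (fun e => lE (e + 1)) ((v p.1 : ℤ) - 1) ((v p.2 : ℤ) - 1) else 0) =
          ∑ e, if (p.1 < p.2 ∧ H.Adj p.1 p.2) ∧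
            Joins ((v p.1 : ℤ) - 1) ((v p.2 : ℤ) - 1) (X.edge e).1 (X.edge e).2
            then lE (e + 1) else 0 := by
        intro p
        unfold edgeWeight
        split_ifs with hp <;> simp [hp]
      simp only [h1]
      rw [Finset.sum_comm]
      refine Finset.sum_congr rfl fun e _ => ?_
      split_ifs with hmem
      · simp only [Finset.mem_map, Finset.mem_univ, true_and] at hmem
        obtain ⟨⟨a, ha⟩, ⟨c, hc⟩⟩ := hmem
        have ha' : f a = (X.edge e).1 := ha
        have hc' : f c = (X.edge e).2 := hc
        have hadj : H.2.Adj a c := by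
          rw [← f.map_adj_iff, X.adj_iff]
          exact ⟨e, Or.inl ⟨by rw [ha'], by rw [hc']⟩⟩
        -- The embedding need not be monotone, so the ends of the edge may have to be swapped.
        obtain ⟨a', c', hlt, hadj', hJ⟩ : ∃ a' c' : Fin H.1, a' < c' ∧ H.2.Adj a' c' ∧
            Joins (f a' : ℕ) (f c' : ℕ) (X.edge e).1 (X.edge e).2 := by
          rcases lt_or_gt_of_ne hadj.ne with hlt | hlt
          · exact ⟨a, c, hlt, hadj, Or.inl ⟨by rw [ha'], by rw [hc']⟩⟩
          · exact ⟨c, a, hlt, hadj.symm, Or.inr ⟨by rw [ha'], by rw [hc']⟩⟩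
        rw [Finset.sum_eq_single (Fin.castLE hH a', Fin.castLE hH c'), if_pos]
        · refine ⟨⟨hlt, a'.isLt, c'.isLt, hadj'⟩, ?_⟩
          rw [hfv' _ a'.isLt, hfv' _ c'.isLt]
          exact hJ
        · rintro ⟨a₂, c₂⟩ _ hne
          refine if_neg ?_
          rintro ⟨⟨hlt₂, ha₂, hc₂, -⟩, hJ₂⟩
          simp only at hlt₂ ha₂ hc₂ hJ₂
          rw [hfv' _ ha₂, hfv' _ hc₂] at hJ₂
          have hinj : ∀ x y : Fin H.1, ((f x : ℕ) : ℤ) = (f y : ℕ) → (x : ℕ) = y := by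
            intro x y hxy
            have : f x = f y := Fin.ext (by exact_mod_cast hxy)
            rw [f.injective this]
          have hlt' : (a' : ℕ) < c' := hlt
          have hlt₂' : (a₂ : ℕ) < c₂ := hlt₂
          have hcases : ((a₂ : ℕ) = a' ∧ (c₂ : ℕ) = c') ∨ ((a₂ : ℕ) = c' ∧ (c₂ : ℕ) = a') := by
            rcases hJ with ⟨j1, j2⟩ | ⟨j1, j2⟩ <;> rcases hJ₂ with ⟨j3, j4⟩ | ⟨j3, j4⟩
            · exact Or.inl ⟨hinj _ _ (j3.symm.trans j1), hinj _ _ (j4.symm.trans j2)⟩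
            · exact Or.inr ⟨hinj _ _ (j4.symm.trans j2), hinj _ _ (j3.symm.trans j1)⟩
            · exact Or.inr ⟨hinj _ _ (j3.symm.trans j1), hinj _ _ (j4.symm.trans j2)⟩
            · exact Or.inl ⟨hinj _ _ (j4.symm.trans j2), hinj _ _ (j3.symm.trans j1)⟩
          rcases hcases with ⟨h3, h4⟩ | ⟨h3, h4⟩
          · exact hne (Prod.ext (Fin.ext h3) (Fin.ext h4))
          · omega
        · simp
      · refine Finset.sum_eq_zero fun p _ => if_neg ?_
        rintro ⟨⟨-, ha, hc, -⟩, hJ⟩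
        rw [hfv' _ ha, hfv' _ hc] at hJ
        refine hmem ?_
        simp only [Finset.mem_map, Finset.mem_univ, true_and]
        rcases hJ with ⟨j1, j2⟩ | ⟨j1, j2⟩
        · exact ⟨⟨_, Fin.ext (by exact_mod_cast j1.symm)⟩, ⟨_, Fin.ext (by exact_mod_cast j2.symm)⟩⟩
        · exact ⟨⟨_, Fin.ext (by exact_mod_cast j1.symm)⟩, ⟨_, Fin.ext (by exact_mod_cast j2.symm)⟩⟩
    · symm
      refine Finset.sum_of_injOn (Fin.castLE hH) ((Fin.castLE_injective hH).injOn)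
        (fun _ _ => Finset.mem_coe.2 (Finset.mem_univ _)) ?_ ?_
      · intro a _ ha
        refine if_neg fun hlt => ha ?_
        exact ⟨⟨a, hlt⟩, by simp, rfl⟩
      · intro a _
        rw [hfv, if_pos]
        exact a.isLt
  constructor
  · rintro ⟨v, hv, h1, h2, h3⟩
    rw [Fintype.mem_piFinset] at hv
    have hpos : ∀ a : Fin H.1, 1 ≤ v (Fin.castLE hH a) ∧ v (Fin.castLE hH a) - 1 < X.n := by
      intro a
      have h4 := (h1 (Fin.castLE hH a)).1 a.isLt
      have h5 := Finset.mem_range.1 (hv (Fin.castLE hH a))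
      omega
    let F : Fin H.1 → Fin X.n := fun a => ⟨v (Fin.castLE hH a) - 1, (hpos a).2⟩
    have hF : ∀ a, ((F a : ℕ) : ℤ) = (v (Fin.castLE hH a) : ℤ) - 1 := by
      intro a
      have := (hpos a).1
      simp only [F]
      omega
    have hpair : ∀ a c : Fin H.1, a < c → F a ≠ F c ∧ (H.2.Adj a c ↔ X.graph.Adj (F a) (F c)) := by
      intro a c hac
      have h4 := h2 (Fin.castLE hH a, Fin.castLE hH c) ⟨hac, c.isLt⟩
      simp only at h4
      rw [← hF, ← hF] at h4
      refine ⟨fun h => h4.1 ?_, ?_⟩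
      · have h5 := congrArg Fin.val h
        have h6 := hF a
        have h7 := hF c
        omega
      · rw [X.adj_iff, ← h4.2]
        exact ⟨fun h => ⟨a.isLt, c.isLt, h⟩, fun ⟨_, _, h⟩ => h⟩
    have hinj : Function.Injective F := by
      intro a c hac
      rcases lt_trichotomy a c with hlt | rfl | hlt
      · exact absurd hac (hpair a c hlt).1
      · rfl
      · exact absurd hac.symm (hpair c a hlt).1
    let f : H.2 ↪g X.graph := ⟨⟨F, hinj⟩, by
      intro a c
      change X.graph.Adj (F a) (F c) ↔ H.2.Adj a c
      rcases lt_trichotomy a c with hlt | rfl | hlt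
      · exact (hpair a c hlt).2.symm
      · simp
      · rw [SimpleGraph.adj_comm, H.2.adj_comm]
        exact (hpair c a hlt).2.symm⟩
    refine ⟨f, ?_⟩
    obtain ⟨h4, h5⟩ := hsum f v fun a => by
      have := (hpos a).1
      change _ = (F a : ℕ) + 1
      simp only [F]
      omega
    rw [← h4, ← h5]
    exact h3
  · rintro ⟨f, hf⟩
    let v : Fin h → ℕ := fun a => if ha : (a : ℕ) < H.1 then f ⟨a, ha⟩ + 1 else 0
    have hv : ∀ a : Fin H.1, v (Fin.castLE hH a) = f a + 1 := by
      intro a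
      exact dif_pos a.isLt
    have hv' : ∀ (a : Fin h) (ha : (a : ℕ) < H.1), v a = f ⟨a, ha⟩ + 1 := fun a ha => dif_pos ha
    refine ⟨v, ?_, ?_, ?_, ?_⟩
    · rw [Fintype.mem_piFinset]
      intro a
      rw [Finset.mem_range]
      simp only [v]
      split_ifs <;> omega
    · intro a
      simp only [v]
      split_ifs with ha
      · simp only [ha, true_iff]; positivity
      · simp [ha]
    · rintro ⟨a, c⟩ ⟨hac, hc⟩
      simp only at hac hc ⊢
      have ha : (a : ℕ) < H.1 := hac.trans hc
      rw [hv' a ha, hv' c hc]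
      push_cast
      rw [add_sub_cancel_right, add_sub_cancel_right, ← X.adj_iff, f.map_adj_iff]
      refine ⟨fun h => ?_, ⟨fun ⟨_, _, h⟩ => h, fun h => ⟨ha, hc, h⟩⟩⟩
      have h1 : f ⟨a, ha⟩ = f ⟨c, hc⟩ := Fin.ext (by omega)
      have h2 := congrArg Fin.val (f.injective h1)
      simp only at h2
      omega
    · obtain ⟨h4, h5⟩ := hsum f v hv
      rw [h4, h5]
      exact hf

end GraphInput

end FineGrained

/-! ### Counting presentations of graph problems -/

namespace FineGrained

/-- Number of the elements at a position of a tuple, in a graph with `n` vertices and `m` edges. -/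
def graphNum {h : ℕ} (n m : ℕ) : GraphPos h → ℕ
  | none => 1
  | some (.inl _) => n + 1
  | some (.inr _) => m + 1

/-- Address of the labels of the `i`-th element of a position, if the threshold is stored at the
address `o + 1` and followed by the edges of the graph and the weights. The numbers `wE` and `wV`
are `0` or `1` according to whether the edges and the vertices have weights. -/
def graphAddr {h : ℕ} {R : Type} [Semiring R] (o wE wV m : R) :
    GraphPos h → Fin 3 → R → R
  -- Without a threshold (`o = 0`) this reads the entry `m`, which a trivial condition ignores.
  -- Likewise a weight factor `0` sends an address to the harmless place `0`.
  | none, _, _ => o + 1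
  | some (.inl _), _, i => wV * (o + 1 + (m + m) + i)
  | some (.inr _), f, i => ![o + 1 + i, o + 1 + m + i, wE * (o + 1 + (m + m) + i)] f

theorem cast_graphAddr {h : ℕ} (o wE wV m : ℕ) (t : GraphPos h) (f : Fin 3) (i : ℕ) :
    ((graphAddr o wE wV m t f i : ℕ) : ℤ) = graphAddr (o : ℤ) wE wV m t f i := by
  rcases t with _ | a | p
  · simp [graphAddr]
  · simp [graphAddr]
  · fin_cases f <;> simp [graphAddr]

theorem arith_graphAddr {h : ℕ} (o wE wV : ℤ) (t : GraphPos h) (f : Fin 3) :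
    Arith (V := Fin 3) fun ρ => graphAddr o wE wV (ρ 1) t f (ρ 2) := by
  have h1 : Arith (V := Fin 3) fun ρ => o + 1 + (ρ 1 + ρ 1) + ρ 2 :=
    ((Arith.const _).add ((Arith.var _).add (Arith.var _))).add (Arith.var _)
  rcases t with _ | a | p
  · exact Arith.const _
  · exact (Arith.const _).mul h1
  · fin_cases f
    · exact (Arith.const _).add (Arith.var _)
    · exact ((Arith.const _).add (Arith.var _)).add (Arith.var _)
    · exact (Arith.const _).mul h1

/-- The entries of the list at which an edge or a vertex weight is expected. -/
def weightAt (L : List ℤ) (o w m i : ℕ) : ℤ := L.getD (w * (o + 1 + (m + m) + i)) 0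

/-- The encoding of a graph together with a threshold and weights. -/
def GraphInput.encodeWith (X : GraphInput) (T R : List ℤ) : List ℤ :=
  (X.n : ℤ) :: (X.m : ℤ) :: (T ++ (X.encodeEdges ++ R))

namespace GraphInput

variable (X : GraphInput) (T R : List ℤ)

theorem length_encodeWith :
    (X.encodeWith T R).length = T.length + 2 + (X.m + X.m) + R.length := by
  simp only [encodeWith, List.length_cons, List.length_append, X.encodeEdges_length]
  omega

/-- Edges and vertices are numbered from 1, and the edge list begins at the address `T.length + 2`.
The number `0` addresses the entry before, whose value never influences a weight. -/
theorem getD_encodeWith (k : ℕ) :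
    (X.encodeWith T R).getD (T.length + 1 + (k + 1)) 0 = (X.encodeEdges ++ R).getD k 0 := by
  rw [encodeWith, ← add_assoc, List.getD_cons_succ, add_right_comm, List.getD_cons_succ,
    List.getD_append_right _ _ _ _ (by omega), Nat.add_sub_cancel_left]

theorem getD_encodeWith_fst (e : Fin X.m) :
    (X.encodeWith T R).getD (T.length + 1 + (e + 1)) 0 = ((X.edge e).1 : ℕ) := by
  rw [getD_encodeWith, encodeEdges, List.append_assoc,
    List.getD_append _ _ _ _ (by simp), List.getD_eq_getElem _ _ (by simp)]
  simp

theorem getD_encodeWith_snd (e : Fin X.m) :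
    (X.encodeWith T R).getD (T.length + 1 + X.m + (e + 1)) 0 = ((X.edge e).2 : ℕ) := by
  rw [add_assoc, ← add_assoc X.m, getD_encodeWith, encodeEdges, List.append_assoc,
    List.getD_append_right _ _ _ _ (by simp), List.length_ofFn, Nat.add_sub_cancel_left,
    List.getD_append _ _ _ _ (by simp), List.getD_eq_getElem _ _ (by simp)]
  simp

theorem weightAt_encodeWith (j : ℕ) :
    weightAt (X.encodeWith T R) T.length 1 X.m (j + 1) = R.getD j 0 := by
  rw [weightAt, one_mul, add_assoc, ← add_assoc (X.m + X.m), getD_encodeWith,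
    List.getD_append_right _ _ _ _ (by rw [X.encodeEdges_length]; omega),
    X.encodeEdges_length, Nat.add_sub_cancel_left]

theorem abs_le_of_mem_encodeWith {c : ℕ} {a : ℤ} (ha : a ∈ X.encodeWith T R)
    (hT : ∀ a ∈ T, |a| ≤ (c : ℤ) * ((X.n : ℤ) + 1) ^ c)
    (hR : ∀ a ∈ R, |a| ≤ (c : ℤ) * ((X.n : ℤ) + 1) ^ c) :
    |a| ≤ (c + 1 : ℕ) * (((X.n + X.m : ℕ) : ℤ) + 1) ^ (c + 1) := by
  have hnat : ∀ k : ℕ, k ≤ X.n + X.m →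
      |(k : ℤ)| ≤ (c + 1 : ℕ) * (((X.n + X.m : ℕ) : ℤ) + 1) ^ (c + 1) := by
    intro k hk
    rw [abs_of_nonneg (by positivity)]
    exact le_poly_bound c hk
  have hmono := poly_bound_mono (c := c) (d := c + 1) (s := X.n) (t := X.n + X.m)
    (by omega) (by omega)
  simp only [encodeWith, encodeEdges, List.mem_cons, List.mem_append, List.mem_ofFn] at ha
  rcases ha with rfl | rfl | ha | (⟨e, rfl⟩ | ⟨e, rfl⟩) | ha
  · exact hnat _ (by omega)
  · exact hnat _ (by omega)
  · exact (hT a ha).trans hmono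
  · exact hnat _ (by omega)
  · exact hnat _ (by omega)
  · exact (hR a ha).trans hmono

end GraphInput

/-- The presentation as a counting problem of a problem about the existence of an induced subgraph
from a finite list with a condition on its total weights. -/
noncomputable def graphCounting (A : Problem) (X : A.Instance → GraphInput)
    (hsize : ∀ x, A.size x = (X x).n + (X x).m) (ℋ : Finset Pattern)
    (Good : ℤ → ℤ → ℤ → Prop) [∀ a b c, Decidable (Good a b c)]
    (hGood : Arith (V := Fin 3) fun ρ => if Good (ρ 0) (ρ 1) (ρ 2) then (1 : ℤ) else 0)
    (o wE wV : ℕ) (T R : A.Instance → List ℤ) (hT : ∀ x, (T x).length = o)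
    (hE : wE = 0 ∨ wE = 1 ∧ ∀ x, (R x).length = (X x).m)
    (hV : wV = 0 ∨ wV = 1 ∧ ∀ x, (R x).length = (X x).n)
    (hencode : ∀ x, A.encode x = (X x).encodeWith (T x) (R x)) (c : ℕ)
    (hTc : ∀ x, ∀ a ∈ T x, |a| ≤ (c : ℤ) * (((X x).n : ℤ) + 1) ^ c)
    (hRc : ∀ x, ∀ a ∈ R x, |a| ≤ (c : ℤ) * (((X x).n : ℤ) + 1) ^ c)
    (hyes : ∀ x, A.Yes x ↔ ∃ H ∈ ℋ, ∃ f : H.2 ↪g (X x).graph,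
      Good (∑ e with ((X x).edge e).1 ∈ Finset.univ.map f.toEmbedding ∧
        ((X x).edge e).2 ∈ Finset.univ.map f.toEmbedding,
          weightAt (A.encode x) o wE (X x).m (e + 1))
        (∑ a, weightAt (A.encode x) o wV (X x).m (f a + 1)) ((A.encode x).getD (o + 1) 0)) :
    Counting A where
  -- The supremum provides enough vertex positions for the largest pattern.
  ι := GraphPos (ℋ.sup Sigma.fst)
  fintype := inferInstance
  decEq := inferInstance
  nonempty := inferInstance
  F := 2
  G i l := ∑ H ∈ ℋ, tupleWeight (ℋ.sup Sigma.fst) Good H i l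
  arith_G := Arith.sum _ fun H => arith_tupleWeight _ Good hGood H
  boundG := ℋ.card
  abs_G_le i l := by
    refine (Finset.abs_sum_le_sum_abs _ _).trans
      ((Finset.sum_le_card_nsmul _ _ 1 fun H _ => abs_tupleWeight_le _ Good H i l).trans ?_)
    simp
  header := 1
  sz a b := a + b
  arith_sz := (Arith.var _).add (Arith.var _)
  cnt t a b := match t with
    | none => 1
    | some (.inl _) => a + 1
    | some (.inr _) => b + 1
  arith_cnt t := by
    rcases t with _ | a | p
    · exact Arith.const _
    · exact (Arith.var _).add (Arith.const _)
    · exact (Arith.var _).add (Arith.const _)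
  addr t f _ b i := graphAddr (o : ℤ) wE wV b t f i
  arith_addr t f := arith_graphAddr _ _ _ t f
  num x := graphNum (X x).n (X x).m
  pos x t f i := graphAddr o wE wV (X x).m t f i
  header_lt x := by rw [hencode, GraphInput.length_encodeWith]; omega
  sz_eq x := by rw [hencode, hsize, GraphInput.encodeWith]; simp
  cnt_eq x t := by
    rw [hencode, GraphInput.encodeWith]
    rcases t with _ | a | p <;> simp [graphNum]
  num_le x t := by
    rw [hsize]
    rcases t with _ | a | p <;> simp only [graphNum] <;> omega
  addr_eq x t f i _ := by
    rw [hencode, cast_graphAddr]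
    rfl
  pos_lt x t f i hi := by
    rw [hencode, GraphInput.length_encodeWith, hT]
    rcases t with _ | a | p
    · simp only [graphAddr]
      omega
    · simp only [graphNum] at hi
      rcases hV with rfl | ⟨rfl, hV⟩
      · simp [graphAddr]
      · simp only [graphAddr, hV x]
        omega
    · simp only [graphNum] at hi
      fin_cases f
      · simp [graphAddr]
        omega
      · simp [graphAddr]
        omega
      · rcases hE with rfl | ⟨rfl, hE⟩
        · simp [graphAddr]
        · simp [graphAddr, hE x]
          omega
  bound := c + 1
  abs_le x a ha := by
    rw [hencode] at ha
    rw [hsize]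
    exact (X x).abs_le_of_mem_encodeWith _ _ ha (hTc x) (hRc x)
  yes_iff x := by
    classical
    rw [Finset.sum_comm, hyes]
    have h1 : ∀ i : GraphPos (ℋ.sup Sigma.fst) → ℕ,
        (fun t f => (A.encode x).getD (graphAddr o wE wV (X x).m t f (i t)) 0) =
        GraphInput.label (fun e => (A.encode x).getD (o + 1 + e) 0)
          (fun e => (A.encode x).getD (o + 1 + (X x).m + e) 0)
          (weightAt (A.encode x) o wE (X x).m) (weightAt (A.encode x) o wV (X x).m)
          ((A.encode x).getD (o + 1) 0) i := by
      intro i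
      funext t f
      rcases t with _ | a | p
      · rfl
      · rfl
      · fin_cases f <;> rfl
    simp only [h1]
    have hfst : ∀ e : Fin (X x).m,
        (A.encode x).getD (o + 1 + (e + 1)) 0 = (((X x).edge e).1 : ℕ) := by
      intro e
      rw [hencode, ← hT x, GraphInput.getD_encodeWith_fst]
    have hsnd : ∀ e : Fin (X x).m,
        (A.encode x).getD (o + 1 + (X x).m + (e + 1)) 0 = (((X x).edge e).2 : ℕ) := by
      intro e
      rw [hencode, ← hT x, GraphInput.getD_encodeWith_snd]
    rw [Finset.sum_congr rfl fun H _ => (X x).sum_tupleWeight hfst hsnd H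
      (graphNum (X x).n (X x).m) rfl (fun _ => rfl) fun _ => rfl]
    -- Once the edges are summed out, all terms are 0 or 1, so positivity detects existence although
    -- individual tuples have negative weights.
    rw [← Finset.sum_product', sum_indicator_pos_iff]
    simp only [Finset.mem_product, Prod.exists]
    constructor
    · rintro ⟨H, hH, hf⟩
      obtain ⟨v, hv, h2⟩ := ((X x).exists_valid_iff H (Finset.le_sup hH)).2 hf
      exact ⟨H, v, ⟨hH, hv⟩, h2⟩
    · rintro ⟨H, v, ⟨hH, hv⟩, h2⟩
      exact ⟨H, hH, ((X x).exists_valid_iff H (Finset.le_sup hH)).1 ⟨v, hv, h2⟩⟩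

end FineGrained

/-! ### Cliques, induced subgraphs and their weighted variants -/

namespace FineGrained

/-- Enumerating a clique in increasing order embeds the complete graph with image exactly the
clique, so conditions on the vertex set transfer. -/
theorem exists_isNClique_iff {n k : ℕ} (G : SimpleGraph (Fin n)) (P : Finset (Fin n) → Prop) :
    (∃ C, G.IsNClique k C ∧ P C) ↔
      ∃ f : (⊤ : SimpleGraph (Fin k)) ↪g G, P (Finset.univ.map f.toEmbedding) := by
  constructor
  · rintro ⟨C, hC, hP⟩
    let f : (⊤ : SimpleGraph (Fin k)) ↪g G := ⟨(C.orderEmbOfFin hC.card_eq).toEmbedding, by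
      intro a b
      rw [SimpleGraph.top_adj]
      constructor
      · rintro h rfl
        exact G.loopless.irrefl _ h
      · intro h
        exact hC.isClique (C.orderEmbOfFin_mem hC.card_eq a) (C.orderEmbOfFin_mem hC.card_eq b)
          fun h' => h ((C.orderEmbOfFin hC.card_eq).injective h')⟩
    refine ⟨f, ?_⟩
    have hf : Finset.univ.map f.toEmbedding = C := by
      change Finset.univ.map (C.orderEmbOfFin hC.card_eq).toEmbedding = C
      exact Finset.map_orderEmbOfFin_univ C hC.card_eq
    rwa [hf]
  · rintro ⟨f, hP⟩
    refine ⟨_, ⟨?_, by simp⟩, hP⟩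
    intro u hu v hv huv
    rw [Finset.mem_coe, Finset.mem_map] at hu hv
    obtain ⟨a, -, rfl⟩ := hu
    obtain ⟨b, -, rfl⟩ := hv
    refine f.map_adj_iff.2 ?_
    rw [SimpleGraph.top_adj]
    rintro rfl
    exact huv rfl

section Listed

variable {W : ℕ → ℕ}

/-- The presentation of `ℋ`-induced subgraph as a counting problem. -/
noncomputable def familyInducedSubgraphCounting (ℋ : Finset Pattern) :
    Counting (familyInducedSubgraph ℋ) :=
  graphCounting _ (fun x : GraphInput => x) (fun _ => rfl) ℋ (fun _ _ _ => True)
    (by simpa using Arith.const 1) 0 0 0 (fun _ => []) (fun _ => []) (fun _ => rfl) (.inl rfl)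
    (.inl rfl) (fun x => by simp [familyInducedSubgraph, GraphInput.encode, GraphInput.encodeWith])
    0 (by simp) (by simp) fun x => by
      simp [familyInducedSubgraph, SimpleGraph.IsIndContained, exists_true_iff_nonempty]

/-- The presentation of `H`-induced subgraph as a counting problem. -/
noncomputable def inducedSubgraphCounting {h : ℕ} (H : SimpleGraph (Fin h)) :
    Counting (inducedSubgraph H) :=
  graphCounting _ (fun x : GraphInput => x) (fun _ => rfl) {⟨h, H⟩} (fun _ _ _ => True)
    (by simpa using Arith.const 1) 0 0 0 (fun _ => []) (fun _ => []) (fun _ => rfl) (.inl rfl)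
    (.inl rfl) (fun x => by simp [inducedSubgraph, GraphInput.encode, GraphInput.encodeWith])
    0 (by simp) (by simp) fun x => by
      simp [inducedSubgraph, SimpleGraph.IsIndContained, exists_true_iff_nonempty]

theorem EdgeWeightedInput.encode_eq (x : EdgeWeightedInput W) :
    x.encode = x.toGraphInput.encodeWith [x.threshold] (List.ofFn x.weight) := rfl

theorem VertexWeightedInput.encode_eq (x : VertexWeightedInput W) :
    x.encode = x.toGraphInput.encodeWith [x.threshold] (List.ofFn x.weight) := rfl

theorem EdgeWeightedInput.weightAt_encode (x : EdgeWeightedInput W) (e : Fin x.m) :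
    weightAt x.encode 1 1 x.m (e + 1) = x.weight e := by
  have := x.toGraphInput.weightAt_encodeWith [x.threshold] (List.ofFn x.weight) e
  rw [EdgeWeightedInput.encode_eq]
  refine this.trans ?_
  rw [List.getD_eq_getElem _ _ (by simp)]
  simp

theorem EdgeWeightedInput.totalWeight_eq (x : EdgeWeightedInput W) (C : Finset (Fin x.n)) :
    x.totalWeight C = ∑ e with (x.edge e).1 ∈ C ∧ (x.edge e).2 ∈ C,
      weightAt x.encode 1 1 x.m (e + 1) :=
  Finset.sum_congr rfl fun e _ => (x.weightAt_encode e).symm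

theorem VertexWeightedInput.weightAt_encode (x : VertexWeightedInput W) (v : Fin x.n) :
    weightAt x.encode 1 1 x.m (v + 1) = x.weight v := by
  have := x.toGraphInput.weightAt_encodeWith [x.threshold] (List.ofFn x.weight) v
  rw [VertexWeightedInput.encode_eq]
  refine this.trans ?_
  rw [List.getD_eq_getElem _ _ (by simp)]
  simp

theorem EdgeWeightedInput.abs_le {c : ℕ}
    (hc : ∀ n, (W n : ℤ) ≤ c * ((n : ℤ) + 1) ^ c) (x : EdgeWeightedInput W) :
    (∀ a ∈ [x.threshold], |a| ≤ (c : ℤ) * ((x.n : ℤ) + 1) ^ c) ∧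
      ∀ a ∈ List.ofFn x.weight, |a| ≤ (c : ℤ) * ((x.n : ℤ) + 1) ^ c := by
  constructor
  · simpa using x.threshold_le.trans (hc _)
  · intro a ha
    obtain ⟨e, rfl⟩ := List.mem_ofFn.1 ha
    exact (x.weight_le e).trans (hc _)

theorem VertexWeightedInput.abs_le {c : ℕ}
    (hc : ∀ n, (W n : ℤ) ≤ c * ((n : ℤ) + 1) ^ c) (x : VertexWeightedInput W) :
    (∀ a ∈ [x.threshold], |a| ≤ (c : ℤ) * ((x.n : ℤ) + 1) ^ c) ∧
      ∀ a ∈ List.ofFn x.weight, |a| ≤ (c : ℤ) * ((x.n : ℤ) + 1) ^ c := by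
  constructor
  · simpa using x.threshold_le.trans (hc _)
  · intro a ha
    obtain ⟨e, rfl⟩ := List.mem_ofFn.1 ha
    exact (x.weight_le e).trans (hc _)

variable (c : ℕ) (hc : ∀ n, (W n : ℤ) ≤ c * ((n : ℤ) + 1) ^ c)

/-- The presentation of Minimum weight `k`-clique as a counting problem. -/
noncomputable def minWeightCliqueCounting (k : ℕ) : Counting (minWeightClique k W) :=
  graphCounting _ (fun x : EdgeWeightedInput W => x.toGraphInput) (fun _ => rfl)
    {⟨k, ⊤⟩} (fun s _ t => s ≤ t) ((Arith.var _).le (Arith.var _)) 1 1 0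
    (fun x => [x.threshold]) (fun x => List.ofFn x.weight) (fun _ => rfl)
    (.inr ⟨rfl, fun _ => List.length_ofFn⟩) (.inl rfl) (fun _ => rfl) c
    (fun x => (x.abs_le hc).1) (fun x => (x.abs_le hc).2) fun x => by
      simp only [Finset.mem_singleton, exists_eq_left]
      refine (exists_isNClique_iff x.graph fun C => x.totalWeight C ≤ x.threshold).trans ?_
      refine exists_congr fun f => ?_
      exact (congrArg (· ≤ x.threshold) (x.totalWeight_eq _)).to_iff

/-- The presentation of MAX `H`-SUBGRAPH with weights on edges as a counting problem. -/
noncomputable def maxSubgraphEdgesCounting {h : ℕ} (H : SimpleGraph (Fin h)) :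
    Counting (maxSubgraphEdges H W) :=
  graphCounting _ (fun x : EdgeWeightedInput W => x.toGraphInput) (fun _ => rfl)
    {⟨h, H⟩} (fun s _ t => t ≤ s) ((Arith.var _).le (Arith.var _)) 1 1 0
    (fun x => [x.threshold]) (fun x => List.ofFn x.weight) (fun _ => rfl)
    (.inr ⟨rfl, fun _ => List.length_ofFn⟩) (.inl rfl) (fun _ => rfl) c
    (fun x => (x.abs_le hc).1) (fun x => (x.abs_le hc).2) fun x => by
      simp only [Finset.mem_singleton, exists_eq_left]
      refine exists_congr fun f => ?_
      exact (congrArg (x.threshold ≤ ·) (x.totalWeight_eq _)).to_iff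

/-- The presentation of MAX `H`-SUBGRAPH with weights on vertices as a counting problem. -/
noncomputable def maxSubgraphVerticesCounting {h : ℕ} (H : SimpleGraph (Fin h)) :
    Counting (maxSubgraphVertices H W) :=
  graphCounting _ (fun x : VertexWeightedInput W => x.toGraphInput) (fun _ => rfl)
    {⟨h, H⟩} (fun _ s t => t ≤ s) ((Arith.var _).le (Arith.var _)) 1 0 1
    (fun x => [x.threshold]) (fun x => List.ofFn x.weight) (fun _ => rfl)
    (.inl rfl) (.inr ⟨rfl, fun _ => List.length_ofFn⟩) (fun _ => rfl) c
    (fun x => (x.abs_le hc).1) (fun x => (x.abs_le hc).2) fun x => by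
      simp only [Finset.mem_singleton, exists_eq_left]
      refine exists_congr fun f => ?_
      rw [← Finset.sum_congr rfl fun a _ => x.weightAt_encode (f a)]
      rfl

end Listed

theorem Listed.nonempty_counting {W : ℕ → ℕ}
    (hW : ∃ c : ℕ, (fun n => (W n : ℝ)) =O[atTop] fun n : ℕ => (n : ℝ) ^ c) {A : Problem}
    (hA : Listed W A) : Nonempty (Counting A) := by
  obtain ⟨c, hc⟩ := exists_poly_bound hW
  cases hA with
  | kSum k => exact ⟨kSumCounting k W c hc⟩
  | collinearity => exact ⟨collinearityCounting W c hc⟩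
  | inducedSubgraph H => exact ⟨inducedSubgraphCounting H⟩
  | familyInducedSubgraph ℋ => exact ⟨familyInducedSubgraphCounting ℋ⟩
  | minWeightClique k => exact ⟨minWeightCliqueCounting c hc k⟩
  | maxSubgraphEdges H => exact ⟨maxSubgraphEdgesCounting c hc H⟩
  | maxSubgraphVertices H => exact ⟨maxSubgraphVerticesCounting c hc H⟩

end FineGrained

theorem mainTheorem2 (W : ℕ → ℕ)
    (hW : ∃ c : ℕ, (fun n => (W n : ℝ)) =O[atTop] fun n : ℕ => (n : ℝ) ^ c)
    (A : Problem) (hA : Listed W A) (ε : ℝ) (hε : 0 < ε) :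
    (∃ Q : PolyFamily, Explicit Q ∧ A ∈ POTIME (fun s => (s : ℝ) ^ (1 + ε)) Q) ∧
      (POSETH → ¬ SETHHard (fun s => (s : ℝ) ^ (1 + ε)) A) := by
  obtain ⟨K⟩ := hA.nonempty_counting hW
  exact ⟨K.exists_mem_POTIME hε, K.not_SETHHard hε⟩
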